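/- **Model.** Fix $K,p\in\mathbb N$, a probability vector $\pi=(\pi_1,\dots,\pi_K)$ with all $\pi_k>0$, a symmetric matrix $\bar B\in[0,\infty)^{K\times K}$ that is not identically zero, a vector $\gamma^0\in\mathbb R^p$, and numbers $\rho_n>0$ with $\rho_n\to0$. Put $N_n=n(n-1)/2$. For every $n$ one observes a network on $n$ nodes from the pairwise covariates-adjusted stochastic block model (PCABM): the labels $c_1,\dots,c_n\in\{1,\dots,K\}$ are i.i.d. with distribution $\pi$; the pairwise covariates $\mathbf z_{ij}\in\mathbb R^p$ satisfy $\mathbf z_{ij}=\mathbf z_{ji}$, $\mathbf z_{ii}=0$; and the weighted adjacency matrix $A$ is symmetric with zero diagonal and entries in $\mathbb N$, where, conditionally on the labels $\mathbf c$ and the covariates $Z=(\mathbf z_{ij})$, the $A_{ij}$, $i<j$, are independent with $$A_{ij}\sim\mathrm{Poisson}(\lambda_{ij}),\qquad \lambda_{ij}=\rho_n\bar B_{c_ic_j}e^{\mathbf z_{ij}^T\gamma^0}.$$ Let $\mathbf e=\mathbf e^{(n)}\in\{1,\dots,K\}^n$ be a given initial label assignment. It is deterministic, or random and uninformative about the data,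 in the sense that $(\mathbf c,\mathbf e)$ is independent of $Z$ and that the above conditional law of $A$ is also its conditional law given $(\mathbf c,\mathbf e,Z)$; in particular $\mathbf c$ and $Z$ are independent. **Conditions.** 1. $\{\mathbf z_{ij}, i<j\}$ are i.i.d., with a law that does not depend on $n$, and $\|\mathbf z_{ij}\|_\infty\le\zeta$ almost surely for some constant $\zeta>0$. 2. With $\theta(\gamma)=\mathbb E\, e^{\mathbf z_{ij}^T\gamma}$, $\mu(\gamma)=\mathbb E\,\mathbf z_{ij}e^{\mathbf z_{ij}^T\gamma}$, $\Sigma(\gamma)=\mathbb E\,\mathbf z_{ij}\mathbf z_{ij}^Te^{\mathbf z_{ij}^T\gamma}$, the matrix $\Sigma(\gamma^0)-\theta(\gamma^0)^{-1}\mu(\gamma^0)\mu(\gamma^0)^T$ is positive definite. 3. There are constants $0<\kappa_1\le\kappa_2<1$ such that for all sufficiently large $n$, almost surely, $\kappa_1\le n_k(\mathbf e)/n\le\kappa_2$ for every $k$, where $n_k(\mathbf e)=\#\{i:e_i=k\}$. **Estimator.** Let $$\ell_{\mathbf e}(\gamma)=\sum_{i<j}A_{ij}\mathbf z_{ij}^T\gamma-\frac12\sum_{k,l=1}^K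 O_{kl}(\mathbf e)\log E_{kl}(\mathbf e,\gamma),$$ $$O_{kl}(\mathbf e)=\sum_{i,j}A_{ij}\mathbf 1(e_i=k,e_j=l),\qquad E_{kl}(\mathbf e,\gamma)=\sum_{i\ne j}e^{\mathbf z_{ij}^T\gamma}\mathbf 1(e_i=k,e_j=l)$$ (a term with $E_{kl}$ an empty sum has $O_{kl}=0$ and is read as $0$), and let $\hat\gamma(\mathbf e)$ be any measurable choice of $\arg\max_{\gamma\in\mathbb R^p}\ell_{\mathbf e}(\gamma)$, with arbitrary value when no maximizer exists. **Theorem.** As $n\to\infty$, if $N_n\rho_n\to\infty$, then $$\sqrt{N_n\rho_n}\,\bigl(\hat\gamma(\mathbf e)-\gamma^0\bigr)\xrightarrow{d}\mathcal N\bigl(0,\Sigma_\infty^{-1}(\gamma^0)\bigr),$$ where $$\Sigma_\infty(\gamma^0)=\sum_{a,b=1}^K\bar B_{ab}\pi_a\pi_b\bigl[\Sigma(\gamma^0)-\theta(\gamma^0)^{-1}\mu(\gamma^0)\mu(\gamma^0)^T\bigr]$$ is positive definite. -/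

import Mathlib

open MeasureTheory ProbabilityTheory Filter Topology

noncomputable section

namespace PCABM

/-- The pairwise covariate space `ℝᵖ`. -/
abbrev Cov (p : ℕ) : Type := EuclideanSpace ℝ (Fin p)

/-! ### Moments of the covariate law `ν`, exponentially tilted by `γ` -/

/-- `θ(γ) = 𝔼 exp(zᵀγ)` for `z ∼ ν`. -/
def theta {p : ℕ} (ν : Measure (Cov p)) (γ : Cov p) : ℝ :=
  ∫ z, Real.exp (inner ℝ z γ) ∂ν

/-- `μ(γ) = 𝔼 [z exp(zᵀγ)]` for `z ∼ ν`, as a vector of coordinates. -/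
def mu {p : ℕ} (ν : Measure (Cov p)) (γ : Cov p) : Fin p → ℝ :=
  fun r => ∫ z, z r * Real.exp (inner ℝ z γ) ∂ν

/-- `Σ(γ) = 𝔼 [z zᵀ exp(zᵀγ)]` for `z ∼ ν`. -/
def sigma {p : ℕ} (ν : Measure (Cov p)) (γ : Cov p) : Matrix (Fin p) (Fin p) ℝ :=
  Matrix.of fun r s => ∫ z, z r * z s * Real.exp (inner ℝ z γ) ∂ν

/-- `Σ(γ) - θ(γ)⁻¹ μ(γ) μ(γ)ᵀ`. -/
def tiltedCov {p : ℕ} (ν : Measure (Cov p)) (γ : Cov p) : Matrix (Fin p) (Fin p) ℝ :=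
  sigma ν γ - (theta ν γ)⁻¹ • Matrix.vecMulVec (mu ν γ) (mu ν γ)

/-- `Σ_∞(γ) = ∑_{a,b} B̄_{ab} π_a π_b [Σ(γ) - θ(γ)⁻¹ μ(γ) μ(γ)ᵀ]`. -/
def sigmaInf {K p : ℕ} (Bbar : Matrix (Fin K) (Fin K) ℝ) (π : Fin K → ℝ)
    (ν : Measure (Cov p)) (γ : Cov p) : Matrix (Fin p) (Fin p) ℝ :=
  ∑ a, ∑ b, (Bbar a b * π a * π b) • tiltedCov ν γ

/-! ### The model -/

/-- The set of node pairs `i < j`. -/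
def pairs (n : ℕ) : Finset (Fin n × Fin n) :=
  Finset.univ.filter fun q => q.1 < q.2

/-- The Poisson rate `λ_{ij} = B_{c_i c_j} exp(z_{ij}ᵀ γ⁰)`. -/
def rate {n K p : ℕ} (B : Matrix (Fin K) (Fin K) ℝ) (γ₀ : Cov p)
    (c : Fin n → Fin K) (z : Fin n → Fin n → Cov p) (i j : Fin n) : ℝ :=
  B (c i) (c j) * Real.exp (inner ℝ (z i j) γ₀)

/-- The pairwise covariates-adjusted stochastic block model on `n` nodes, with label
probabilities `π`, connectivity matrix `B`, covariate law `ν` and coefficient `γ₀`, observed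
together with an initial label assignment `e` that is given independently of the network data.

`c` are the true labels, `z` the pairwise covariates, `A` the weighted adjacency matrix.
The assignment `e` may be deterministic, or random: it carries no information on `z`
(the pair `(c, e)` is independent of `z`) and none on `A` beyond `(c, z)` (the conditional law
of `A` given `(c, e, z)` is the one prescribed by `(c, z)`). -/
structure IsPCABM {Ω : Type*} [MeasurableSpace Ω] (P : Measure Ω) {n K p : ℕ}
    (π : Fin K → ℝ) (B : Matrix (Fin K) (Fin K) ℝ) (ν : Measure (Cov p)) (γ₀ : Cov p)
    (c e : Ω → Fin n → Fin K) (z : Ω → Fin n → Fin n → Cov p)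
    (A : Ω → Fin n → Fin n → ℕ) : Prop where
  measurable_c : Measurable c
  measurable_e : Measurable e
  measurable_z : Measurable z
  measurable_A : Measurable A
  /-- The true labels are independent draws from the distribution `π`. -/
  indep_c : iIndepFun (fun i ω => c ω i) P
  law_c : ∀ i k, P.real {ω | c ω i = k} = π k
  /-- The covariates are symmetric with zero diagonal, and `z_{ij}`, `i < j`, are i.i.d. with
  law `ν`. -/
  z_symm : ∀ ω i j, z ω i j = z ω j i
  z_diag : ∀ ω i, z ω i i = 0
  indep_z : iIndepFun (fun (q : {q : Fin n × Fin n // q.1 < q.2}) ω => z ω q.1.1 q.1.2) P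
  law_z : ∀ i j, i < j → P.map (fun ω => z ω i j) = ν
  /-- Labels and initial assignment are independent of the covariates. -/
  indep_labels_z : IndepFun (fun ω => (c ω, e ω)) z P
  /-- `A` is symmetric with zero diagonal and, conditionally on labels, initial assignment and
  covariates, the `A_{ij}`, `i < j`, are independent Poisson variables with rates `λ_{ij}`. -/
  A_symm : ∀ ω i j, A ω i j = A ω j i
  A_diag : ∀ ω i, A ω i i = 0
  condLaw_A : ∀ a : Fin n → Fin n → ℕ,
    P⟦{ω | ∀ i j, i < j → A ω i j = a i j} |
        MeasurableSpace.comap (fun ω => (c ω, e ω, z ω)) inferInstance⟧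
      =ᵐ[P] fun ω => ∏ q ∈ pairs n,
        (poissonMeasure (rate B γ₀ (c ω) (z ω) q.1 q.2).toNNReal).real {a q.1 q.2}

/-! ### The profile likelihood and its maximizer -/

/-- `n_k(e)`, the number of nodes with label `k`. -/
def blockSize {n K : ℕ} (e : Fin n → Fin K) (k : Fin K) : ℕ :=
  (Finset.univ.filter fun i => e i = k).card

/-- `O_{kl}(e) = ∑_{i,j} A_{ij} 1(e_i = k, e_j = l)`. -/
def blockEdges {n K : ℕ} (A : Fin n → Fin n → ℕ) (e : Fin n → Fin K) (k l : Fin K) : ℝ :=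
  ∑ i, ∑ j, if e i = k ∧ e j = l then (A i j : ℝ) else 0

/-- `E_{kl}(e, γ) = ∑_{i ≠ j} exp(z_{ij}ᵀ γ) 1(e_i = k, e_j = l)`. -/
def blockExp {n K p : ℕ} (z : Fin n → Fin n → Cov p) (e : Fin n → Fin K) (γ : Cov p)
    (k l : Fin K) : ℝ :=
  ∑ i, ∑ j, if i ≠ j ∧ e i = k ∧ e j = l then Real.exp (inner ℝ (z i j) γ) else 0

/-- `ℓ_e(γ) = ∑_{i<j} A_{ij} z_{ij}ᵀ γ - ½ ∑_{k,l} O_{kl}(e) log E_{kl}(e, γ)`.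
If `E_{kl}` is an empty sum then `O_{kl} = 0`, and the corresponding term is `0`. -/
def logLik {n K p : ℕ} (A : Fin n → Fin n → ℕ) (z : Fin n → Fin n → Cov p)
    (e : Fin n → Fin K) (γ : Cov p) : ℝ :=
  ∑ q ∈ pairs n, (A q.1 q.2 : ℝ) * inner ℝ (z q.1 q.2) γ
    - (1 / 2) * ∑ k, ∑ l, blockEdges A e k l * Real.log (blockExp z e γ k l)

/-- `g` is a value of `argmax_γ ℓ_e(γ)`: whenever `ℓ_e` attains its maximum over `ℝᵖ`, it does so
at `g`. No requirement is made on `g` for data for which `ℓ_e` has no maximizer. -/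
def IsArgmax {n K p : ℕ} (A : Fin n → Fin n → ℕ) (z : Fin n → Fin n → Cov p)
    (e : Fin n → Fin K) (g : Cov p) : Prop :=
  (∃ γ, ∀ γ', logLik A z e γ' ≤ logLik A z e γ) → ∀ γ', logLik A z e γ' ≤ logLik A z e g

/-- `N_n = n(n-1)/2`, the number of possible edges. -/
def numPairs (n : ℕ) : ℝ := (n : ℝ) * ((n : ℝ) - 1) / 2

end PCABM

end

/-! Write `r = √(N_n ρ_n)`. The profile likelihood is a sum over pairs of `A i j` times a linear
function minus a log-sum-exp, so it is concave (`concaveOn_logLik`), and its maximizer can be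
located from its behaviour near `γ₀` alone. Uniformly for `u` in a bounded set, `ℓ(γ₀ + u / r) -
ℓ(γ₀)` is `⟨W, u⟩ - uᵀ Σ_∞ u / 2` up to an error vanishing in probability, where `W` is the score
divided by `r` (`Regime.eventually_abs_logLik_sub_le`). By concavity a maximizer then exists with
probability tending to one, and `r (γhat - γ₀)` differs from `Σ_∞⁻¹ W` by a vanishing amount
(`norm_argmax_sub_lt`, `Regime.tendsto_argmax_sub`). It remains to find the limit laws of `W` and of
the curvature.

A wrong initial assignment does no harm because `e` carries no information on the covariates. In
every block `(k, l)` the averages with weights `exp(zᵀγ₀)` converge to the same tilted moments, at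
rate `N_n^(-1/2)` (`Regime.tendsto_blockAvg_sub`). Hence every block variance tends to the quadratic
form of `θ⁻¹ (Σ - θ⁻¹ μ μᵀ)`, while the number of edges divided by `r²` tends to `θ ∑ B̄_ab π_a π_b`
(`Regime.tendsto_edgeDensity`). The product of the two is `Σ_∞`.

For the score, the Poisson variables are integrated out given labels, assignment and covariates
(`IsPCABM.integral_cexp`). The characteristic function becomes the mean of `exp(∑ λ (exp(i u) - 1))`
with each `u` of order `1 / r`, and a Taylor expansion leaves a conditional mean and a conditional
variance. The variance tends to that of `N(0, Σ_∞)` (`Regime.tendsto_score_var`). The mean need not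
be zero, since the blocks of `e` are not the true ones, but it is of order `√ρ_n` and disappears
because `ρ_n → 0` (`Regime.tendsto_score_mean`). Applying `Σ_∞⁻¹` turns the covariance `Σ_∞` into
`Σ_∞⁻¹`. -/

noncomputable section

namespace PCABM

/-! ### Convergence in probability as convergence along a filter -/

section InProb

variable {Ω : ℕ → Type*} [∀ n, MeasurableSpace (Ω n)]

/-- The filter of events whose probability tends to one. -/
def inProb (P : (n : ℕ) → Measure (Ω n)) : Filter (Σ n, Ω n) where
  -- `P n` acts as an outer measure, so slices need not be measurable. Limits along this filter are
  -- limits in probability, and the calculus of `Tendsto` (sums, products, squeezing, continuous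
  -- maps) applies to them directly.
  sets := {S | Tendsto (fun n => P n {ω | (⟨n, ω⟩ : Σ n, Ω n) ∉ S}) atTop (𝓝 0)}
  univ_sets := by simp
  sets_of_superset := by
    intro S T hS hST
    refine tendsto_of_tendsto_of_tendsto_of_le_of_le tendsto_const_nhds hS
      (fun _ => zero_le) fun n => measure_mono fun ω hω h => hω (hST h)
  inter_sets := by
    intro S T hS hT
    have h := Tendsto.add hS hT
    rw [add_zero] at h
    refine tendsto_of_tendsto_of_tendsto_of_le_of_le tendsto_const_nhds h
      (fun _ => zero_le) fun n => (measure_mono ?_).trans (measure_union_le _ _)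
    intro ω hω
    by_contra hc
    simp only [Set.mem_union, Set.mem_ofPred_eq, not_or, not_not] at hc
    exact hω hc

variable {P : (n : ℕ) → Measure (Ω n)}

lemma eventually_inProb {p : (Σ n, Ω n) → Prop} :
    (∀ᶠ x in inProb P, p x) ↔ Tendsto (fun n => P n {ω | ¬ p ⟨n, ω⟩}) atTop (𝓝 0) :=
  Iff.rfl

lemma eventually_inProb_of_ae {p : (Σ n, Ω n) → Prop}
    (h : ∀ᶠ n in atTop, ∀ᵐ ω ∂(P n), p ⟨n, ω⟩) : ∀ᶠ x in inProb P, p x := by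
  rw [eventually_inProb]
  refine tendsto_const_nhds.congr' ?_
  filter_upwards [h] with n hn
  exact (ae_iff.1 hn).symm

lemma tendsto_fst_inProb : Tendsto (fun x : Σ n, Ω n => x.1) (inProb P) atTop := by
  intro S hS
  exact eventually_inProb_of_ae (p := fun x => x.1 ∈ S) (by
    filter_upwards [hS] with n hn
    exact Eventually.of_forall fun _ => hn)

/-- Convergence in probability of uniformly bounded variables gives convergence of means. -/
lemma tendsto_integral_of_inProb [∀ n, IsProbabilityMeasure (P n)]
    {F : (n : ℕ) → Ω n → ℂ} {C : ℝ} {a : ℂ}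
    (hF : ∀ n, AEStronglyMeasurable (F n) (P n)) (hC : ∀ n, ∀ᵐ ω ∂(P n), ‖F n ω‖ ≤ C)
    (h : Tendsto (fun x : Σ n, Ω n => F x.1 x.2) (inProb P) (𝓝 a)) :
    Tendsto (fun n => ∫ ω, F n ω ∂(P n)) atTop (𝓝 a) := by
  have hC0 : 0 ≤ C := by
    obtain ⟨ω, hω⟩ := (hC 0).exists
    exact (norm_nonneg _).trans hω
  rw [Metric.tendsto_atTop]
  intro ε hε
  have hmem := (Metric.tendsto_nhds.1 h) (ε / 2) (by positivity)
  rw [eventually_inProb] at hmem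
  -- `D` bounds the deviation on the exceptional event; the added one keeps it positive as a
  -- divisor.
  set D := C + ‖a‖ + 1 with hD
  have hD0 : 0 < D := by positivity
  have hev := (ENNReal.tendsto_toReal ENNReal.zero_ne_top).comp hmem
  have hev2 := (Metric.tendsto_atTop.1 hev) (ε / (2 * D)) (by positivity)
  obtain ⟨N, hN⟩ := hev2
  refine ⟨N, fun n hn => ?_⟩
  have hint : Integrable (F n) (P n) := Integrable.of_bound (hF n) C (hC n)
  have hsub : Integrable (fun ω => F n ω - a) (P n) := hint.sub (integrable_const a)
  set B : Set (Ω n) := {ω | ¬ dist (F n ω) a < ε / 2} with hB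
  have hBm : NullMeasurableSet B (P n) := by
    have : AEMeasurable (fun ω => dist (F n ω) a) (P n) :=
      ((hF n).aemeasurable.dist aemeasurable_const)
    exact (nullMeasurableSet_lt this aemeasurable_const).compl
  have hPB : (P n).real B < ε / (2 * D) := by
    have := hN n hn
    simp only [Function.comp, ENNReal.toReal_zero, dist_zero_right, Real.norm_eq_abs] at this
    exact lt_of_abs_lt this
  have hle : ∫ ω, ‖F n ω - a‖ ∂(P n) ≤ ∫ ω, (ε / 2 + B.indicator (fun _ => D) ω) ∂(P n) := by
    refine integral_mono_ae hsub.norm ((integrable_const _).add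
      ((integrable_const D).indicator₀ hBm)) ?_
    filter_upwards [hC n] with ω hω
    by_cases hωB : ω ∈ B
    · have : ‖F n ω - a‖ ≤ C + ‖a‖ := (norm_sub_le _ _).trans (by gcongr)
      simp only [Set.indicator_of_mem hωB]
      linarith
    · have : dist (F n ω) a < ε / 2 := by simpa [hB] using hωB
      rw [dist_eq_norm] at this
      simp only [Set.indicator_of_notMem hωB]
      linarith
  have hval : ∫ ω, (ε / 2 + B.indicator (fun _ => D) ω) ∂(P n) = ε / 2 + (P n).real B * D := by
    rw [integral_add (integrable_const _) ((integrable_const D).indicator₀ hBm),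
      integral_indicator₀ hBm]
    simp
  have heq : (∫ ω, F n ω ∂(P n)) - a = ∫ ω, (F n ω - a) ∂(P n) := by
    rw [integral_sub hint (integrable_const a)]; simp
  rw [dist_eq_norm, heq]
  calc ‖∫ ω, (F n ω - a) ∂(P n)‖ ≤ ∫ ω, ‖F n ω - a‖ ∂(P n) := norm_integral_le_integral_norm _
    _ ≤ ε / 2 + (P n).real B * D := hle.trans_eq hval
    _ < ε / 2 + ε / (2 * D) * D := by gcongr
    _ = ε := by field_simp; ring

/-- Convergence in mean square gives convergence in probability. -/
lemma tendsto_inProb_of_sq [∀ n, IsProbabilityMeasure (P n)] {X : (n : ℕ) → Ω n → ℝ}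
    {b : ℕ → ℝ} (hX : ∀ᶠ n in atTop, Integrable (fun ω => X n ω ^ 2) (P n))
    (hb : ∀ᶠ n in atTop, ∫ ω, X n ω ^ 2 ∂(P n) ≤ b n) (hb0 : Tendsto b atTop (𝓝 0)) :
    Tendsto (fun x : Σ n, Ω n => X x.1 x.2) (inProb P) (𝓝 0) := by
  rw [Metric.tendsto_nhds]
  intro ε hε
  rw [eventually_inProb]
  have h1 : Tendsto (fun n => ENNReal.ofReal (b n / ε ^ 2)) atTop (𝓝 0) := by
    have := ENNReal.tendsto_ofReal (hb0.div_const (ε ^ 2))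
    simpa using this
  refine tendsto_of_tendsto_of_tendsto_of_le_of_le' tendsto_const_nhds h1
    (Eventually.of_forall fun _ => zero_le) ?_
  filter_upwards [hX, hb] with n hXn hbn
  have hm := mul_meas_ge_le_integral_of_nonneg
    (Eventually.of_forall fun ω => sq_nonneg (X n ω)) hXn (ε ^ 2)
  have hsub : {ω | ¬ dist (X n ω) 0 < ε} ⊆ {ω | ε ^ 2 ≤ X n ω ^ 2} := by
    intro ω hω
    simp only [Set.mem_ofPred_eq, dist_zero_right, Real.norm_eq_abs, not_lt] at hω ⊢
    rw [← sq_abs (X n ω)]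
    gcongr
  refine (measure_mono hsub).trans ?_
  rw [← ENNReal.ofReal_toReal (measure_ne_top (P n) {ω | ε ^ 2 ≤ X n ω ^ 2})]
  refine ENNReal.ofReal_le_ofReal ?_
  rw [le_div_iff₀ (by positivity), mul_comm]
  exact hm.trans hbn

/-- A sequence that converges to zero in probability on events whose probability is uniformly
close to one converges to zero in probability. -/
lemma tendsto_inProb_of_tight {α : Type*} {l : Filter α} {X : (Σ n, Ω n) → α}
    {W : (Σ n, Ω n) → ℝ}
    (hW : ∀ η : ENNReal, 0 < η → ∃ R : ℝ, ∀ n, P n {ω | ¬ W ⟨n, ω⟩ ≤ R} ≤ η)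
    (h : ∀ R : ℝ, Tendsto X (inProb P ⊓ 𝓟 {x | W x ≤ R}) l) : Tendsto X (inProb P) l := by
  intro S hS
  change ∀ᶠ x in inProb P, X x ∈ S
  rw [eventually_inProb, ENNReal.tendsto_nhds_zero]
  intro η hη
  obtain ⟨R, hR⟩ := hW (η / 2) (ENNReal.half_pos hη.ne')
  have h1 : ∀ᶠ x in inProb P ⊓ 𝓟 {x | W x ≤ R}, X x ∈ S := h R hS
  rw [eventually_inf_principal, eventually_inProb, ENNReal.tendsto_nhds_zero] at h1
  filter_upwards [h1 (η / 2) (ENNReal.half_pos hη.ne')] with n hn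
  calc P n {ω | ¬ X ⟨n, ω⟩ ∈ S}
      ≤ P n ({ω | ¬ (⟨n, ω⟩ ∈ {x : Σ n, Ω n | W x ≤ R} → X ⟨n, ω⟩ ∈ S)} ∪
          {ω | ¬ W ⟨n, ω⟩ ≤ R}) := by
        refine measure_mono fun ω hω => ?_
        by_cases hw : W ⟨n, ω⟩ ≤ R
        · exact Or.inl fun hc => hω (hc hw)
        · exact Or.inr hw
    _ ≤ _ := measure_union_le _ _
    _ ≤ η / 2 + η / 2 := add_le_add hn (hR n)
    _ = η := ENNReal.add_halves η

end InProb

/-! ### Exponential functionals of conditionally Poisson variables -/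

/-- The Laplace transform of a Poisson variable at a complex argument. -/
lemma integral_cexp_poissonMeasure (r : NNReal) (w : ℂ) :
    ∫ k, Complex.exp (k * w) ∂(poissonMeasure r) = Complex.exp (r * (Complex.exp w - 1)) := by
  rw [integral_poissonMeasure r]
  calc ∑' a : ℕ, (Real.exp (-r) * r ^ a / a.factorial : ℝ) • Complex.exp (a * w)
  _ = ∑' a : ℕ, (Real.exp (-r) : ℂ) * ((r * Complex.exp w) ^ a / a.factorial) := by
      congr with a
      rw [Complex.real_smul]
      push_cast
      rw [mul_pow, ← Complex.exp_nat_mul]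
      ring
  _ = (Real.exp (-r) : ℂ) * ∑' a : ℕ, ((r * Complex.exp w) ^ a / a.factorial) := tsum_mul_left
  _ = (Real.exp (-r) : ℂ) * Complex.exp (r * Complex.exp w) := by
      rw [(NormedSpace.expSeries_div_hasSum_exp (r * Complex.exp w)).tsum_eq,
        Complex.exp_eq_exp_ℂ]
  _ = Complex.exp (r * (Complex.exp w - 1)) := by
      rw [Complex.ofReal_exp, ← Complex.exp_add]
      push_cast
      ring_nf

/-- Counts are nonnegative, so exponents with nonpositive real part keep the functional in the unit
disc. This covers both imaginary exponents (characteristic functions) and negative ones (Laplace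
transforms). -/
lemma norm_cexp_sum_nat_mul_le_one {ι : Type*} (s : Finset ι) (a : ι → ℕ) {w : ι → ℂ}
    (hw : ∀ q, (w q).re ≤ 0) : ‖Complex.exp (∑ q ∈ s, (a q : ℂ) * w q)‖ ≤ 1 := by
  rw [Complex.norm_exp, Complex.re_sum, Real.exp_le_one_iff]
  refine Finset.sum_nonpos fun q _ => ?_
  simp only [Complex.mul_re, Complex.natCast_re, Complex.natCast_im, zero_mul, sub_zero]
  exact mul_nonpos_of_nonneg_of_nonpos (Nat.cast_nonneg _) (hw q)

/-- If, conditionally on `m`, the variables `A q` are independent Poisson with rates `r q`, then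
the mean of `exp (∑ A q * w q)` can be computed by integrating out `A`. -/
lemma integral_cexp_sum_condPoisson {Ω ι : Type*} [Fintype ι] {m mΩ : MeasurableSpace Ω}
    (hm : m ≤ mΩ) (P : Measure Ω) [IsProbabilityMeasure P] (A : Ω → ι → ℕ) (hA : Measurable A)
    (r : Ω → ι → NNReal)
    (hcond : ∀ a : ι → ℕ, P[(A ⁻¹' {a}).indicator (fun _ => (1 : ℝ)) | m]
      =ᵐ[P] fun ω => ∏ q, (poissonMeasure (r ω q)).real {a q})
    (w : Ω → ι → ℂ) (hw : Measurable[m] w) (hre : ∀ ω q, (w ω q).re ≤ 0) :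
    ∫ ω, Complex.exp (∑ q, (A ω q : ℂ) * w ω q) ∂P
      = ∫ ω, Complex.exp (∑ q, (r ω q : ℂ) * (Complex.exp (w ω q) - 1)) ∂P := by
  set G : (ι → ℕ) → Ω → ℂ := fun a ω => Complex.exp (∑ q, (a q : ℂ) * w ω q) with hG
  have hwm : Measurable w := hw.mono hm le_rfl
  have hGm : ∀ a, Measurable[m] (G a) := by
    intro a
    have h1 : Measurable fun v : ι → ℂ => Complex.exp (∑ q, (a q : ℂ) * v q) := by fun_prop
    exact h1.comp hw
  have hG1 : ∀ a ω, ‖G a ω‖ ≤ 1 := fun a ω => norm_cexp_sum_nat_mul_le_one _ a (hre ω)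
  have hGint : ∀ a, Integrable (G a) P := fun a =>
    Integrable.of_bound ((hGm a).mono hm le_rfl).aestronglyMeasurable 1
      (Eventually.of_forall (hG1 a))
  set F : Ω → ℂ := fun ω => Complex.exp (∑ q, (A ω q : ℂ) * w ω q) with hF
  have hFm : Measurable F := by
    refine Complex.measurable_exp.comp (Finset.measurable_sum _ fun q _ => Measurable.mul ?_ ?_)
    · exact (measurable_of_countable (fun k : ℕ => (k : ℂ))).comp
        ((measurable_pi_apply q).comp hA)
    · exact (measurable_pi_apply q).comp hwm
  have hFint : Integrable F P :=
    Integrable.of_bound hFm.aestronglyMeasurable 1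
      (Eventually.of_forall fun ω => norm_cexp_sum_nat_mul_le_one _ _ (hre ω))
  have hset : ∀ a, MeasurableSet (A ⁻¹' {a}) := fun a => hA (measurableSet_singleton a)
  have hunion : (⋃ a, A ⁻¹' {a}) = Set.univ := by
    ext ω; simp
  have hdisj : Pairwise (Function.onFun Disjoint fun a => A ⁻¹' {a}) := fun a b hab =>
    Disjoint.preimage A (Set.disjoint_singleton.2 hab)
  -- `A` takes countably many values, so the integral splits over the events `A = a`. On each of
  -- them `A` is frozen, the functional is `m`-measurable, and the indicator may be replaced by its
  -- conditional expectation.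
  have hsum := hasSum_integral_iUnion (μ := P) (f := F) hset hdisj hFint.integrableOn
  rw [hunion, setIntegral_univ] at hsum
  set p : (ι → ℕ) → Ω → ℝ := fun a ω => ∏ q, (poissonMeasure (r ω q)).real {a q} with hp
  have hp0 : ∀ a ω, 0 ≤ p a ω := fun a ω => Finset.prod_nonneg fun q _ => measureReal_nonneg
  have hpi : ∀ a ω, (Measure.pi fun q => poissonMeasure (r ω q)).real {a} = p a ω := by
    intro a ω
    simp [measureReal_def, hp, ENNReal.toReal_prod]
  have hind : ∀ a, Integrable ((A ⁻¹' {a}).indicator (fun _ => (1 : ℝ))) P := fun a =>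
    (integrable_const 1).indicator (hset a)
  have hpint : ∀ a, Integrable (p a) P := fun a => integrable_condExp.congr (hcond a)
  have hppt : ∀ a, ∫ ω, p a ω ∂P = P.real (A ⁻¹' {a}) := by
    intro a
    rw [← integral_congr_ae (hcond a), integral_condExp hm, integral_indicator (hset a)]
    simp
  have hterm : ∀ a, ∫ ω in A ⁻¹' {a}, F ω ∂P = ∫ ω, p a ω • G a ω ∂P := by
    intro a
    have h1 : ∫ ω in A ⁻¹' {a}, F ω ∂P
        = ∫ ω, (A ⁻¹' {a}).indicator (fun _ => (1 : ℝ)) ω • G a ω ∂P := by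
      rw [← integral_indicator (hset a)]
      refine integral_congr_ae (Eventually.of_forall fun ω => ?_)
      by_cases h : ω ∈ A ⁻¹' {a}
      · have h' : A ω = a := h
        simp [hF, hG, h']
      · simp [Set.indicator_of_notMem h]
    have hint2 : Integrable
        (fun ω => (A ⁻¹' {a}).indicator (fun _ => (1 : ℝ)) ω • G a ω) P := by
      refine (hGint a).norm.mono' ((hind a).1.smul (hGint a).1) (Eventually.of_forall fun ω => ?_)
      by_cases h : ω ∈ A ⁻¹' {a}
      · simp [Set.indicator_of_mem h]
      · simp [Set.indicator_of_notMem h]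
    have h2 := condExp_bilin_of_stronglyMeasurable_right (μ := P)
      (f := (A ⁻¹' {a}).indicator (fun _ => (1 : ℝ))) (g := G a)
      (ContinuousLinearMap.lsmul ℝ ℝ : ℝ →L[ℝ] ℂ →L[ℝ] ℂ) (hGm a).stronglyMeasurable hint2 (hind a)
    rw [h1, ← integral_condExp hm]
    refine integral_congr_ae (h2.trans ?_)
    filter_upwards [hcond a] with ω hω
    simp only [ContinuousLinearMap.lsmul_apply]
    rw [hω]
  have hnorm : ∀ a, ∫ ω, ‖p a ω • G a ω‖ ∂P ≤ P.real (A ⁻¹' {a}) := by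
    intro a
    rw [← hppt a]
    refine integral_mono_of_nonneg (Eventually.of_forall fun ω => norm_nonneg _) (hpint a)
      (Eventually.of_forall fun ω => ?_)
    simp only [norm_smul, Real.norm_eq_abs, abs_of_nonneg (hp0 a ω)]
    exact mul_le_of_le_one_right (hp0 a ω) (hG1 a ω)
  have hpG : ∀ a, Integrable (fun ω => p a ω • G a ω) P := by
    intro a
    refine (hpint a).mono' ((hpint a).1.smul (hGint a).1) (Eventually.of_forall fun ω => ?_)
    simp only [norm_smul, Real.norm_eq_abs, abs_of_nonneg (hp0 a ω)]
    exact mul_le_of_le_one_right (hp0 a ω) (hG1 a ω)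
  -- The events `A = a` partition the space, so their probabilities are summable. They dominate the
  -- terms and justify exchanging sum and integral.
  have hsummable : Summable fun a => P.real (A ⁻¹' {a}) := by
    have h := hasSum_integral_iUnion (μ := P) (f := fun _ : Ω => (1 : ℝ)) hset hdisj
      (integrable_const (1 : ℝ)).integrableOn
    simpa using h.summable
  have hsum2 := hasSum_integral_of_summable_integral_norm hpG
    (hsummable.of_nonneg_of_le (fun a => integral_nonneg fun ω => norm_nonneg _) hnorm)
  have heq : ∫ ω, F ω ∂P = ∫ ω, ∑' a, p a ω • G a ω ∂P := by
    refine hsum.unique ?_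
    simp_rw [hterm]
    exact hsum2
  rw [heq]
  refine integral_congr_ae (Eventually.of_forall fun ω => ?_)
  -- For fixed `ω` the sum over `a` is an integral against a product of Poisson laws, which factors
  -- into one-dimensional transforms.
  have h3 : Integrable (fun a : ι → ℕ => G a ω) (Measure.pi fun q => poissonMeasure (r ω q)) :=
    Integrable.of_bound (measurable_of_countable _).aestronglyMeasurable 1
      (Eventually.of_forall fun a => hG1 a ω)
  have h4 := integral_countable h3
  simp_rw [hpi] at h4
  simp only
  rw [← h4]
  simp only [hG, Complex.exp_sum]
  rw [integral_fintype_prod_eq_prod (fun q (k : ℕ) => Complex.exp (k * w ω q))]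
  simp_rw [integral_cexp_poissonMeasure]

section Model

variable {Ω : Type*} [MeasurableSpace Ω] {P : Measure Ω} [IsProbabilityMeasure P] {n K p : ℕ}
  {π : Fin K → ℝ} {B : Matrix (Fin K) (Fin K) ℝ} {ν : Measure (Cov p)} {γ₀ : Cov p}
  {c e : Ω → Fin n → Fin K} {z : Ω → Fin n → Fin n → Cov p} {A : Ω → Fin n → Fin n → ℕ}

/-- Exponential functionals of the adjacency matrix, with the adjacency matrix integrated out. -/
lemma IsPCABM.integral_cexp (h : IsPCABM P π B ν γ₀ c e z A) (hB : ∀ a b, 0 ≤ B a b)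
    (w : (Fin n → Fin K) × (Fin n → Fin K) × (Fin n → Fin n → Cov p) → Fin n × Fin n → ℂ)
    (hw : ∀ q, Measurable fun y => w y q) (hre : ∀ y q, (w y q).re ≤ 0) :
    ∫ ω, Complex.exp (∑ q ∈ pairs n, (A ω q.1 q.2 : ℂ) * w (c ω, e ω, z ω) q) ∂P
      = ∫ ω, Complex.exp (∑ q ∈ pairs n, (rate B γ₀ (c ω) (z ω) q.1 q.2 : ℂ) *
          (Complex.exp (w (c ω, e ω, z ω) q) - 1)) ∂P := by
  have hYm : Measurable fun ω => (c ω, e ω, z ω) :=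
    h.measurable_c.prodMk (h.measurable_e.prodMk h.measurable_z)
  have key := integral_cexp_sum_condPoisson
    (m := MeasurableSpace.comap (fun ω => (c ω, e ω, z ω)) inferInstance) hYm.comap_le P
    (fun ω (q : pairs n) => A ω q.1.1 q.1.2)
    (measurable_pi_lambda _ fun q => (measurable_pi_apply _).comp
      ((measurable_pi_apply _).comp h.measurable_A))
    (fun ω (q : pairs n) => (rate B γ₀ (c ω) (z ω) q.1.1 q.1.2).toNNReal) ?_
    (fun ω (q : pairs n) => w (c ω, e ω, z ω) q.1) ?_ (fun ω q => hre _ _)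
  · simp only [Finset.univ_eq_attach] at key
    have h1 : ∀ ω, ∑ q ∈ pairs n, (A ω q.1 q.2 : ℂ) * w (c ω, e ω, z ω) q
        = ∑ q ∈ (pairs n).attach, (A ω q.1.1 q.1.2 : ℂ) * w (c ω, e ω, z ω) q.1 := fun ω =>
      (Finset.sum_attach _ fun q => (A ω q.1 q.2 : ℂ) * w (c ω, e ω, z ω) q).symm
    have h2 : ∀ ω, ∑ q ∈ pairs n, (rate B γ₀ (c ω) (z ω) q.1 q.2 : ℂ) *
          (Complex.exp (w (c ω, e ω, z ω) q) - 1)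
        = ∑ q ∈ (pairs n).attach, ((rate B γ₀ (c ω) (z ω) q.1.1 q.1.2).toNNReal : ℂ) *
          (Complex.exp (w (c ω, e ω, z ω) q.1) - 1) := by
      intro ω
      rw [← Finset.sum_attach (pairs n)]
      refine Finset.sum_congr rfl fun q _ => ?_
      have : 0 ≤ rate B γ₀ (c ω) (z ω) q.1.1 q.1.2 := mul_nonneg (hB _ _) (Real.exp_pos _).le
      congr 1
      have h3 := Real.coe_toNNReal _ this
      exact_mod_cast h3.symm
    simp_rw [h1, h2]
    exact key
  · intro α
    -- The conditional law constrains only the entries with `i < j`, so the value zero elsewhere is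
    -- arbitrary.
    set a : Fin n → Fin n → ℕ := fun i j => if hq : (i, j) ∈ pairs n then α ⟨(i, j), hq⟩ else 0
      with ha
    have hset : {ω | ∀ i j, i < j → A ω i j = a i j}
        = (fun ω (q : pairs n) => A ω q.1.1 q.1.2) ⁻¹' {α} := by
      ext ω
      simp only [Set.mem_ofPred_eq, Set.mem_preimage, Set.mem_singleton_iff, funext_iff]
      constructor
      · intro hω q
        have hq : q.1.1 < q.1.2 := by simpa [pairs] using q.2
        rw [hω _ _ hq]
        simp [ha]
      · intro hω i j hij
        have hq : (i, j) ∈ pairs n := by simpa [pairs] using hij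
        have := hω ⟨(i, j), hq⟩
        simp only [ha, hq, dif_pos]
        exact this
    have h1 := h.condLaw_A a
    rw [hset] at h1
    refine h1.trans (Eventually.of_forall fun ω => ?_)
    simp only [Finset.univ_eq_attach]
    rw [← Finset.prod_attach (pairs n)]
    refine Finset.prod_congr rfl fun q _ => ?_
    simp [ha]
  · exact (measurable_pi_lambda (fun y (q : pairs n) => w y q.1) fun q => hw q.1).comp
      (comap_measurable _)

end Model

/-! ### Second moments of sums of uncorrelated bounded variables -/

/-- Expanding the square leaves only the diagonal terms, each at most `C ^ 2`. This orthogonality is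
behind the laws of large numbers for covariates and labels. -/
lemma integral_sq_sum_le {Ω ι : Type*} [MeasurableSpace Ω] {P : Measure Ω}
    [IsProbabilityMeasure P] (s : Finset ι) {X : ι → Ω → ℝ} {C : ℝ}
    (hX : ∀ i ∈ s, AEStronglyMeasurable (X i) P) (hC : ∀ i ∈ s, ∀ᵐ ω ∂P, |X i ω| ≤ C)
    (h0 : ∀ i ∈ s, ∀ j ∈ s, i ≠ j → ∫ ω, X i ω * X j ω ∂P = 0) :
    Integrable (fun ω => (∑ i ∈ s, X i ω) ^ 2) P ∧
      ∫ ω, (∑ i ∈ s, X i ω) ^ 2 ∂P ≤ s.card * C ^ 2 := by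
  have hint : ∀ i ∈ s, ∀ j ∈ s, Integrable (fun ω => X i ω * X j ω) P := by
    intro i hi j hj
    refine Integrable.of_bound ((hX i hi).mul (hX j hj)) (C * C) ?_
    filter_upwards [hC i hi, hC j hj] with ω h1 h2
    rw [norm_mul, Real.norm_eq_abs, Real.norm_eq_abs]
    exact mul_le_mul h1 h2 (abs_nonneg _) ((abs_nonneg _).trans h1)
  have hexp : ∀ ω, (∑ i ∈ s, X i ω) ^ 2 = ∑ i ∈ s, ∑ j ∈ s, X i ω * X j ω := by
    intro ω
    rw [sq, Finset.sum_mul_sum]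
  simp_rw [hexp]
  refine ⟨integrable_finsetSum _ fun i hi => integrable_finsetSum _ fun j hj => hint i hi j hj, ?_⟩
  rw [integral_finsetSum _ fun i hi => integrable_finsetSum _ fun j hj => hint i hi j hj]
  rw [← nsmul_eq_mul]
  refine Finset.sum_le_card_nsmul _ _ _ fun i hi => ?_
  rw [integral_finsetSum _ fun j hj => hint i hi j hj, Finset.sum_eq_single_of_mem i hi]
  · have h1 : ∫ ω, X i ω * X i ω ∂P ≤ ∫ _, C ^ 2 ∂P := by
      refine integral_mono_ae (hint i hi i hi) (integrable_const _) ?_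
      filter_upwards [hC i hi] with ω hω
      rw [← sq, ← sq_abs]
      gcongr
    simpa using h1
  · intro j hj hji
    exact h0 i hi j hj hji.symm

lemma sum_sum_eq_sum_pairs {n : ℕ} {M : Type*} [AddCommMonoid M] (φ : Fin n → Fin n → M) :
    ∑ i, ∑ j, φ i j = ∑ q ∈ pairs n, (φ q.1 q.2 + φ q.2 q.1) + ∑ i, φ i i := by
  have h1 : ∑ i, ∑ j, φ i j = ∑ q : Fin n × Fin n, φ q.1 q.2 :=
    (Fintype.sum_prod_type' _).symm
  have h2 : ∑ q ∈ pairs n, φ q.2 q.1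
      = ∑ q ∈ Finset.univ.filter (fun q : Fin n × Fin n => q.2 < q.1), φ q.1 q.2 := by
    refine Finset.sum_nbij' Prod.swap Prod.swap ?_ ?_ ?_ ?_ ?_ <;> simp [pairs]
  have h3 : ∑ i, φ i i
      = ∑ q ∈ Finset.univ.filter (fun q : Fin n × Fin n => q.1 = q.2), φ q.1 q.2 := by
    refine Finset.sum_nbij' (fun i => (i, i)) Prod.fst ?_ ?_ ?_ ?_ ?_
    · simp
    · simp
    · simp
    · rintro ⟨i, j⟩ h
      simpa using h
    · simp
  rw [Finset.sum_add_distrib, h2, h3, h1,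
    ← Finset.sum_filter_add_sum_filter_not Finset.univ (fun q : Fin n × Fin n => q.1 < q.2),
    add_assoc]
  congr 1
  rw [← Finset.sum_union]
  · refine Finset.sum_congr ?_ fun _ _ => rfl
    ext q
    simp only [Finset.mem_filter, Finset.mem_univ, true_and, Finset.mem_union, not_lt]
    rw [le_iff_lt_or_eq]
    simp [eq_comm]
  · rw [Finset.disjoint_left]
    intro q hq hq'
    simp only [Finset.mem_filter, Finset.mem_univ, true_and] at hq hq'
    omega

lemma card_pairs (n : ℕ) : ((pairs n).card : ℝ) = numPairs n := by
  have h := sum_sum_eq_sum_pairs (n := n) fun _ _ => (1 : ℝ)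
  simp only [Finset.sum_const, Finset.card_univ, Fintype.card_fin, nsmul_eq_mul, mul_one] at h
  rw [numPairs]
  linarith

/-! ### Variance bounds for covariate sums and label counts -/

section Model

variable {Ω : Type*} [MeasurableSpace Ω] {P : Measure Ω} {n K p : ℕ}
  {π : Fin K → ℝ} {B : Matrix (Fin K) (Fin K) ℝ} {ν : Measure (Cov p)} {γ₀ : Cov p}
  {c e : Ω → Fin n → Fin K} {z : Ω → Fin n → Fin n → Cov p} {A : Ω → Fin n → Fin n → ℕ}

lemma IsPCABM.measurable_z_apply (h : IsPCABM P π B ν γ₀ c e z A) (i j : Fin n) :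
    Measurable fun ω => z ω i j :=
  (measurable_pi_apply j).comp ((measurable_pi_apply i).comp h.measurable_z)

lemma IsPCABM.ae_z (h : IsPCABM P π B ν γ₀ c e z A) {p' : Cov p → Prop}
    (hp' : ∀ᵐ x ∂ν, p' x) {i j : Fin n} (hij : i < j) : ∀ᵐ ω ∂P, p' (z ω i j) := by
  rw [← h.law_z i j hij] at hp'
  exact ae_of_ae_map (h.measurable_z_apply i j).aemeasurable hp'

lemma IsPCABM.integral_z (h : IsPCABM P π B ν γ₀ c e z A) {f : Cov p → ℝ}
    (hf : Measurable f) {i j : Fin n} (hij : i < j) : ∫ ω, f (z ω i j) ∂P = ∫ x, f x ∂ν := by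
  rw [← h.law_z i j hij, integral_map (h.measurable_z_apply i j).aemeasurable
    hf.aestronglyMeasurable]

variable [IsProbabilityMeasure P]

/-- Second moment bound for weighted sums of centred functions of the covariates, with weights
depending on the labels. -/
lemma IsPCABM.integral_sq_sum_z_le (h : IsPCABM P π B ν γ₀ c e z A) {f : Cov p → ℝ} {F M : ℝ}
    (hf : Measurable f) (hF : ∀ᵐ x ∂ν, |f x| ≤ F) (hf0 : ∫ x, f x ∂ν = 0)
    (a : (Fin n → Fin K) → (Fin n → Fin K) → Fin n × Fin n → ℝ) (ha : ∀ u v q, |a u v q| ≤ M) :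
    Integrable (fun ω => (∑ q ∈ pairs n, a (c ω) (e ω) q * f (z ω q.1 q.2)) ^ 2) P ∧
      ∫ ω, (∑ q ∈ pairs n, a (c ω) (e ω) q * f (z ω q.1 q.2)) ^ 2 ∂P
        ≤ numPairs n * (M * F) ^ 2 := by
  have ham : ∀ q, Measurable fun ω => a (c ω) (e ω) q := fun q =>
    (measurable_of_countable (fun y : (Fin n → Fin K) × (Fin n → Fin K) => a y.1 y.2 q)).comp
      (h.measurable_c.prodMk h.measurable_e)
  have hfm : ∀ i j, Measurable fun ω => f (z ω i j) := fun i j => hf.comp (h.measurable_z_apply i j)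
  rw [← card_pairs]
  refine integral_sq_sum_le (pairs n)
    (fun q _ => ((ham q).mul (hfm q.1 q.2)).aestronglyMeasurable) ?_ ?_
  · intro q hq
    have hq' : q.1 < q.2 := by simpa [pairs] using hq
    filter_upwards [h.ae_z hF hq'] with ω hω
    rw [abs_mul]
    exact mul_le_mul (ha _ _ _) hω (abs_nonneg _) ((abs_nonneg _).trans (ha (c ω) (e ω) q))
  · intro q hq q' hq' hne
    have hq1 : q.1 < q.2 := by simpa [pairs] using hq
    have hq2 : q'.1 < q'.2 := by simpa [pairs] using hq'
    have hrw : ∀ ω, a (c ω) (e ω) q * f (z ω q.1 q.2) * (a (c ω) (e ω) q' * f (z ω q'.1 q'.2))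
        = (a (c ω) (e ω) q * a (c ω) (e ω) q') * (f (z ω q.1 q.2) * f (z ω q'.1 q'.2)) :=
      fun ω => by ring
    simp_rw [hrw]
    -- The weights split off because labels and assignment are jointly independent of the
    -- covariates; the covariates at two distinct pairs are then independent of each other with
    -- centred images under `f`.
    have hind : IndepFun (fun ω => a (c ω) (e ω) q * a (c ω) (e ω) q')
        (fun ω => f (z ω q.1 q.2) * f (z ω q'.1 q'.2)) P := by
      refine h.indep_labels_z.comp
        (φ := fun y : (Fin n → Fin K) × (Fin n → Fin K) => a y.1 y.2 q * a y.1 y.2 q')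
        (ψ := fun y : Fin n → Fin n → Cov p => f (y q.1 q.2) * f (y q'.1 q'.2))
        (measurable_of_countable _) ?_
      have hm : ∀ i j : Fin n, Measurable fun y : Fin n → Fin n → Cov p => f (y i j) :=
        fun i j => hf.comp ((measurable_pi_apply j).comp (measurable_pi_apply i))
      exact (hm _ _).mul (hm _ _)
    have hind2 : IndepFun (fun ω => f (z ω q.1 q.2)) (fun ω => f (z ω q'.1 q'.2)) P := by
      have := h.indep_z.indepFun (i := ⟨q, hq1⟩) (j := ⟨q', hq2⟩) (by simpa using hne)
      exact this.comp hf hf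
    have h1 := hind.integral_fun_mul_eq_mul_integral
      ((ham q).mul (ham q')).aestronglyMeasurable
      ((hfm q.1 q.2).mul (hfm q'.1 q'.2)).aestronglyMeasurable
    have h2 := hind2.integral_fun_mul_eq_mul_integral
      (hfm q.1 q.2).aestronglyMeasurable (hfm q'.1 q'.2).aestronglyMeasurable
    rw [h1, h2, h.integral_z hf hq1, hf0]
    simp

/-- Second moment bound for block frequencies of the true labels. -/
lemma IsPCABM.integral_sq_label_freq_le (h : IsPCABM P π B ν γ₀ c e z A) (k : Fin K) :
    Integrable (fun ω => (∑ i, ((if c ω i = k then 1 else 0) - π k)) ^ 2) P ∧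
      ∫ ω, (∑ i, ((if c ω i = k then 1 else 0) - π k)) ^ 2 ∂P ≤ n := by
  have hcm : ∀ i, Measurable fun ω => c ω i := fun i => (measurable_pi_apply i).comp h.measurable_c
  set g : Fin K → ℝ := fun l => (if l = k then 1 else 0) - π k with hg
  have hgm : Measurable g := measurable_of_countable g
  have hset : ∀ i, MeasurableSet {ω | c ω i = k} := fun i => (hcm i) (measurableSet_singleton k)
  have hint0 : ∀ i, ∫ ω, g (c ω i) ∂P = 0 := by
    intro i
    have h1 : ∀ ω, g (c ω i) = {ω | c ω i = k}.indicator (fun _ => (1 : ℝ)) ω - π k := by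
      intro ω
      simp [hg, Set.indicator_apply]
    simp_rw [h1]
    rw [integral_sub ((integrable_const _).indicator (hset i)) (integrable_const _),
      integral_indicator (hset i)]
    simp [h.law_c i k]
  have hb : ∀ i ω, |g (c ω i)| ≤ 1 := by
    intro i ω
    have h0 : 0 ≤ π k := by rw [← h.law_c i k]; exact measureReal_nonneg
    have h1 : π k ≤ 1 := by rw [← h.law_c i k]; exact measureReal_le_one
    simp only [hg]
    split_ifs <;> rw [abs_le] <;> constructor <;> linarith
  have := integral_sq_sum_le (P := P) Finset.univ (X := fun i ω => g (c ω i)) (C := 1)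
    (fun i _ => (hgm.comp (hcm i)).aestronglyMeasurable)
    (fun i _ => Eventually.of_forall (hb i)) ?_
  · simpa only [Finset.card_univ, Fintype.card_fin, one_pow, mul_one] using this
  · intro i _ j _ hij
    have hind : IndepFun (fun ω => g (c ω i)) (fun ω => g (c ω j)) P :=
      (h.indep_c.indepFun hij).comp hgm hgm
    rw [hind.integral_fun_mul_eq_mul_integral (hgm.comp (hcm i)).aestronglyMeasurable
      (hgm.comp (hcm j)).aestronglyMeasurable, hint0]
    simp

end Model

/-! ### Block sums and block averages -/

/-- The sum of `f (z_{ij})` over the ordered pairs `i ≠ j` in block `(k, l)`. -/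
def blockSum {n K p : ℕ} (z : Fin n → Fin n → Cov p) (e : Fin n → Fin K) (f : Cov p → ℝ)
    (k l : Fin K) : ℝ :=
  ∑ i, ∑ j, if i ≠ j ∧ e i = k ∧ e j = l then f (z i j) else 0

/-- The average of `f (z_{ij})` over block `(k, l)`, with weights `exp (z_{ij}ᵀ γ)`. -/
def blockAvg {n K p : ℕ} (z : Fin n → Fin n → Cov p) (e : Fin n → Fin K) (γ : Cov p)
    (f : Cov p → ℝ) (k l : Fin K) : ℝ :=
  blockSum z e (fun x => f x * Real.exp (inner ℝ x γ)) k l / blockExp z e γ k l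

section Block

variable {n K p : ℕ} {z : Fin n → Fin n → Cov p} {e : Fin n → Fin K} {γ : Cov p}

lemma blockSum_exp (k l : Fin K) :
    blockSum z e (fun x => Real.exp (inner ℝ x γ)) k l = blockExp z e γ k l := rfl

lemma blockSum_eq_sum_pairs (hz : ∀ i j, z i j = z j i) (f : Cov p → ℝ) (k l : Fin K) :
    blockSum z e f k l = ∑ q ∈ pairs n, ((if e q.1 = k ∧ e q.2 = l then 1 else 0)
      + (if e q.2 = k ∧ e q.1 = l then 1 else 0)) * f (z q.1 q.2) := by
  rw [blockSum, sum_sum_eq_sum_pairs]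
  simp only [ne_eq, not_true_eq_false, false_and, if_false, Finset.sum_const_zero, add_zero]
  refine Finset.sum_congr rfl fun q hq => ?_
  have hq' : q.1 < q.2 := by simpa [pairs] using hq
  rw [hz q.2 q.1, add_mul]
  simp only [hq'.ne, hq'.ne', not_false_eq_true, true_and, ite_mul, one_mul, zero_mul]

lemma blockSum_mono {f g : Cov p → ℝ} (h : ∀ i j, f (z i j) ≤ g (z i j)) (k l : Fin K) :
    blockSum z e f k l ≤ blockSum z e g k l := by
  refine Finset.sum_le_sum fun i _ => Finset.sum_le_sum fun j _ => ?_
  split_ifs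
  · exact h i j
  · exact le_rfl

lemma blockSum_add (f g : Cov p → ℝ) (k l : Fin K) :
    blockSum z e (fun x => f x + g x) k l = blockSum z e f k l + blockSum z e g k l := by
  simp only [blockSum, ← Finset.sum_add_distrib]
  refine Finset.sum_congr rfl fun i _ => Finset.sum_congr rfl fun j _ => ?_
  split_ifs <;> simp

lemma blockSum_const_mul (a : ℝ) (f : Cov p → ℝ) (k l : Fin K) :
    blockSum z e (fun x => a * f x) k l = a * blockSum z e f k l := by
  simp only [blockSum, Finset.mul_sum]
  refine Finset.sum_congr rfl fun i _ => Finset.sum_congr rfl fun j _ => ?_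
  split_ifs <;> simp

lemma blockSum_symm (hz : ∀ i j, z i j = z j i) (f : Cov p → ℝ) (k l : Fin K) :
    blockSum z e f k l = blockSum z e f l k := by
  rw [blockSum, Finset.sum_comm]
  refine Finset.sum_congr rfl fun i _ => Finset.sum_congr rfl fun j _ => ?_
  rw [hz j i]
  exact if_congr ⟨fun h => ⟨h.1.symm, h.2.2, h.2.1⟩, fun h => ⟨h.1.symm, h.2.2, h.2.1⟩⟩ rfl rfl

lemma blockAvg_add (f g : Cov p → ℝ) (k l : Fin K) :
    blockAvg z e γ (fun x => f x + g x) k l = blockAvg z e γ f k l + blockAvg z e γ g k l := by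
  simp only [blockAvg, add_mul, blockSum_add, add_div]

lemma blockAvg_const_mul (a : ℝ) (f : Cov p → ℝ) (k l : Fin K) :
    blockAvg z e γ (fun x => a * f x) k l = a * blockAvg z e γ f k l := by
  simp only [blockAvg, mul_assoc, blockSum_const_mul, mul_div_assoc]

lemma blockAvg_const (hE : blockExp z e γ k l ≠ 0) (a : ℝ) :
    blockAvg z e γ (fun _ => a) k l = a := by
  rw [blockAvg, blockSum_const_mul, blockSum_exp, mul_div_cancel_right₀ _ hE]

lemma blockAvg_mono {f g : Cov p → ℝ} (h : ∀ i j, f (z i j) ≤ g (z i j)) (k l : Fin K)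
    (hE : 0 < blockExp z e γ k l) : blockAvg z e γ f k l ≤ blockAvg z e γ g k l := by
  refine div_le_div_of_nonneg_right (blockSum_mono (fun i j => ?_) k l) hE.le
  exact mul_le_mul_of_nonneg_right (h i j) (Real.exp_pos _).le

lemma blockAvg_sum {ι : Type*} (s : Finset ι) (f : ι → Cov p → ℝ) (k l : Fin K) :
    blockAvg z e γ (fun x => ∑ i ∈ s, f i x) k l = ∑ i ∈ s, blockAvg z e γ (f i) k l := by
  classical
  induction s using Finset.induction_on with
  | empty => simp [blockAvg, blockSum]
  | insert i s hi ih => simp only [Finset.sum_insert hi, blockAvg_add, ih]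

lemma blockAvg_abs_le {f : Cov p → ℝ} {C : ℝ} (h : ∀ i j, |f (z i j)| ≤ C) (k l : Fin K)
    (hE : 0 < blockExp z e γ k l) : |blockAvg z e γ f k l| ≤ C := by
  rw [abs_le]
  constructor
  · rw [← blockAvg_const hE.ne' (-C)]
    exact blockAvg_mono (fun i j => (abs_le.1 (h i j)).1) k l hE
  · rw [← blockAvg_const hE.ne' C]
    exact blockAvg_mono (fun i j => (abs_le.1 (h i j)).2) k l hE

/-- Large blocks have large exponential sums. -/
lemma le_blockExp {κ R : ℝ} (hκ : 0 < κ) (hn : 2 ≤ κ * n)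
    (hb : ∀ k, κ ≤ (blockSize e k : ℝ) / n) (hz : ∀ i j, ‖z i j‖ ≤ R) (k l : Fin K) :
    κ ^ 2 * Real.exp (-(R * ‖γ‖)) * numPairs n ≤ blockExp z e γ k l := by
  have hn0 : (0 : ℝ) < n := by
    rcases Nat.eq_zero_or_pos n with h | h
    · subst h; norm_num at hn
    · exact_mod_cast h
  have hk : ∀ k, κ * n ≤ blockSize e k := fun k => (le_div_iff₀ hn0).1 (hb k)
  -- The subtracted block size pays for the pairs `i = j`. They occur only if `k = l`, but the bound
  -- is used for all blocks alike.
  have hcount : (blockSize e k : ℝ) * blockSize e l - blockSize e k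
      ≤ blockSum z e (fun _ => 1) k l := by
    have h1 : ∀ k, (blockSize e k : ℝ) = ∑ i, if e i = k then (1 : ℝ) else 0 := by
      intro k; simp [blockSize]
    have h2 : (blockSize e k : ℝ) = ∑ i, ∑ j, if j = i ∧ e i = k then (1 : ℝ) else 0 := by
      rw [h1 k]
      refine Finset.sum_congr rfl fun i _ => ?_
      by_cases h : e i = k <;> simp [h]
    rw [show (blockSize e k : ℝ) * blockSize e l
      = ∑ i, ∑ j, (if e i = k then (1 : ℝ) else 0) * (if e j = l then 1 else 0) by
        rw [h1 k, h1 l, Finset.sum_mul_sum]]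
    conv_lhs => rw [h2]
    simp only [← Finset.sum_sub_distrib, blockSum]
    refine Finset.sum_le_sum fun i _ => Finset.sum_le_sum fun j _ => ?_
    by_cases h3 : j = i
    · subst h3
      by_cases h1 : e j = k <;> by_cases h2 : e j = l <;> simp [h1]
      all_goals (split_ifs <;> norm_num)
    · have h3' : ¬ i = j := fun h => h3 h.symm
      by_cases h1 : e i = k <;> by_cases h2 : e j = l <;> simp [h1, h2, h3, h3']
  have hexp : Real.exp (-(R * ‖γ‖)) * blockSum z e (fun _ => 1) k l ≤ blockExp z e γ k l := by
    rw [← blockSum_const_mul, ← blockSum_exp]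
    refine blockSum_mono (fun i j => ?_) k l
    rw [mul_one]
    refine Real.exp_le_exp.2 ?_
    have h1 := abs_real_inner_le_norm (z i j) γ
    have h2 : ‖z i j‖ * ‖γ‖ ≤ R * ‖γ‖ := by gcongr; exact hz i j
    linarith [neg_abs_le (inner ℝ (z i j) γ)]
  have hlow : κ ^ 2 * numPairs n ≤ (blockSize e k : ℝ) * blockSize e l - blockSize e k := by
    have h1 := hk k
    have h2 := hk l
    rw [numPairs]
    have h3 : κ * n * (κ * n - 1) ≤ (blockSize e k : ℝ) * (blockSize e l - 1) :=
      mul_le_mul h1 (by linarith) (by linarith) (by linarith)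
    -- `2 ≤ κ * n` makes `κ * n - 1` at least `κ * n / 2`, which absorbs the diagonal correction.
    have h4 : κ * n * (κ * n / 2) ≤ κ * n * (κ * n - 1) := by
      gcongr
      linarith
    have h5 : κ ^ 2 * n * ((n : ℝ) - 1) ≤ κ ^ 2 * n * n := by gcongr; linarith
    nlinarith
  calc κ ^ 2 * Real.exp (-(R * ‖γ‖)) * numPairs n
      = Real.exp (-(R * ‖γ‖)) * (κ ^ 2 * numPairs n) := by ring
    _ ≤ Real.exp (-(R * ‖γ‖)) * blockSum z e (fun _ => 1) k l := by gcongr; linarith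
    _ ≤ _ := hexp

end Block

/-! ### The asymptotic regime -/

/-- A sequence of networks from the model in the regime of the limit theorem. The covariates are
bounded by `R` in Euclidean norm. -/
structure Regime {Ω : ℕ → Type*} [∀ n, MeasurableSpace (Ω n)] (P : (n : ℕ) → Measure (Ω n))
    {K p : ℕ} (π : Fin K → ℝ) (Bbar : Matrix (Fin K) (Fin K) ℝ) (ν : Measure (Cov p))
    (γ₀ : Cov p) (ρ : ℕ → ℝ) (c e : (n : ℕ) → Ω n → Fin n → Fin K)
    (z : (n : ℕ) → Ω n → Fin n → Fin n → Cov p) (A : (n : ℕ) → Ω n → Fin n → Fin n → ℕ)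
    (R κ : ℝ) : Prop where
  B_symm : Bbar.IsSymm
  B_nonneg : ∀ a b, 0 ≤ Bbar a b
  R_nonneg : 0 ≤ R
  bdd : ∀ᵐ x ∂ν, ‖x‖ ≤ R
  ρ_pos : ∀ n, 0 < ρ n
  ρ_zero : Tendsto ρ atTop (𝓝 0)
  ρ_edges : Tendsto (fun n => numPairs n * ρ n) atTop atTop
  model : ∀ n, IsPCABM (P n) π (ρ n • Bbar) ν γ₀ (c n) (e n) (z n) (A n)
  κ_pos : 0 < κ
  blocks : ∀ᶠ n : ℕ in atTop, ∀ᵐ ω ∂(P n), ∀ k, κ ≤ (blockSize (e n ω) k : ℝ) / n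

/-- `∑_{a,b} B̄_{ab} π_a π_b`, the limiting mean connectivity. -/
def meanB {K : ℕ} (Bbar : Matrix (Fin K) (Fin K) ℝ) (π : Fin K → ℝ) : ℝ :=
  ∑ a, ∑ b, Bbar a b * π a * π b

lemma tendsto_numPairs : Tendsto numPairs atTop atTop := by
  have h : Tendsto (fun n : ℕ => (n : ℝ) - 1) atTop atTop :=
    tendsto_atTop_add_const_right _ _ tendsto_natCast_atTop_atTop
  exact (tendsto_natCast_atTop_atTop.atTop_mul_atTop₀ h).atTop_div_const two_pos

lemma numPairs_pos {n : ℕ} (hn : 2 ≤ n) : 0 < numPairs n := by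
  have : (2 : ℝ) ≤ n := by exact_mod_cast hn
  rw [numPairs]
  have : (0 : ℝ) < n * (n - 1) := mul_pos (by linarith) (by linarith)
  linarith

section Sequence

variable {Ω : ℕ → Type*} [∀ n, MeasurableSpace (Ω n)] {P : (n : ℕ) → Measure (Ω n)}
  {K p : ℕ} {π : Fin K → ℝ}
  {Bbar : Matrix (Fin K) (Fin K) ℝ} {ν : Measure (Cov p)} {γ₀ : Cov p} {ρ : ℕ → ℝ}
  {c e : (n : ℕ) → Ω n → Fin n → Fin K} {z : (n : ℕ) → Ω n → Fin n → Fin n → Cov p}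
  {A : (n : ℕ) → Ω n → Fin n → Fin n → ℕ} {R κ : ℝ}

lemma Regime.ae_norm_z (h : Regime P π Bbar ν γ₀ ρ c e z A R κ) (n : ℕ) :
    ∀ᵐ ω ∂(P n), ∀ i j, ‖z n ω i j‖ ≤ R := by
  rw [ae_all_iff]
  intro i
  rw [ae_all_iff]
  intro j
  rcases lt_trichotomy i j with hij | hij | hij
  · exact (h.model n).ae_z h.bdd hij
  · subst hij
    filter_upwards with ω
    rw [(h.model n).z_diag]
    simpa using h.R_nonneg
  · filter_upwards [(h.model n).ae_z h.bdd hij] with ω hω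
    rwa [(h.model n).z_symm]

lemma Regime.eventually_norm_z (h : Regime P π Bbar ν γ₀ ρ c e z A R κ) :
    ∀ᶠ x in inProb P, ∀ i j, ‖z x.1 x.2 i j‖ ≤ R :=
  eventually_inProb_of_ae (p := fun x => ∀ i j, ‖z x.1 x.2 i j‖ ≤ R)
    (Eventually.of_forall h.ae_norm_z)

/-- Each block contains a fixed fraction of all pairs and bounded covariates keep the weights away
from zero. Denominators of order `N_n`, for all blocks at once, are what make the block averages
concentrate. -/
lemma Regime.eventually_le_blockExp (h : Regime P π Bbar ν γ₀ ρ c e z A R κ) :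
    ∀ᶠ x in inProb P, ∀ k l,
      κ ^ 2 * Real.exp (-(R * ‖γ₀‖)) * numPairs x.1 ≤ blockExp (z x.1 x.2) (e x.1 x.2) γ₀ k l := by
  have h1 : ∀ᶠ x in inProb P, ∀ k, κ ≤ (blockSize (e x.1 x.2) k : ℝ) / x.1 :=
    eventually_inProb_of_ae (p := fun x => ∀ k, κ ≤ (blockSize (e x.1 x.2) k : ℝ) / x.1) h.blocks
  have h2 : ∀ᶠ n : ℕ in atTop, 2 ≤ κ * n :=
    (tendsto_natCast_atTop_atTop.const_mul_atTop h.κ_pos).eventually_ge_atTop 2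
  filter_upwards [h1, tendsto_fst_inProb.eventually h2, h.eventually_norm_z] with x hx1 hx2 hx3
  exact le_blockExp h.κ_pos hx2 hx1 hx3

lemma eventually_two_le_fst : ∀ᶠ x : Σ n, Ω n in inProb P, 2 ≤ x.1 :=
  tendsto_fst_inProb.eventually (eventually_ge_atTop 2)

lemma Regime.eventually_blockExp_pos (h : Regime P π Bbar ν γ₀ ρ c e z A R κ) :
    ∀ᶠ x in inProb P, ∀ k l, 0 < blockExp (z x.1 x.2) (e x.1 x.2) γ₀ k l := by
  filter_upwards [h.eventually_le_blockExp, eventually_two_le_fst] with x hx hx2 k l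
  have := h.κ_pos
  have := numPairs_pos hx2
  exact lt_of_lt_of_le (by positivity) (hx k l)

lemma Regime.integrable [IsProbabilityMeasure ν] (h : Regime P π Bbar ν γ₀ ρ c e z A R κ)
    {f : Cov p → ℝ} {F : ℝ} (hf : Measurable f) (hF : ∀ x, ‖x‖ ≤ R → |f x| ≤ F) :
    Integrable f ν :=
  Integrable.of_bound hf.aestronglyMeasurable F (by
    filter_upwards [h.bdd] with x hx using hF x hx)

lemma exp_inner_le {x γ : Cov p} (hx : ‖x‖ ≤ R) :
    Real.exp (inner ℝ x γ) ≤ Real.exp (R * ‖γ‖) :=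
  Real.exp_le_exp.2 ((real_inner_le_norm x γ).trans (by gcongr))

lemma abs_mul_exp_inner_le {x γ : Cov p} {y F : ℝ} (hx : ‖x‖ ≤ R) (hy : |y| ≤ F) :
    |y * Real.exp (inner ℝ x γ)| ≤ F * Real.exp (R * ‖γ‖) := by
  rw [abs_mul, abs_of_pos (Real.exp_pos _)]
  exact mul_le_mul hy (exp_inner_le hx) (Real.exp_pos _).le ((abs_nonneg _).trans hy)

lemma measurable_exp_inner (γ : Cov p) : Measurable fun x : Cov p => Real.exp (inner ℝ x γ) := by
  fun_prop

lemma Regime.theta_pos [IsProbabilityMeasure ν] (h : Regime P π Bbar ν γ₀ ρ c e z A R κ) :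
    0 < theta ν γ₀ := by
  refine integral_exp_pos (h.integrable (F := 1 * Real.exp (R * ‖γ₀‖)) (measurable_exp_inner γ₀) ?_)
  intro x hx
  simpa using abs_mul_exp_inner_le (y := 1) (F := 1) (γ := γ₀) hx (by simp)

/-! ### Laws of large numbers for covariates and labels -/

variable [∀ n, IsProbabilityMeasure (P n)]

/-- Law of large numbers, with a rate, for weighted sums of centred functions of the covariates. -/
lemma Regime.tendsto_sum_centred (h : Regime P π Bbar ν γ₀ ρ c e z A R κ) {f : Cov p → ℝ}
    {F M : ℝ} (hf : Measurable f) (hF : ∀ x, ‖x‖ ≤ R → |f x| ≤ F) (hf0 : ∫ x, f x ∂ν = 0)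
    (a : (n : ℕ) → (Fin n → Fin K) → (Fin n → Fin K) → Fin n × Fin n → ℝ)
    (ha : ∀ n u v q, |a n u v q| ≤ M) {β : ℕ → ℝ} (hβ : Tendsto β atTop (𝓝 0)) :
    Tendsto (fun x : Σ n, Ω n => β x.1 / Real.sqrt (numPairs x.1) *
      ∑ q ∈ pairs x.1, a x.1 (c x.1 x.2) (e x.1 x.2) q * f (z x.1 x.2 q.1 q.2))
      (inProb P) (𝓝 0) := by
  have hFν : ∀ᵐ x ∂ν, |f x| ≤ F := by filter_upwards [h.bdd] with x hx using hF x hx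
  have hb : ∀ n, _ := fun n => (h.model n).integral_sq_sum_z_le hf hFν hf0 (a n) (ha n)
  -- The second moment of the sum is at most `numPairs n * (M * F) ^ 2`, so after division by
  -- `√(numPairs n)` only `β n ^ 2` remains, and any null `β` suffices.
  refine tendsto_inProb_of_sq (X := fun n ω => β n / Real.sqrt (numPairs n) *
      ∑ q ∈ pairs n, a n (c n ω) (e n ω) q * f (z n ω q.1 q.2))
      (b := fun n => β n ^ 2 * (M * F) ^ 2) ?_ ?_ ?_
  · refine Eventually.of_forall fun n => ?_
    simp_rw [mul_pow]
    exact (hb n).1.const_mul _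
  · filter_upwards [eventually_ge_atTop 2] with n hn
    simp_rw [mul_pow]
    rw [integral_const_mul, div_pow, Real.sq_sqrt (numPairs_pos hn).le]
    have hN := numPairs_pos hn
    calc β n ^ 2 / numPairs n * _ ≤ β n ^ 2 / numPairs n * (numPairs n * (M * F) ^ 2) := by
          gcongr; exact (hb n).2
      _ = β n ^ 2 * (M ^ 2 * F ^ 2) := by field_simp
  · simpa using (hβ.pow 2).mul_const ((M * F) ^ 2)

lemma tendsto_inv_sqrt_numPairs : Tendsto (fun n => 1 / Real.sqrt (numPairs n)) atTop (𝓝 0) := by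
  simp only [one_div]
  exact (Real.tendsto_sqrt_atTop.comp tendsto_numPairs).inv_tendsto_atTop

/-- Law of large numbers, with a rate, for weighted block averages. -/
lemma Regime.tendsto_blockAvg_sub [IsProbabilityMeasure ν]
    (h : Regime P π Bbar ν γ₀ ρ c e z A R κ) {f : Cov p → ℝ}
    {F : ℝ} (hf : Measurable f) (hF : ∀ x, ‖x‖ ≤ R → |f x| ≤ F) {β : ℕ → ℝ}
    (hβ : Tendsto β atTop (𝓝 0)) (k l : Fin K) :
    Tendsto (fun x : Σ n, Ω n => β x.1 * Real.sqrt (numPairs x.1) *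
      (blockAvg (z x.1 x.2) (e x.1 x.2) γ₀ f k l
        - (∫ y, f y * Real.exp (inner ℝ y γ₀) ∂ν) / theta ν γ₀)) (inProb P) (𝓝 0) := by
  set m := (∫ y, f y * Real.exp (inner ℝ y γ₀) ∂ν) / theta ν γ₀ with hm
  have hF' : ∀ x, ‖x‖ ≤ R → |f x - m| ≤ F + |m| := fun x hx =>
    (abs_sub _ _).trans (by gcongr; exact hF x hx)
  -- Centring `f` at `m` before tilting gives `g` mean zero under `ν`, and the deviation of the
  -- block average from `m` is exactly the block sum of `g` over `blockExp`.
  set g : Cov p → ℝ := fun x => (f x - m) * Real.exp (inner ℝ x γ₀) with hg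
  have hgm : Measurable g := (hf.sub_const m).mul (measurable_exp_inner γ₀)
  have hgb : ∀ x, ‖x‖ ≤ R → |g x| ≤ (F + |m|) * Real.exp (R * ‖γ₀‖) := fun x hx =>
    abs_mul_exp_inner_le hx (hF' x hx)
  have hg0 : ∫ x, g x ∂ν = 0 := by
    simp only [hg, sub_mul]
    rw [integral_sub, integral_const_mul]
    · rw [hm, ← theta, div_mul_cancel₀ _ h.theta_pos.ne', sub_self]
    · exact h.integrable (hf.mul (measurable_exp_inner γ₀))
        fun x hx => abs_mul_exp_inner_le hx (hF x hx)
    · exact h.integrable (measurable_const.mul (measurable_exp_inner γ₀))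
        fun x hx => abs_mul_exp_inner_le hx le_rfl
  have hD := h.tendsto_sum_centred hgm hgb hg0
    (fun n u v q => (if v q.1 = k ∧ v q.2 = l then 1 else 0)
      + (if v q.2 = k ∧ v q.1 = l then 1 else 0)) (M := 2)
    (fun n u v q => by split_ifs <;> norm_num) hβ
  set c0 := κ ^ 2 * Real.exp (-(R * ‖γ₀‖)) with hc0
  have hc0p : 0 < c0 := by have := h.κ_pos; positivity
  have hD' := hD.norm.const_mul (1 / c0)
  rw [norm_zero, mul_zero] at hD'
  refine squeeze_zero_norm' ?_ hD'
  filter_upwards [h.eventually_le_blockExp, eventually_two_le_fst, h.eventually_blockExp_pos]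
    with x hx hx2 hx3
  have hN := numPairs_pos hx2
  have hE := hx3 k l
  have hEq : blockAvg (z x.1 x.2) (e x.1 x.2) γ₀ f k l - m
      = blockSum (z x.1 x.2) (e x.1 x.2) g k l / blockExp (z x.1 x.2) (e x.1 x.2) γ₀ k l := by
    have h1 : g = fun x => f x * Real.exp (inner ℝ x γ₀) + (-m) * Real.exp (inner ℝ x γ₀) := by
      funext x; simp only [hg]; ring
    rw [h1, blockSum_add, blockSum_const_mul, blockSum_exp, blockAvg]
    field_simp
    ring
  rw [hEq, ← blockSum_eq_sum_pairs ((h.model x.1).z_symm x.2)]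
  set D := blockSum (z x.1 x.2) (e x.1 x.2) g k l
  set E := blockExp (z x.1 x.2) (e x.1 x.2) γ₀ k l
  have hs : Real.sqrt (numPairs x.1) ≠ 0 := (Real.sqrt_pos.2 hN).ne'
  -- The factor `numPairs / E` is at most `1 / c0`; what is left is the normalized centred sum
  -- already known to vanish.
  have h2 : β x.1 * Real.sqrt (numPairs x.1) * (D / E)
      = (numPairs x.1 / E) * (β x.1 / Real.sqrt (numPairs x.1) * D) := by
    have := Real.mul_self_sqrt hN.le
    field_simp
    rw [Real.sq_sqrt hN.le]
    ring
  rw [h2, norm_mul]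
  refine mul_le_mul_of_nonneg_right ?_ (norm_nonneg _)
  rw [Real.norm_eq_abs, abs_of_pos (div_pos hN hE), div_le_div_iff₀ hE hc0p]
  have := hx k l
  linarith

/-- The limit does not depend on the block: an uninformative assignment samples the covariates of
each block from the same law. It is the rate statement with `β = 1 / √N_n`. -/
lemma Regime.tendsto_blockAvg [IsProbabilityMeasure ν]
    (h : Regime P π Bbar ν γ₀ ρ c e z A R κ) {f : Cov p → ℝ}
    {F : ℝ} (hf : Measurable f) (hF : ∀ x, ‖x‖ ≤ R → |f x| ≤ F) (k l : Fin K) :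
    Tendsto (fun x : Σ n, Ω n => blockAvg (z x.1 x.2) (e x.1 x.2) γ₀ f k l) (inProb P)
      (𝓝 ((∫ y, f y * Real.exp (inner ℝ y γ₀) ∂ν) / theta ν γ₀)) := by
  rw [← tendsto_sub_nhds_zero_iff]
  refine (h.tendsto_blockAvg_sub hf hF tendsto_inv_sqrt_numPairs k l).congr' ?_
  filter_upwards [eventually_two_le_fst] with x hx
  have := (Real.sqrt_pos.2 (numPairs_pos hx)).ne'
  field_simp

lemma exists_abs_le_of_matrix (M : Matrix (Fin K) (Fin K) ℝ) :
    ∃ C : ℝ, 0 ≤ C ∧ ∀ a b, |M a b| ≤ C := by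
  obtain ⟨C, hC⟩ := (Set.finite_range fun q : Fin K × Fin K => |M q.1 q.2|).bddAbove
  refine ⟨max C 0, le_max_right _ _, fun a b => le_max_of_le_left (hC ⟨(a, b), rfl⟩)⟩

/-- The relative frequencies of the true labels converge. -/
lemma Regime.tendsto_label_freq (h : Regime P π Bbar ν γ₀ ρ c e z A R κ) (k : Fin K) :
    Tendsto (fun x : Σ n, Ω n => (x.1 : ℝ)⁻¹ * ∑ i, if c x.1 x.2 i = k then (1 : ℝ) else 0)
      (inProb P) (𝓝 (π k)) := by
  rw [← tendsto_sub_nhds_zero_iff]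
  have h1 : Tendsto (fun x : Σ n, Ω n => (x.1 : ℝ)⁻¹ *
      ∑ i, ((if c x.1 x.2 i = k then (1 : ℝ) else 0) - π k)) (inProb P) (𝓝 0) := by
    have hb : ∀ n, _ := fun n => (h.model n).integral_sq_label_freq_le k
    refine tendsto_inProb_of_sq (X := fun n ω => (n : ℝ)⁻¹ *
      ∑ i, ((if c n ω i = k then (1 : ℝ) else 0) - π k)) (b := fun n => (n : ℝ)⁻¹) ?_ ?_ ?_
    · refine Eventually.of_forall fun n => ?_
      simp_rw [mul_pow]
      exact (hb n).1.const_mul _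
    · filter_upwards [eventually_ge_atTop 1] with n hn
      have hn' : (0 : ℝ) < n := by exact_mod_cast hn
      simp_rw [mul_pow]
      rw [integral_const_mul]
      calc ((n : ℝ)⁻¹) ^ 2 * _ ≤ ((n : ℝ)⁻¹) ^ 2 * n := by gcongr; exact (hb n).2
        _ = (n : ℝ)⁻¹ := by field_simp
    · exact tendsto_inv_atTop_nhds_zero_nat
  refine h1.congr' ?_
  filter_upwards [eventually_two_le_fst] with x hx
  have hx' : (x.1 : ℝ) ≠ 0 := by positivity
  rw [Finset.sum_sub_distrib, Finset.sum_const, Finset.card_univ, Fintype.card_fin, nsmul_eq_mul]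
  field_simp

/-- The mean connectivity of the pairs of nodes converges. -/
lemma Regime.tendsto_meanB (h : Regime P π Bbar ν γ₀ ρ c e z A R κ) :
    Tendsto (fun x : Σ n, Ω n => (numPairs x.1)⁻¹ *
      ∑ q ∈ pairs x.1, Bbar (c x.1 x.2 q.1) (c x.1 x.2 q.2)) (inProb P) (𝓝 (meanB Bbar π)) := by
  obtain ⟨C, hC0, hC⟩ := exists_abs_le_of_matrix Bbar
  have hinv : Tendsto (fun n : ℕ => ((n : ℝ) - 1)⁻¹) atTop (𝓝 0) :=
    (tendsto_atTop_add_const_right _ (-1 : ℝ) tendsto_natCast_atTop_atTop).inv_tendsto_atTop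
  have hinv' : Tendsto (fun x : Σ n, Ω n => ((x.1 : ℝ) - 1)⁻¹) (inProb P) (𝓝 0) :=
    hinv.comp tendsto_fst_inProb
  set fr : Fin K → (Σ n, Ω n) → ℝ :=
    fun k x => (x.1 : ℝ)⁻¹ * ∑ i, if c x.1 x.2 i = k then (1 : ℝ) else 0 with hfr
  have hmain : Tendsto (fun x : Σ n, Ω n => ∑ a, ∑ b, Bbar a b * fr a x * fr b x) (inProb P)
      (𝓝 (meanB Bbar π)) :=
    tendsto_finsetSum _ fun a _ => tendsto_finsetSum _ fun b _ =>
      ((h.tendsto_label_freq a).const_mul _).mul (h.tendsto_label_freq b)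
  have hdiag : Tendsto (fun x : Σ n, Ω n => ((x.1 : ℝ) - 1)⁻¹ *
      ((x.1 : ℝ)⁻¹ * ∑ i, Bbar (c x.1 x.2 i) (c x.1 x.2 i))) (inProb P) (𝓝 0) := by
    have hlim := hinv'.norm.mul_const C
    rw [norm_zero, zero_mul] at hlim
    refine squeeze_zero_norm' ?_ hlim
    filter_upwards [eventually_two_le_fst] with x hx
    have hx' : (0 : ℝ) < x.1 := by positivity
    rw [norm_mul]
    refine mul_le_mul_of_nonneg_left ?_ (norm_nonneg _)
    rw [norm_mul, norm_inv, Real.norm_eq_abs, abs_of_pos hx', inv_mul_le_iff₀ hx']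
    refine (norm_sum_le _ _).trans ?_
    refine (Finset.sum_le_card_nsmul _ _ C fun i _ => hC _ _).trans ?_
    simp
  -- `(n - 1)⁻¹ + 1 = n / (n - 1)` is the ratio of `n ^ 2` ordered pairs to the `n (n - 1)`
  -- off-diagonal ones; `hdiag` removes the diagonal.
  have hall := ((hinv'.add_const 1).mul hmain).sub hdiag
  rw [zero_add, one_mul, sub_zero] at hall
  refine hall.congr' ?_
  filter_upwards [eventually_two_le_fst] with x hx
  have hx2 : (2 : ℝ) ≤ x.1 := by exact_mod_cast hx
  have hdouble : ∑ i, ∑ j, Bbar (c x.1 x.2 i) (c x.1 x.2 j)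
      = (x.1 : ℝ) ^ 2 * ∑ a, ∑ b, Bbar a b * fr a x * fr b x := by
    have h1 : ∀ i j, Bbar (c x.1 x.2 i) (c x.1 x.2 j) = ∑ a, ∑ b, Bbar a b *
        ((if c x.1 x.2 i = a then (1 : ℝ) else 0) * (if c x.1 x.2 j = b then (1 : ℝ) else 0)) := by
      intro i j
      simp
    simp_rw [h1]
    rw [Finset.mul_sum]
    have h2 : ∀ i, ∑ j, ∑ a, ∑ b, Bbar a b *
        ((if c x.1 x.2 i = a then (1 : ℝ) else 0) * (if c x.1 x.2 j = b then (1 : ℝ) else 0))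
        = ∑ a, ∑ b, ∑ j, Bbar a b *
        ((if c x.1 x.2 i = a then (1 : ℝ) else 0) * (if c x.1 x.2 j = b then (1 : ℝ) else 0)) := by
      intro i
      rw [Finset.sum_comm]
      exact Finset.sum_congr rfl fun a _ => Finset.sum_comm
    simp_rw [h2]
    rw [Finset.sum_comm]
    refine Finset.sum_congr rfl fun a _ => ?_
    rw [Finset.sum_comm, Finset.mul_sum]
    refine Finset.sum_congr rfl fun b _ => ?_
    simp_rw [← Finset.mul_sum]
    rw [← Finset.sum_mul]
    simp only [hfr]
    field_simp
  have hpairs := sum_sum_eq_sum_pairs fun i j => Bbar (c x.1 x.2 i) (c x.1 x.2 j)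
  rw [hdouble, Finset.sum_add_distrib, Finset.sum_congr rfl fun (q : Fin x.1 × Fin x.1) _ =>
    h.B_symm.apply (c x.1 x.2 q.1) (c x.1 x.2 q.2)] at hpairs
  set S := ∑ a, ∑ b, Bbar a b * fr a x * fr b x
  set T := ∑ q ∈ pairs x.1, Bbar (c x.1 x.2 q.1) (c x.1 x.2 q.2)
  set D := ∑ i, Bbar (c x.1 x.2 i) (c x.1 x.2 i)
  have hT : T = ((x.1 : ℝ) ^ 2 * S - D) / 2 := by linarith
  have h1 : (x.1 : ℝ) ≠ 0 := by linarith
  have h2 : (x.1 : ℝ) - 1 ≠ 0 := by linarith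
  rw [hT, numPairs]
  field_simp
  ring

/-- Law of large numbers for connectivity-weighted functions of the covariates. -/
lemma Regime.tendsto_sum_B [IsProbabilityMeasure ν]
    (h : Regime P π Bbar ν γ₀ ρ c e z A R κ) {f : Cov p → ℝ}
    {F : ℝ} (hf : Measurable f) (hF : ∀ x, ‖x‖ ≤ R → |f x| ≤ F) :
    Tendsto (fun x : Σ n, Ω n => (numPairs x.1)⁻¹ *
      ∑ q ∈ pairs x.1, Bbar (c x.1 x.2 q.1) (c x.1 x.2 q.2) * f (z x.1 x.2 q.1 q.2))
      (inProb P) (𝓝 (meanB Bbar π * ∫ y, f y ∂ν)) := by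
  obtain ⟨C, hC0, hC⟩ := exists_abs_le_of_matrix Bbar
  set m := ∫ y, f y ∂ν with hm
  have h1 := h.tendsto_sum_centred (f := fun x => f x - m) (F := F + |m|) (hf.sub_const m)
    (fun x hx => (abs_sub _ _).trans (by gcongr; exact hF x hx))
    (by rw [integral_sub (h.integrable hf hF) (integrable_const m)]; simp [hm])
    (fun n u v q => Bbar (u q.1) (u q.2)) (M := C) (fun n u v q => hC _ _)
    tendsto_inv_sqrt_numPairs
  have h2 := h1.add (h.tendsto_meanB.mul_const m)
  rw [zero_add] at h2
  refine h2.congr' ?_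
  filter_upwards [eventually_two_le_fst] with x hx
  have hN := numPairs_pos hx
  rw [div_div, Real.mul_self_sqrt hN.le, one_div, mul_assoc, ← mul_add, Finset.sum_mul,
    ← Finset.sum_add_distrib]
  congr 1
  refine Finset.sum_congr rfl fun q _ => ?_
  ring

end Sequence

/-! ### Maximizers of concave functions -/

/-- A concave function that is smaller on a sphere than at its centre has a maximizer, and all its
maximizers are inside the sphere. -/
lemma exists_argmax_and_norm_sub_lt {E : Type*} [NormedAddCommGroup E] [NormedSpace ℝ E]
    [ProperSpace E] {F : E → ℝ} (hF : ConcaveOn ℝ Set.univ F) (hc : Continuous F) {x₀ : E} {δ : ℝ}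
    (hδ : 0 < δ) (hb : ∀ x, ‖x - x₀‖ = δ → F x < F x₀) :
    (∃ x, ∀ y, F y ≤ F x) ∧ ∀ g, (∀ y, F y ≤ F g) → ‖g - x₀‖ < δ := by
  -- The segment from `x₀` to `y` meets the sphere at parameter `t`. Were `F y` at least `F x₀`,
  -- concavity would force `F` at that point to be at least `F x₀` too.
  have hout : ∀ y, δ ≤ ‖y - x₀‖ → F y < F x₀ := by
    intro y hy
    have hy0 : 0 < ‖y - x₀‖ := hδ.trans_le hy
    set t := δ / ‖y - x₀‖ with ht
    have ht0 : 0 < t := div_pos hδ hy0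
    have ht1 : t ≤ 1 := (div_le_one hy0).2 hy
    have h1 := hF.2 (Set.mem_univ x₀) (Set.mem_univ y) (sub_nonneg.2 ht1) ht0.le (by ring)
    have h2 : (1 - t) • x₀ + t • y - x₀ = t • (y - x₀) := by module
    have h3 := hb ((1 - t) • x₀ + t • y) (by
      rw [h2, norm_smul, Real.norm_eq_abs, abs_of_pos ht0, ht, div_mul_cancel₀ _ hy0.ne'])
    simp only [smul_eq_mul] at h1
    nlinarith
  constructor
  · obtain ⟨x, -, hx⟩ := (isCompact_closedBall x₀ δ).exists_isMaxOn
      ⟨x₀, Metric.mem_closedBall_self hδ.le⟩ hc.continuousOn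
    refine ⟨x, fun y => ?_⟩
    by_cases hy : ‖y - x₀‖ ≤ δ
    · exact hx (by rwa [Metric.mem_closedBall, dist_eq_norm])
    · exact (hout y (not_le.1 hy).le).le.trans (hx (Metric.mem_closedBall_self hδ.le))
  · intro g hg
    by_contra hc'
    exact absurd (hg x₀) (not_le.2 (hout g (not_lt.1 hc')))

/-! ### Concavity of the profile likelihood -/

/-- Convexity of `exp` is applied termwise after subtracting `log X` and `log Y` from the exponents.
The normalized terms sum to one at both endpoints, so the sum at the intermediate point is at most
`exp L`. -/
lemma convexOn_log_sum_exp_inner {E ι : Type*} [NormedAddCommGroup E] [InnerProductSpace ℝ E]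
    (s : Finset ι) (v : ι → E) :
    ConvexOn ℝ Set.univ fun γ => Real.log (∑ i ∈ s, Real.exp (inner ℝ (v i) γ)) := by
  -- For an empty block `Real.log 0 = 0` makes the function constant.
  rcases s.eq_empty_or_nonempty with rfl | hs
  · simpa using convexOn_const 0 convex_univ
  refine ⟨convex_univ, fun x _ y _ a b ha hb hab => ?_⟩
  have hpos : ∀ γ, 0 < ∑ i ∈ s, Real.exp (inner ℝ (v i) γ) := fun γ =>
    Finset.sum_pos (fun i _ => Real.exp_pos _) hs
  set X := ∑ i ∈ s, Real.exp (inner ℝ (v i) x) with hX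
  set Y := ∑ i ∈ s, Real.exp (inner ℝ (v i) y) with hY
  have hXp : 0 < X := hpos x
  have hYp : 0 < Y := hpos y
  simp only [smul_eq_mul]
  rw [Real.log_le_iff_le_exp (hpos _)]
  set L := a * Real.log X + b * Real.log Y with hL
  have hterm : ∀ i ∈ s, Real.exp (inner ℝ (v i) (a • x + b • y)) ≤ Real.exp L *
      (a * (Real.exp (inner ℝ (v i) x) / X) + b * (Real.exp (inner ℝ (v i) y) / Y)) := by
    intro i _
    have h1 := convexOn_exp.2 (Set.mem_univ (inner ℝ (v i) x - Real.log X))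
      (Set.mem_univ (inner ℝ (v i) y - Real.log Y)) ha hb hab
    simp only [smul_eq_mul, Real.exp_sub, Real.exp_log hXp, Real.exp_log hYp] at h1
    have h2 : inner ℝ (v i) (a • x + b • y)
        = L + (a * (inner ℝ (v i) x - Real.log X) + b * (inner ℝ (v i) y - Real.log Y)) := by
      rw [inner_add_right, real_inner_smul_right, real_inner_smul_right]
      ring
    rw [h2, Real.exp_add]
    gcongr
  refine (Finset.sum_le_sum hterm).trans_eq ?_
  rw [← Finset.mul_sum, Finset.sum_add_distrib, ← Finset.mul_sum, ← Finset.mul_sum,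
    ← Finset.sum_div, ← Finset.sum_div, ← hX, ← hY, div_self (hpos x).ne', div_self (hpos y).ne',
    mul_one, mul_one, hab, mul_one]

lemma continuous_log_sum_exp_inner {E ι : Type*} [NormedAddCommGroup E] [InnerProductSpace ℝ E]
    (s : Finset ι) (v : ι → E) :
    Continuous fun γ => Real.log (∑ i ∈ s, Real.exp (inner ℝ (v i) γ)) := by
  rcases s.eq_empty_or_nonempty with rfl | hs
  · simpa using continuous_const
  refine Continuous.log (by fun_prop) fun γ => (Finset.sum_pos (fun i _ => Real.exp_pos _) hs).ne'

section Lik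

variable {n K p : ℕ} {A : Fin n → Fin n → ℕ} {z : Fin n → Fin n → Cov p} {e : Fin n → Fin K}
  {γ : Cov p}

lemma blockExp_eq_sum_filter (k l : Fin K) : blockExp z e γ k l =
    ∑ q ∈ Finset.univ.filter (fun q : Fin n × Fin n => q.1 ≠ q.2 ∧ e q.1 = k ∧ e q.2 = l),
      Real.exp (inner ℝ (z q.1 q.2) γ) := by
  rw [Finset.sum_filter, Fintype.sum_prod_type]
  rfl

/-- The profile likelihood as a sum over pairs of nodes. -/
lemma logLik_eq_sum_pairs (hA : ∀ i j, A i j = A j i) (hA0 : ∀ i, A i i = 0)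
    (hz : ∀ i j, z i j = z j i) : logLik A z e γ = ∑ q ∈ pairs n, (A q.1 q.2 : ℝ) *
      (inner ℝ (z q.1 q.2) γ - Real.log (blockExp z e γ (e q.1) (e q.2))) := by
  have h1 : ∑ k, ∑ l, blockEdges A e k l * Real.log (blockExp z e γ k l)
      = ∑ i, ∑ j, (A i j : ℝ) * Real.log (blockExp z e γ (e i) (e j)) := by
    simp only [blockEdges, Finset.sum_mul]
    have h2 : ∀ k, ∑ l, ∑ i, ∑ j, (if e i = k ∧ e j = l then (A i j : ℝ) else 0)
          * Real.log (blockExp z e γ k l)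
        = ∑ i, ∑ j, ∑ l, (if e i = k ∧ e j = l then (A i j : ℝ) else 0)
          * Real.log (blockExp z e γ k l) := by
      intro k
      rw [Finset.sum_comm]
      exact Finset.sum_congr rfl fun i _ => Finset.sum_comm
    simp_rw [h2]
    rw [Finset.sum_comm]
    refine Finset.sum_congr rfl fun i _ => ?_
    rw [Finset.sum_comm]
    refine Finset.sum_congr rfl fun j _ => ?_
    simp [ite_and, ite_mul]
  have hsymm : ∀ k l, blockExp z e γ k l = blockExp z e γ l k := fun k l => by
    rw [← blockSum_exp, ← blockSum_exp, blockSum_symm hz]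
  rw [logLik, h1, sum_sum_eq_sum_pairs]
  simp only [hA0, Nat.cast_zero, zero_mul, Finset.sum_const_zero, add_zero]
  rw [Finset.mul_sum, ← Finset.sum_sub_distrib]
  refine Finset.sum_congr rfl fun q _ => ?_
  rw [hA q.2 q.1, hsymm (e q.2) (e q.1)]
  ring

/-- Each pair contributes a nonnegative count times a linear function minus a log-sum-exp. Concavity
makes a local expansion decide where the global maximizers are. -/
lemma concaveOn_logLik (hA : ∀ i j, A i j = A j i) (hA0 : ∀ i, A i i = 0)
    (hz : ∀ i j, z i j = z j i) : ConcaveOn ℝ Set.univ (logLik A z e) := by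
  have h : logLik A z e = fun γ => ∑ q ∈ pairs n, (A q.1 q.2 : ℝ) *
      (inner ℝ (z q.1 q.2) γ - Real.log (blockExp z e γ (e q.1) (e q.2))) :=
    funext fun γ => logLik_eq_sum_pairs hA hA0 hz
  refine ⟨convex_univ, fun x _ y _ a b ha hb hab => ?_⟩
  rw [h]
  simp only [smul_eq_mul, Finset.mul_sum]
  rw [← Finset.sum_add_distrib]
  refine Finset.sum_le_sum fun q _ => ?_
  have h1 := (convexOn_log_sum_exp_inner (Finset.univ.filter
    (fun q' : Fin n × Fin n => q'.1 ≠ q'.2 ∧ e q'.1 = e q.1 ∧ e q'.2 = e q.2))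
    (fun q' => z q'.1 q'.2)).2 (Set.mem_univ x) (Set.mem_univ y) ha hb hab
  simp only [← blockExp_eq_sum_filter, smul_eq_mul] at h1
  rw [inner_add_right, real_inner_smul_right, real_inner_smul_right]
  have h2 : (0 : ℝ) ≤ A q.1 q.2 := Nat.cast_nonneg _
  nlinarith

lemma continuous_logLik (hA : ∀ i j, A i j = A j i) (hA0 : ∀ i, A i i = 0)
    (hz : ∀ i j, z i j = z j i) : Continuous (logLik A z e) := by
  have h : logLik A z e = fun γ => ∑ q ∈ pairs n, (A q.1 q.2 : ℝ) *
      (inner ℝ (z q.1 q.2) γ - Real.log (blockExp z e γ (e q.1) (e q.2))) :=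
    funext fun γ => logLik_eq_sum_pairs hA hA0 hz
  rw [h]
  refine continuous_finsetSum _ fun q _ => continuous_const.mul
    ((continuous_const.inner continuous_id).sub ?_)
  simp only [blockExp_eq_sum_filter]
  exact continuous_log_sum_exp_inner _ _

/-! ### Second order expansion -/

lemma abs_exp_sub_quadratic_le {x b : ℝ} (hx : |x| ≤ b) (hb : b ≤ 1) :
    |Real.exp x - 1 - x - x ^ 2 / 2| ≤ b ^ 3 := by
  have h := Real.exp_bound (hx.trans hb) (n := 3) (by norm_num)
  simp only [Finset.sum_range_succ, Finset.sum_range_zero] at h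
  norm_num [Nat.factorial] at h
  have h2 : |x| ^ 3 ≤ b ^ 3 := by gcongr
  have h3 : Real.exp x - 1 - x - x ^ 2 / 2 = Real.exp x - (1 + x + x ^ 2 / 2) := by ring
  rw [h3]
  have h4 : 0 ≤ |x| ^ 3 := by positivity
  linarith

lemma abs_log_one_add_sub_quadratic_le {y : ℝ} (hy : |y| ≤ 1 / 2) :
    |Real.log (1 + y) - y + y ^ 2 / 2| ≤ 2 * |y| ^ 3 := by
  have h := Real.abs_log_sub_add_sum_range_le (x := -y) (by rw [abs_neg]; linarith) 2
  simp only [Finset.sum_range_succ, Finset.sum_range_zero] at h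
  norm_num at h
  have h3 : Real.log (1 + y) - y + y ^ 2 / 2 = -y + y ^ 2 / 2 + Real.log (1 + y) := by ring
  rw [h3]
  refine h.trans ?_
  rw [div_le_iff₀ (by linarith)]
  nlinarith [pow_nonneg (abs_nonneg y) 3]

/-- The second order expansion of the logarithm of a Laplace transform, given the second order
expansion of the Laplace transform. -/
lemma abs_log_sub_cumulants_le {b m₁ m₂ M : ℝ} (hb : b ≤ 1 / 4) (h1 : |m₁| ≤ b)
    (h2 : |m₂| ≤ b ^ 2) (hM : |M - 1 - m₁ - m₂ / 2| ≤ b ^ 3) :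
    |Real.log M - m₁ - (m₂ - m₁ ^ 2) / 2| ≤ 20 * b ^ 3 := by
  have hb0 : 0 ≤ b := (abs_nonneg _).trans h1
  have hb2 : b ^ 2 ≤ b / 4 := by nlinarith
  have hb3 : b ^ 3 ≤ b ^ 2 / 4 := by nlinarith [sq_nonneg b]
  set y := M - 1 with hy
  rw [abs_le] at h1 h2 hM
  have hyb : |y| ≤ 2 * b := by rw [abs_le]; constructor <;> linarith
  have hlog := abs_log_one_add_sub_quadratic_le (y := y) (by linarith)
  have hy3 : |y| ^ 3 ≤ (2 * b) ^ 3 := by gcongr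
  have hd : |y - m₁| ≤ b ^ 2 := by rw [abs_le]; constructor <;> linarith
  have hs : |y + m₁| ≤ 3 * b := by
    rw [abs_le] at hyb ⊢; constructor <;> linarith
  have hsq : |y ^ 2 - m₁ ^ 2| ≤ 3 * b ^ 3 := by
    rw [sq_sub_sq, abs_mul]
    calc |y + m₁| * |y - m₁| ≤ 3 * b * b ^ 2 := by gcongr
      _ = 3 * b ^ 3 := by ring
  have hM1 : 1 + y = M := by rw [hy]; ring
  rw [hM1] at hlog
  -- The error is the sum of the logarithm remainder, at most `2 (2b)³ = 16 b³`, the assumed `b³`,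
  -- and half of `|y² - m₁²| ≤ 3 b³`; the total `18.5 b³` is rounded up to `20 b³`.
  rw [abs_le] at hlog hsq ⊢
  have hc : 0 ≤ b ^ 3 := by positivity
  constructor <;> nlinarith

/-- The weighted block variance of the linear form `h`. -/
def blockVar (z : Fin n → Fin n → Cov p) (e : Fin n → Fin K) (γ h : Cov p) (k l : Fin K) : ℝ :=
  blockAvg z e γ (fun x => inner ℝ x h ^ 2) k l - blockAvg z e γ (fun x => inner ℝ x h) k l ^ 2

/-- The ratio of the exponential sums at `γ + h` and `γ` is the Laplace transform at `h` of the
weighted empirical law of the block. Its logarithm expands in cumulants, here mean and variance,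
with a cubic remainder because the linear form is bounded by `R * ‖h‖`. -/
lemma abs_log_blockExp_add_sub_le {R : ℝ} (hz : ∀ i j, ‖z i j‖ ≤ R) {h : Cov p}
    (hR : R * ‖h‖ ≤ 1 / 4) {k l : Fin K} (hE : 0 < blockExp z e γ k l) :
    |Real.log (blockExp z e (γ + h) k l) - Real.log (blockExp z e γ k l)
      - blockAvg z e γ (fun x => inner ℝ x h) k l - blockVar z e γ h k l / 2|
      ≤ 20 * (R * ‖h‖) ^ 3 := by
  have hx : ∀ i j, |(inner ℝ (z i j) h : ℝ)| ≤ R * ‖h‖ := fun i j =>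
    (abs_real_inner_le_norm _ _).trans (by gcongr; exact hz i j)
  have hM : blockExp z e (γ + h) k l
      = blockAvg z e γ (fun x => Real.exp (inner ℝ x h)) k l * blockExp z e γ k l := by
    rw [blockAvg, div_mul_cancel₀ _ hE.ne', ← blockSum_exp]
    congr 1
    funext x
    rw [inner_add_right, Real.exp_add, mul_comm]
  have h3 := blockAvg_abs_le (γ := γ) (e := e)
    (f := fun x => Real.exp (inner ℝ x h) + (-1) * (1 + (inner ℝ x h + 1 / 2 * inner ℝ x h ^ 2)))
    (C := (R * ‖h‖) ^ 3) (z := z) (fun i j => by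
      have := abs_exp_sub_quadratic_le (hx i j) (by linarith)
      convert this using 2
      ring) k l hE
  simp only [blockAvg_add, blockAvg_const_mul, blockAvg_const hE.ne'] at h3
  have h1 : |blockAvg z e γ (fun x => inner ℝ x h) k l| ≤ R * ‖h‖ := blockAvg_abs_le hx k l hE
  have h2 : |blockAvg z e γ (fun x => inner ℝ x h ^ 2) k l| ≤ (R * ‖h‖) ^ 2 :=
    blockAvg_abs_le (fun i j => by
      rw [abs_pow]
      have := hx i j
      gcongr) k l hE
  have hpos : 0 < blockAvg z e γ (fun x => Real.exp (inner ℝ x h)) k l := by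
    have hlow := blockAvg_mono (γ := γ) (e := e) (f := fun _ => Real.exp (-(R * ‖h‖)))
      (g := fun x => Real.exp (inner ℝ x h)) (z := z)
      (fun i j => Real.exp_le_exp.2 (abs_le.1 (hx i j)).1) k l hE
    rw [blockAvg_const hE.ne'] at hlow
    exact (Real.exp_pos _).trans_le hlow
  rw [hM, Real.log_mul hpos.ne' hE.ne', add_sub_cancel_right]
  refine abs_log_sub_cumulants_le hR h1 h2 ?_
  convert h3 using 2
  ring

/-- The vector of weighted block averages. -/
def blockMean (z : Fin n → Fin n → Cov p) (e : Fin n → Fin K) (γ : Cov p) (k l : Fin K) : Cov p :=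
  WithLp.toLp 2 fun s => blockAvg z e γ (fun x => x s) k l

lemma inner_blockMean (h : Cov p) (k l : Fin K) :
    inner ℝ (blockMean z e γ k l) h = blockAvg z e γ (fun x => inner ℝ x h) k l := by
  simp only [blockMean, PiLp.inner_apply, RCLike.inner_apply, conj_trivial, blockAvg_sum,
    blockAvg_const_mul]

/-- The score at `γ`, normalized by `r`. -/
def score (A : Fin n → Fin n → ℕ) (z : Fin n → Fin n → Cov p) (e : Fin n → Fin K) (γ : Cov p)
    (r : ℝ) : Cov p :=
  r⁻¹ • ∑ q ∈ pairs n, (A q.1 q.2 : ℝ) • (z q.1 q.2 - blockMean z e γ (e q.1) (e q.2))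

/-- The normalized number of edges. -/
def edgeDensity (A : Fin n → Fin n → ℕ) (r : ℝ) : ℝ := (r ^ 2)⁻¹ * ∑ q ∈ pairs n, (A q.1 q.2 : ℝ)

/-- Local asymptotic quadratic expansion of the profile likelihood. -/
lemma abs_logLik_sub_quadratic_le (hA : ∀ i j, A i j = A j i) (hA0 : ∀ i, A i i = 0)
    (hzs : ∀ i j, z i j = z j i) {R : ℝ} (hz : ∀ i j, ‖z i j‖ ≤ R)
    (hE : ∀ k l, 0 < blockExp z e γ k l) {r : ℝ} (hr : 0 < r) {h : Cov p}
    (hR : R * ‖h‖ / r ≤ 1 / 4) {V v D : ℝ}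
    (hV : ∀ k l, |blockVar z e γ h k l - v| ≤ D) :
    |logLik A z e (γ + r⁻¹ • h) - logLik A z e γ - (inner ℝ (score A z e γ r) h - V / 2)|
      ≤ (edgeDensity A r * D + |edgeDensity A r * v - V|) / 2
        + 20 * (R * ‖h‖) ^ 3 * edgeDensity A r / r := by
  set ε := 20 * (R * ‖r⁻¹ • h‖) ^ 3 with hε
  have hnorm : ‖r⁻¹ • h‖ = ‖h‖ / r := by
    rw [norm_smul, norm_inv, Real.norm_eq_abs, abs_of_pos hr, inv_mul_eq_div]
  have hlog := fun k l => abs_log_blockExp_add_sub_le (e := e) (γ := γ) hz (h := r⁻¹ • h)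
    (by rw [hnorm, ← mul_div_assoc]; exact hR) (hE k l)
  have hvar : ∀ k l, blockVar z e γ (r⁻¹ • h) k l = (r ^ 2)⁻¹ * blockVar z e γ h k l := by
    intro k l
    simp only [blockVar, real_inner_smul_right, mul_pow, blockAvg_const_mul, inv_pow]
    ring
  set T := edgeDensity A r with hT
  have hsumA : ∑ q ∈ pairs n, (A q.1 q.2 : ℝ) = r ^ 2 * T := by
    rw [hT, edgeDensity, ← mul_assoc, mul_inv_cancel₀ (by positivity), one_mul]
  have hT0 : 0 ≤ T := mul_nonneg (by positivity) (Finset.sum_nonneg fun q _ => Nat.cast_nonneg _)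
  have hscore : inner ℝ (score A z e γ r) h = ∑ q ∈ pairs n, (A q.1 q.2 : ℝ) *
      (inner ℝ (z q.1 q.2) (r⁻¹ • h)
        - blockAvg z e γ (fun x => inner ℝ x (r⁻¹ • h)) (e q.1) (e q.2)) := by
    rw [score, real_inner_smul_left, sum_inner, Finset.mul_sum]
    refine Finset.sum_congr rfl fun q _ => ?_
    rw [real_inner_smul_left, inner_sub_left, inner_blockMean]
    simp only [real_inner_smul_right, blockAvg_const_mul]
    ring
  -- The block variance is replaced by the common value `v` pair by pair. The total weight of the
  -- pairs is `r ^ 2 * T`, so the resulting error `(r ^ 2)⁻¹ * D / 2` adds up to `T * D / 2`.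
  have hterm : ∀ q : Fin n × Fin n, |(inner ℝ (z q.1 q.2) (γ + r⁻¹ • h)
        - Real.log (blockExp z e (γ + r⁻¹ • h) (e q.1) (e q.2)))
      - (inner ℝ (z q.1 q.2) γ - Real.log (blockExp z e γ (e q.1) (e q.2)))
      - (inner ℝ (z q.1 q.2) (r⁻¹ • h)
        - blockAvg z e γ (fun x => inner ℝ x (r⁻¹ • h)) (e q.1) (e q.2))
      + (r ^ 2)⁻¹ * v / 2| ≤ ε + (r ^ 2)⁻¹ * D / 2 := by
    intro q
    have h1 := hlog (e q.1) (e q.2)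
    have h2 := hV (e q.1) (e q.2)
    rw [hvar] at h1
    have h3 : |(r ^ 2)⁻¹ * (blockVar z e γ h (e q.1) (e q.2) - v)| ≤ (r ^ 2)⁻¹ * D := by
      rw [abs_mul, abs_of_pos (by positivity : 0 < (r ^ 2)⁻¹)]
      gcongr
    rw [inner_add_right]
    rw [abs_le] at h1 h3 ⊢
    constructor <;> linarith
  have hmain : logLik A z e (γ + r⁻¹ • h) - logLik A z e γ - inner ℝ (score A z e γ r) h
      + T * v / 2 = ∑ q ∈ pairs n, (A q.1 q.2 : ℝ) * ((inner ℝ (z q.1 q.2) (γ + r⁻¹ • h)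
        - Real.log (blockExp z e (γ + r⁻¹ • h) (e q.1) (e q.2)))
      - (inner ℝ (z q.1 q.2) γ - Real.log (blockExp z e γ (e q.1) (e q.2)))
      - (inner ℝ (z q.1 q.2) (r⁻¹ • h)
        - blockAvg z e γ (fun x => inner ℝ x (r⁻¹ • h)) (e q.1) (e q.2))
      + (r ^ 2)⁻¹ * v / 2) := by
    have h4 : T * v / 2 = ∑ q ∈ pairs n, (A q.1 q.2 : ℝ) * ((r ^ 2)⁻¹ * v / 2) := by
      rw [← Finset.sum_mul, hsumA]
      field_simp
    rw [logLik_eq_sum_pairs hA hA0 hzs, logLik_eq_sum_pairs hA hA0 hzs, hscore, h4,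
      ← Finset.sum_sub_distrib, ← Finset.sum_sub_distrib, ← Finset.sum_add_distrib]
    refine Finset.sum_congr rfl fun q _ => ?_
    ring
  have hbound : |logLik A z e (γ + r⁻¹ • h) - logLik A z e γ - inner ℝ (score A z e γ r) h
      + T * v / 2| ≤ r ^ 2 * T * (ε + (r ^ 2)⁻¹ * D / 2) := by
    rw [hmain, ← hsumA, Finset.sum_mul]
    refine (Finset.abs_sum_le_sum_abs _ _).trans (Finset.sum_le_sum fun q _ => ?_)
    rw [abs_mul, Nat.abs_cast]
    exact mul_le_mul_of_nonneg_left (hterm q) (Nat.cast_nonneg _)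
  have hval : r ^ 2 * T * (ε + (r ^ 2)⁻¹ * D / 2) = T * D / 2 + 20 * (R * ‖h‖) ^ 3 * T / r := by
    rw [hε, hnorm]
    field_simp
    ring
  rw [hval] at hbound
  have h5 := neg_abs_le (T * v - V)
  have h6 := le_abs_self (T * v - V)
  rw [abs_le] at hbound ⊢
  constructor <;> linarith

end Lik

/-! ### Quadratic forms of matrices -/

section Quad

variable {p : ℕ}

/-- The quadratic form of a matrix. -/
def quad (M : Matrix (Fin p) (Fin p) ℝ) (h : Cov p) : ℝ := ∑ r, ∑ s, h r * h s * M r s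

/-- A matrix as a continuous linear operator on the covariate space. -/
abbrev op (M : Matrix (Fin p) (Fin p) ℝ) : Cov p →L[ℝ] Cov p :=
  Matrix.toEuclideanCLM (n := Fin p) (𝕜 := ℝ) M

lemma quad_eq_dotProduct (M : Matrix (Fin p) (Fin p) ℝ) (h : Cov p) :
    quad M h = h.ofLp ⬝ᵥ M.mulVec h.ofLp := by
  simp only [quad, dotProduct, Matrix.mulVec, Finset.mul_sum]
  exact Finset.sum_congr rfl fun r _ => Finset.sum_congr rfl fun s _ => by ring

lemma quad_eq_inner (M : Matrix (Fin p) (Fin p) ℝ) (h : Cov p) :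
    quad M h = inner ℝ h (op M h) := by
  rw [quad_eq_dotProduct, Matrix.inner_toEuclideanCLM]

lemma quad_smul (a : ℝ) (M : Matrix (Fin p) (Fin p) ℝ) (h : Cov p) :
    quad (a • M) h = a * quad M h := by
  simp only [quad, Finset.mul_sum, Matrix.smul_apply, smul_eq_mul]
  exact Finset.sum_congr rfl fun r _ => Finset.sum_congr rfl fun s _ => by ring

lemma continuous_quad (M : Matrix (Fin p) (Fin p) ℝ) : Continuous (quad M) := by
  unfold quad
  fun_prop

lemma abs_quad_le (M : Matrix (Fin p) (Fin p) ℝ) (h : Cov p) :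
    |quad M h| ≤ ‖h‖ ^ 2 * ∑ r, ∑ s, |M r s| := by
  simp only [quad, Finset.mul_sum]
  refine (Finset.abs_sum_le_sum_abs _ _).trans (Finset.sum_le_sum fun r _ => ?_)
  refine (Finset.abs_sum_le_sum_abs _ _).trans (Finset.sum_le_sum fun s _ => ?_)
  rw [abs_mul, abs_mul, sq]
  have hr : |h r| ≤ ‖h‖ := PiLp.norm_apply_le h r
  have hs : |h s| ≤ ‖h‖ := PiLp.norm_apply_le h s
  gcongr

lemma quad_smul_vec (M : Matrix (Fin p) (Fin p) ℝ) (a : ℝ) (h : Cov p) :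
    quad M (a • h) = a ^ 2 * quad M h := by
  simp only [quad, Finset.mul_sum, PiLp.smul_apply, smul_eq_mul]
  exact Finset.sum_congr rfl fun r _ => Finset.sum_congr rfl fun s _ => by ring

lemma quad_pos {M : Matrix (Fin p) (Fin p) ℝ} (hM : M.PosDef) {h : Cov p} (hh : h ≠ 0) :
    0 < quad M h := by
  rw [quad_eq_dotProduct]
  have h0 : h.ofLp ≠ 0 := fun h0 => hh (by ext i; simp [h0])
  simpa using hM.dotProduct_mulVec_pos h0

/-- Positive definite quadratic forms are coercive. -/
lemma exists_le_quad {M : Matrix (Fin p) (Fin p) ℝ} (hM : M.PosDef) :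
    ∃ a : ℝ, 0 < a ∧ ∀ h : Cov p, a * ‖h‖ ^ 2 ≤ quad M h := by
  -- The sphere is empty when `p = 0`. Otherwise the minimum over the compact sphere is positive and
  -- extends to all vectors by homogeneity.
  rcases (Metric.sphere (0 : Cov p) 1).eq_empty_or_nonempty with hS | hS
  · refine ⟨1, one_pos, fun h => ?_⟩
    have h0 : h = 0 := by
      by_contra hne
      have : (‖h‖⁻¹ • h) ∈ Metric.sphere (0 : Cov p) 1 := by
        rw [mem_sphere_zero_iff_norm, norm_smul, norm_inv, norm_norm,
          inv_mul_cancel₀ (norm_ne_zero_iff.2 hne)]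
      rw [hS] at this
      exact this
    simp [h0, quad]
  · obtain ⟨u, hu, hmin⟩ := (isCompact_sphere (0 : Cov p) 1).exists_isMinOn hS
      (continuous_quad M).continuousOn
    have hu0 : u ≠ 0 := by
      rintro rfl
      simp at hu
    refine ⟨quad M u, quad_pos hM hu0, fun h => ?_⟩
    rcases eq_or_ne h 0 with rfl | hne
    · simp [quad]
    · have hn : ‖h‖ ≠ 0 := norm_ne_zero_iff.2 hne
      have hm : (‖h‖⁻¹ • h) ∈ Metric.sphere (0 : Cov p) 1 := by
        rw [mem_sphere_zero_iff_norm, norm_smul, norm_inv, norm_norm, inv_mul_cancel₀ hn]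
      have h1 : quad M u ≤ quad M (‖h‖⁻¹ • h) := hmin hm
      rw [quad_smul_vec, inv_pow, inv_mul_eq_div, le_div_iff₀ (by positivity)] at h1
      exact h1

/-! ### Inverse operators and completing the square -/

section Inverse

variable {M : Matrix (Fin p) (Fin p) ℝ}

lemma inner_op_comm (hM : M.IsSymm) (x y : Cov p) :
    inner ℝ (op M x) y = inner ℝ x (op M y) := by
  rw [real_inner_comm, Matrix.inner_toEuclideanCLM, Matrix.inner_toEuclideanCLM]
  rw [dotProduct_comm, Matrix.dotProduct_mulVec, ← Matrix.mulVec_transpose, hM.eq,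
    dotProduct_comm]

lemma op_op_inv (hM : M.PosDef) (x : Cov p) : op M (op M⁻¹ x) = x := by
  have h : op M * op M⁻¹ = 1 := by
    rw [← map_mul, Matrix.mul_nonsing_inv _ ((Matrix.isUnit_iff_isUnit_det _).1 hM.isUnit), map_one]
  exact congrArg (fun f : Cov p →L[ℝ] Cov p => f x) h

lemma isSymm_of_posDef (hM : M.PosDef) : M.IsSymm := by
  have := hM.isHermitian
  rwa [Matrix.IsHermitian, Matrix.conjTranspose_eq_transpose_of_trivial] at this

lemma quad_op_inv (hM : M.PosDef) (t : Cov p) : quad M (op M⁻¹ t) = quad M⁻¹ t := by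
  rw [quad_eq_inner, op_op_inv hM, quad_eq_inner, inner_op_comm (isSymm_of_posDef hM.inv)]

/-- Completing the square. -/
lemma quadratic_eq (hM : M.PosDef) (w h : Cov p) :
    inner ℝ w h - quad M h / 2
      = (inner ℝ w (op M⁻¹ w) - quad M (op M⁻¹ w) / 2) - quad M (h - op M⁻¹ w) / 2 := by
  set u := op M⁻¹ w with hu
  have hw : w = op M u := (op_op_inv hM w).symm
  have hs := isSymm_of_posDef hM
  have h1 : inner ℝ h (op M u) = inner ℝ w h := by rw [← hw, real_inner_comm]
  have h2 : inner ℝ u (op M h) = inner ℝ w h := by rw [← inner_op_comm hs, ← hw]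
  have h3 : inner ℝ u (op M u) = inner ℝ w u := by rw [← hw, real_inner_comm]
  simp only [quad_eq_inner, map_sub, inner_sub_left, inner_sub_right, h1, h2, h3]
  ring

end Inverse

end Quad

/-! ### Moments of the covariate law -/

section Moments

variable {p : ℕ} {ν : Measure (Cov p)} [IsProbabilityMeasure ν] {γ : Cov p} {R : ℝ}

lemma integrable_mul_exp_inner (hR : ∀ᵐ x ∂ν, ‖x‖ ≤ R) {f : Cov p → ℝ} {F : ℝ}
    (hf : Measurable f) (hF : ∀ x, ‖x‖ ≤ R → |f x| ≤ F) :
    Integrable (fun x => f x * Real.exp (inner ℝ x γ)) ν :=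
  Integrable.of_bound (hf.mul (measurable_exp_inner γ)).aestronglyMeasurable
    (F * Real.exp (R * ‖γ‖)) (by
      filter_upwards [hR] with x hx using abs_mul_exp_inner_le hx (hF x hx))

lemma abs_apply_le {x : Cov p} (hx : ‖x‖ ≤ R) (r : Fin p) : |x r| ≤ R :=
  (PiLp.norm_apply_le x r).trans hx

lemma abs_apply_mul_apply_le {x : Cov p} (hx : ‖x‖ ≤ R) (r s : Fin p) : |x r * x s| ≤ R * R := by
  rw [abs_mul]
  exact mul_le_mul (abs_apply_le hx r) (abs_apply_le hx s) (abs_nonneg _) ((norm_nonneg x).trans hx)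

lemma abs_inner_le {x : Cov p} (hx : ‖x‖ ≤ R) (h : Cov p) : |inner ℝ x h| ≤ R * ‖h‖ :=
  (abs_real_inner_le_norm _ _).trans (by gcongr)

lemma measurable_apply (r : Fin p) : Measurable fun x : Cov p => x r := by fun_prop

lemma inner_eq_sum (x h : Cov p) : inner ℝ x h = ∑ r, h r * x r := by
  simp [PiLp.inner_apply]

lemma inner_sq_eq_sum (x h : Cov p) :
    inner ℝ x h ^ 2 = ∑ r, ∑ s, (h r * h s) * (x r * x s) := by
  rw [inner_eq_sum, sq, Finset.sum_mul_sum]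
  exact Finset.sum_congr rfl fun r _ => Finset.sum_congr rfl fun s _ => by ring

lemma integral_inner_mul_exp (hR : ∀ᵐ x ∂ν, ‖x‖ ≤ R) (h : Cov p) :
    ∫ x, inner ℝ x h * Real.exp (inner ℝ x γ) ∂ν = ∑ r, h r * mu ν γ r := by
  simp only [inner_eq_sum (h := h), Finset.sum_mul, mul_assoc]
  rw [integral_finsetSum]
  · simp only [integral_const_mul, mu]
  · intro r _
    exact (integrable_mul_exp_inner hR (measurable_apply r)
      fun x hx => abs_apply_le hx r).const_mul _

lemma integral_inner_sq_mul_exp (hR : ∀ᵐ x ∂ν, ‖x‖ ≤ R) (h : Cov p) :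
    ∫ x, inner ℝ x h ^ 2 * Real.exp (inner ℝ x γ) ∂ν
      = ∑ r, ∑ s, h r * h s * sigma ν γ r s := by
  have hint : ∀ r s, Integrable (fun x : Cov p => (h r * h s) *
      (x r * x s * Real.exp (inner ℝ x γ))) ν := fun r s =>
    (integrable_mul_exp_inner hR ((measurable_apply r).mul (measurable_apply s))
      fun x hx => abs_apply_mul_apply_le hx r s).const_mul _
  simp only [inner_sq_eq_sum (h := h), Finset.sum_mul]
  simp only [mul_assoc (h _ * h _)]
  rw [integral_finsetSum _ fun r _ => integrable_finsetSum _ fun s _ => hint r s]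
  refine Finset.sum_congr rfl fun r _ => ?_
  rw [integral_finsetSum _ fun s _ => hint r s]
  simp only [integral_const_mul, sigma, Matrix.of_apply]

lemma quad_tiltedCov (hR : ∀ᵐ x ∂ν, ‖x‖ ≤ R) (h : Cov p) :
    quad (tiltedCov ν γ) h = ∫ x, inner ℝ x h ^ 2 * Real.exp (inner ℝ x γ) ∂ν
      - (theta ν γ)⁻¹ * (∫ x, inner ℝ x h * Real.exp (inner ℝ x γ) ∂ν) ^ 2 := by
  rw [integral_inner_mul_exp hR, integral_inner_sq_mul_exp hR, quad, sq, Finset.sum_mul_sum]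
  simp only [tiltedCov, Matrix.sub_apply, Matrix.smul_apply, Matrix.vecMulVec_apply, smul_eq_mul,
    mul_sub, Finset.sum_sub_distrib, Finset.mul_sum]
  congr 1
  exact Finset.sum_congr rfl fun r _ => Finset.sum_congr rfl fun s _ => by ring

/-- The quadratic form of the tilted covariance as an integrated square. -/
lemma integral_centred_sq_mul_exp (hR : ∀ᵐ x ∂ν, ‖x‖ ≤ R) (hθ : 0 < theta ν γ) (h : Cov p) :
    ∫ x, (inner ℝ x h - (∫ y, inner ℝ y h * Real.exp (inner ℝ y γ) ∂ν) / theta ν γ) ^ 2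
      * Real.exp (inner ℝ x γ) ∂ν = quad (tiltedCov ν γ) h := by
  rw [quad_tiltedCov hR]
  set I := ∫ y, inner ℝ y h * Real.exp (inner ℝ y γ) ∂ν with hI
  set m := I / theta ν γ with hm
  have h1 : ∀ x : Cov p, (inner ℝ x h - m) ^ 2 * Real.exp (inner ℝ x γ)
      = inner ℝ x h ^ 2 * Real.exp (inner ℝ x γ)
        + ((-2 * m) * (inner ℝ x h * Real.exp (inner ℝ x γ))
          + m ^ 2 * Real.exp (inner ℝ x γ)) := fun x => by ring
  have hi0 : Integrable (fun x : Cov p => Real.exp (inner ℝ x γ)) ν := by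
    simpa using integrable_mul_exp_inner (γ := γ) hR (measurable_const (a := (1 : ℝ)))
      (fun x _ => (abs_one (α := ℝ)).le)
  have hm1 : Measurable fun x : Cov p => (inner ℝ x h : ℝ) := by fun_prop
  have hi1 : Integrable (fun x : Cov p => inner ℝ x h * Real.exp (inner ℝ x γ)) ν :=
    integrable_mul_exp_inner hR hm1 fun x hx => abs_inner_le hx h
  have hi2 : Integrable (fun x : Cov p => inner ℝ x h ^ 2 * Real.exp (inner ℝ x γ)) ν :=
    integrable_mul_exp_inner (F := (R * ‖h‖) ^ 2) hR (hm1.pow_const 2) fun x hx => by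
      rw [abs_pow]
      have := abs_inner_le hx h
      gcongr
  have hi3 : Integrable (fun x : Cov p => (-2 * m) * (inner ℝ x h * Real.exp (inner ℝ x γ))
      + m ^ 2 * Real.exp (inner ℝ x γ)) ν := (hi1.const_mul _).add (hi0.const_mul _)
  simp_rw [h1]
  rw [integral_add hi2 hi3,
    integral_add (hi1.const_mul _) (hi0.const_mul _), integral_const_mul, integral_const_mul,
    ← theta, ← hI, hm]
  field_simp
  ring

end Moments

/-! ### The number of edges -/

section Sequence

variable {Ω : ℕ → Type*} [∀ n, MeasurableSpace (Ω n)] {P : (n : ℕ) → Measure (Ω n)}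
  {K p : ℕ} {π : Fin K → ℝ}
  {Bbar : Matrix (Fin K) (Fin K) ℝ} {ν : Measure (Cov p)} {γ₀ : Cov p} {ρ : ℕ → ℝ}
  {c e : (n : ℕ) → Ω n → Fin n → Fin K} {z : (n : ℕ) → Ω n → Fin n → Fin n → Cov p}
  {A : (n : ℕ) → Ω n → Fin n → Fin n → ℕ} {R κ : ℝ}

lemma Regime.tendsto_scale (h : Regime P π Bbar ν γ₀ ρ c e z A R κ) :
    Tendsto (fun n => Real.sqrt (numPairs n * ρ n)) atTop atTop :=
  Real.tendsto_sqrt_atTop.comp h.ρ_edges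

lemma Regime.scale_pos (h : Regime P π Bbar ν γ₀ ρ c e z A R κ) {n : ℕ} (hn : 2 ≤ n) :
    0 < Real.sqrt (numPairs n * ρ n) :=
  Real.sqrt_pos.2 (mul_pos (numPairs_pos hn) (h.ρ_pos n))

lemma Regime.scale_sq (h : Regime P π Bbar ν γ₀ ρ c e z A R κ) {n : ℕ} (hn : 2 ≤ n) :
    Real.sqrt (numPairs n * ρ n) ^ 2 = numPairs n * ρ n :=
  Real.sq_sqrt (mul_pos (numPairs_pos hn) (h.ρ_pos n)).le

lemma Regime.smul_nonneg (h : Regime P π Bbar ν γ₀ ρ c e z A R κ) (n : ℕ) (a b : Fin K) :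
    0 ≤ (ρ n • Bbar) a b := mul_nonneg (h.ρ_pos n).le (h.B_nonneg a b)

lemma Regime.rate_nonneg (h : Regime P π Bbar ν γ₀ ρ c e z A R κ) (x : Σ n, Ω n)
    (q : Fin x.1 × Fin x.1) : 0 ≤ rate (ρ x.1 • Bbar) γ₀ (c x.1 x.2) (z x.1 x.2) q.1 q.2 :=
  mul_nonneg (h.smul_nonneg _ _ _) (Real.exp_pos _).le

lemma Regime.measurable_rate (h : Regime P π Bbar ν γ₀ ρ c e z A R κ) (n : ℕ) (i j : Fin n) :
    Measurable fun ω => rate (ρ n • Bbar) γ₀ (c n ω) (z n ω) i j := by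
  refine Measurable.mul ?_ ((measurable_exp_inner γ₀).comp ((h.model n).measurable_z_apply i j))
  exact (measurable_of_countable fun u : Fin n → Fin K => (ρ n • Bbar) (u i) (u j)).comp
    (h.model n).measurable_c

variable [∀ n, IsProbabilityMeasure (P n)] [IsProbabilityMeasure ν]

/-- The factor `ρ_n` in the rates cancels against `r ^ 2 = N_n ρ_n`, and the remaining factor of the
rate tilts the covariate law by `exp(zᵀγ₀)`. -/
lemma Regime.tendsto_sum_rate_mul (h : Regime P π Bbar ν γ₀ ρ c e z A R κ) {f : Cov p → ℝ}
    {F : ℝ} (hf : Measurable f) (hF : ∀ x, ‖x‖ ≤ R → |f x| ≤ F) :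
    Tendsto (fun x : Σ n, Ω n => (Real.sqrt (numPairs x.1 * ρ x.1) ^ 2)⁻¹ *
      ∑ q ∈ pairs x.1, rate (ρ x.1 • Bbar) γ₀ (c x.1 x.2) (z x.1 x.2) q.1 q.2
        * f (z x.1 x.2 q.1 q.2))
      (inProb P) (𝓝 (meanB Bbar π * ∫ y, f y * Real.exp (inner ℝ y γ₀) ∂ν)) := by
  refine (h.tendsto_sum_B (hf.mul (measurable_exp_inner γ₀))
    (fun x hx => abs_mul_exp_inner_le hx (hF x hx))).congr' ?_
  filter_upwards [eventually_two_le_fst] with x hx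
  have hN := (numPairs_pos hx).ne'
  have hρ := (h.ρ_pos x.1).ne'
  rw [h.scale_sq hx, mul_inv, mul_assoc]
  congr 1
  rw [Finset.mul_sum]
  refine Finset.sum_congr rfl fun q _ => ?_
  simp only [rate, Matrix.smul_apply, smul_eq_mul, Pi.mul_apply]
  field_simp

lemma Regime.tendsto_sum_rate (h : Regime P π Bbar ν γ₀ ρ c e z A R κ) :
    Tendsto (fun x : Σ n, Ω n => (Real.sqrt (numPairs x.1 * ρ x.1) ^ 2)⁻¹ *
      ∑ q ∈ pairs x.1, rate (ρ x.1 • Bbar) γ₀ (c x.1 x.2) (z x.1 x.2) q.1 q.2)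
      (inProb P) (𝓝 (meanB Bbar π * theta ν γ₀)) := by
  simpa [theta] using h.tendsto_sum_rate_mul (f := fun _ => (1 : ℝ)) (F := 1) measurable_const
    (fun x _ => by simp)

/-- This is the difference quotient at zero of `u ↦ exp(-s u)`, read along `u = r⁻²`. -/
lemma tendsto_sq_mul_exp_sub_one {ι : Type*} {l : Filter ι} {r : ι → ℝ} (hr : Tendsto r l atTop)
    (s : ℝ) : Tendsto (fun i => r i ^ 2 * (Real.exp (-s * (r i ^ 2)⁻¹) - 1)) l (𝓝 (-s)) := by
  have h0 : Tendsto (fun i => (r i ^ 2)⁻¹) l (𝓝 0) :=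
    ((tendsto_pow_atTop two_ne_zero).comp hr).inv_tendsto_atTop
  have hd : HasDerivAt (fun u : ℝ => Real.exp (-s * u)) (-s) 0 := by
    simpa using ((hasDerivAt_id (0 : ℝ)).const_mul (-s)).exp
  have hslope := hd.tendsto_slope
  have hne : ∀ᶠ i in l, (r i ^ 2)⁻¹ ≠ 0 := by
    filter_upwards [hr.eventually_gt_atTop 0] with i hi
    positivity
  have h1 := hslope.comp (tendsto_nhdsWithin_iff.2 ⟨h0, hne⟩)
  refine h1.congr' ?_
  filter_upwards [hne] with i hi
  simp [slope, inv_inv]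

/-- The number of edges obeys a weak law of large numbers. -/
lemma Regime.tendsto_edgeDensity (h : Regime P π Bbar ν γ₀ ρ c e z A R κ) :
    Tendsto (fun x : Σ n, Ω n => edgeDensity (A x.1 x.2) (Real.sqrt (numPairs x.1 * ρ x.1)))
      (inProb P) (𝓝 (meanB Bbar π * theta ν γ₀)) := by
  set τ := meanB Bbar π * theta ν γ₀ with hτ
  set r : ℕ → ℝ := fun n => Real.sqrt (numPairs n * ρ n) with hr
  set T : (n : ℕ) → Ω n → ℝ := fun n ω => edgeDensity (A n ω) (r n) with hT
  have hT0 : ∀ n ω, 0 ≤ T n ω := fun n ω =>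
    mul_nonneg (by positivity) (Finset.sum_nonneg fun q _ => Nat.cast_nonneg _)
  have hTm : ∀ n, Measurable (T n) := fun n => by
    refine measurable_const.mul (Finset.measurable_sum _ fun q _ => ?_)
    exact (measurable_of_countable (fun k : ℕ => (k : ℝ))).comp ((measurable_pi_apply q.2).comp
      ((measurable_pi_apply q.1).comp (h.model n).measurable_A))
  -- Integrating out the Poisson counts turns the Laplace transform of `T` into the mean of `exp(Λ
  -- (exp(-s / r²) - 1))`. The exponent tends to `-s τ` in probability, and the exponential is
  -- bounded by one.
  have hlap : ∀ s : ℝ, 0 ≤ s →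
      Tendsto (fun n => ∫ ω, Real.exp (-s * T n ω) ∂(P n)) atTop (𝓝 (Real.exp (-s * τ))) := by
    intro s hs
    set Λ : (n : ℕ) → Ω n → ℝ := fun n ω =>
      ∑ q ∈ pairs n, rate (ρ n • Bbar) γ₀ (c n ω) (z n ω) q.1 q.2 with hΛ
    have hΛ0 : ∀ n ω, 0 ≤ Λ n ω := fun n ω =>
      Finset.sum_nonneg fun q _ => h.rate_nonneg ⟨n, ω⟩ q
    have hid : ∀ n, ((∫ ω, Real.exp (-s * T n ω) ∂(P n) : ℝ) : ℂ)
        = ∫ ω, ((Real.exp (Λ n ω * (Real.exp (-s * (r n ^ 2)⁻¹) - 1)) : ℝ) : ℂ) ∂(P n) := by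
      intro n
      have h1 := (h.model n).integral_cexp (h.smul_nonneg n)
        (fun _ _ => ((-s * (r n ^ 2)⁻¹ : ℝ) : ℂ)) (fun q => measurable_const) (fun _ _ => by
          rw [Complex.ofReal_re]
          have : 0 ≤ s * (r n ^ 2)⁻¹ := by positivity
          linarith)
      rw [← integral_complex_ofReal]
      refine (integral_congr_ae (Eventually.of_forall fun ω => ?_)).trans
        (h1.trans (integral_congr_ae (Eventually.of_forall fun ω => ?_)))
      · simp only [← Finset.sum_mul, hT, edgeDensity]
        push_cast
        ring_nf
      · simp only [← Finset.sum_mul, hΛ]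
        push_cast
        ring_nf
    have hlim : Tendsto (fun x : Σ n, Ω n =>
        ((Real.exp (Λ x.1 x.2 * (Real.exp (-s * (r x.1 ^ 2)⁻¹) - 1)) : ℝ) : ℂ)) (inProb P)
        (𝓝 ((Real.exp (-s * τ) : ℝ) : ℂ)) := by
      refine (Complex.continuous_ofReal.tendsto _).comp ((Real.continuous_exp.tendsto _).comp ?_)
      have h2 := h.tendsto_sum_rate.mul
        ((tendsto_sq_mul_exp_sub_one h.tendsto_scale s).comp (tendsto_fst_inProb (P := P)))
      rw [mul_comm] at h2
      refine h2.congr' ?_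
      filter_upwards [eventually_two_le_fst] with x hx
      have := (h.scale_pos hx).ne'
      simp only [Function.comp, hΛ, hr]
      field_simp
    have h3 := tendsto_integral_of_inProb (P := P)
      (F := fun n ω => ((Real.exp (Λ n ω * (Real.exp (-s * (r n ^ 2)⁻¹) - 1)) : ℝ) : ℂ)) (C := 1)
      (fun n => (Complex.measurable_ofReal.comp (Real.measurable_exp.comp
        ((Finset.measurable_sum _ fun q _ => h.measurable_rate n q.1 q.2).mul_const
          _))).aestronglyMeasurable)
      (fun n => Eventually.of_forall fun ω => by
        rw [Complex.norm_real, Real.norm_eq_abs, abs_of_pos (Real.exp_pos _), Real.exp_le_one_iff]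
        refine mul_nonpos_of_nonneg_of_nonpos (hΛ0 n ω) (sub_nonpos.2 (Real.exp_le_one_iff.2 ?_))
        have : 0 ≤ s * (r n ^ 2)⁻¹ := by positivity
        linarith) hlim
    simp_rw [← hid] at h3
    exact (Complex.continuous_re.tendsto _).comp h3
  have hexp : ∀ n (s : ℝ), 0 ≤ s → Integrable (fun ω => Real.exp (-s * T n ω)) (P n) := by
    intro n s hs
    refine Integrable.of_bound (Real.measurable_exp.comp
      ((hTm n).const_mul _)).aestronglyMeasurable 1 (Eventually.of_forall fun ω => ?_)
    rw [Real.norm_eq_abs, abs_of_pos (Real.exp_pos _), Real.exp_le_one_iff]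
    have := mul_nonneg hs (hT0 n ω)
    linarith
  -- The mean square of `exp(-T) - exp(-τ)` involves only the Laplace transforms at `1` and `2`,
  -- whose limits cancel. Thus `exp(-T)`, and after a logarithm `T`, converges in probability
  -- without any moment bound on `A`.
  set X : (n : ℕ) → Ω n → ℝ := fun n ω => Real.exp (-1 * T n ω) - Real.exp (-1 * τ) with hX
  have hXsq : ∀ n ω, X n ω ^ 2 = Real.exp (-2 * T n ω)
      + (-2 * Real.exp (-1 * τ)) * Real.exp (-1 * T n ω) + Real.exp (-1 * τ) ^ 2 := by
    intro n ω
    have : Real.exp (-2 * T n ω) = Real.exp (-1 * T n ω) ^ 2 := by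
      rw [← Real.exp_nat_mul]; congr 1; push_cast; ring
    rw [this, hX]
    ring
  have hi2 : ∀ n, Integrable (fun ω => Real.exp (-2 * T n ω)
      + (-2 * Real.exp (-1 * τ)) * Real.exp (-1 * T n ω)) (P n) := fun n =>
    (hexp n 2 (by norm_num)).add ((hexp n 1 (by norm_num)).const_mul _)
  have hXint : ∀ n, Integrable (fun ω => X n ω ^ 2) (P n) := by
    intro n
    simp_rw [hXsq]
    exact (hi2 n).add (integrable_const _)
  have hXval : ∀ n, ∫ ω, X n ω ^ 2 ∂(P n) = ∫ ω, Real.exp (-2 * T n ω) ∂(P n)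
      + (-2 * Real.exp (-1 * τ)) * ∫ ω, Real.exp (-1 * T n ω) ∂(P n) + Real.exp (-1 * τ) ^ 2 := by
    intro n
    simp_rw [hXsq]
    rw [integral_add (hi2 n) (integrable_const _), integral_add (hexp n 2 (by norm_num))
      ((hexp n 1 (by norm_num)).const_mul _), integral_const_mul]
    simp
  have hX0 : Tendsto (fun n => ∫ ω, X n ω ^ 2 ∂(P n)) atTop (𝓝 0) := by
    simp_rw [hXval]
    have := ((hlap 2 (by norm_num)).add ((hlap 1 (by norm_num)).const_mul
      (-2 * Real.exp (-1 * τ)))).add_const (Real.exp (-1 * τ) ^ 2)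
    convert this using 2
    have : Real.exp (-2 * τ) = Real.exp (-1 * τ) ^ 2 := by
      rw [← Real.exp_nat_mul]; congr 1; push_cast; ring
    rw [this]
    ring
  have hXp := tendsto_inProb_of_sq (P := P) (Eventually.of_forall hXint)
    (Eventually.of_forall fun n => le_rfl) hX0
  have hE : Tendsto (fun x : Σ n, Ω n => Real.exp (-1 * T x.1 x.2)) (inProb P)
      (𝓝 (Real.exp (-1 * τ))) := tendsto_sub_nhds_zero_iff.1 hXp
  have hlog := ((Real.continuousAt_log (Real.exp_pos (-1 * τ)).ne').tendsto.comp hE).neg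
  simp only [Function.comp_def, Real.log_exp, neg_mul, one_mul, neg_neg] at hlog
  exact hlog

end Sequence

/-! ### The limit law of the score -/

lemma sigmaInf_eq_smul {K p : ℕ} (Bbar : Matrix (Fin K) (Fin K) ℝ) (π : Fin K → ℝ)
    (ν : Measure (Cov p)) (γ : Cov p) :
    sigmaInf Bbar π ν γ = meanB Bbar π • tiltedCov ν γ := by
  simp only [sigmaInf, meanB, Finset.sum_smul]

lemma measurable_blockSum {n K p : ℕ} (e : Fin n → Fin K) {f : Cov p → ℝ} (hf : Measurable f)
    (k l : Fin K) : Measurable fun z : Fin n → Fin n → Cov p => blockSum z e f k l := by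
  refine Finset.measurable_sum _ fun i _ => Finset.measurable_sum _ fun j _ => ?_
  split_ifs
  · exact hf.comp ((measurable_pi_apply j).comp (measurable_pi_apply i))
  · exact measurable_const

lemma measurable_blockAvg {n K p : ℕ} {f : Cov p → ℝ} (hf : Measurable f) (γ : Cov p)
    (q : Fin n × Fin n) :
    Measurable fun y : (Fin n → Fin K) × (Fin n → Fin n → Cov p) =>
      blockAvg y.2 y.1 γ f (y.1 q.1) (y.1 q.2) := by
  refine measurable_from_prod_countable_right fun e => ?_
  simp only [blockAvg, ← blockSum_exp]
  exact (measurable_blockSum e (hf.mul (measurable_exp_inner γ)) _ _).div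
    (measurable_blockSum e (measurable_exp_inner γ) _ _)

lemma measurable_inner_const {p : ℕ} (s : Cov p) : Measurable fun x : Cov p => (inner ℝ x s : ℝ) := by
  fun_prop

lemma inner_score {n K p : ℕ} (A : Fin n → Fin n → ℕ) (z : Fin n → Fin n → Cov p)
    (e : Fin n → Fin K) (γ : Cov p) (r : ℝ) (s : Cov p) :
    inner ℝ (score A z e γ r) s = ∑ q ∈ pairs n, (A q.1 q.2 : ℝ) *
      (r⁻¹ * (inner ℝ (z q.1 q.2) s - blockAvg z e γ (fun x => inner ℝ x s) (e q.1) (e q.2))) := by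
  rw [score, real_inner_smul_left, sum_inner, Finset.mul_sum]
  refine Finset.sum_congr rfl fun q _ => ?_
  rw [real_inner_smul_left, inner_sub_left, inner_blockMean]
  ring

lemma abs_blockAvg_inner_le {n K p : ℕ} {z : Fin n → Fin n → Cov p} {e : Fin n → Fin K}
    {γ : Cov p} {R : ℝ} (hz : ∀ i j, ‖z i j‖ ≤ R) (s : Cov p) {k l : Fin K}
    (hE : 0 < blockExp z e γ k l) : |blockAvg z e γ (fun y => inner ℝ y s) k l| ≤ R * ‖s‖ :=
  blockAvg_abs_le (fun i j => abs_inner_le (hz i j) s) k l hE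

/-- From `(y - a)² - (y - m)² = (2y - a - m)(m - a)`, with first factor at most `3b + |m|`. It
replaces an empirical block mean `a` by its limit `m` in one term of the conditional variance. -/
lemma abs_mul_sq_sub_le {lam r a y m b D : ℝ} (hlam : 0 ≤ lam) (ha : |a| ≤ b) (hy : |y| ≤ b)
    (had : |a - m| ≤ D) : |lam * (r⁻¹ * (y - a)) ^ 2 - (r ^ 2)⁻¹ * (lam * (y - m) ^ 2)|
      ≤ (r ^ 2)⁻¹ * lam * ((3 * b + |m|) * D) := by
  have h5 : lam * (r⁻¹ * (y - a)) ^ 2 - (r ^ 2)⁻¹ * (lam * (y - m) ^ 2)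
      = (r ^ 2)⁻¹ * lam * ((2 * y - a - m) * (m - a)) := by
    rw [mul_pow, inv_pow]; ring
  have h6 : |2 * y - a - m| ≤ 3 * b + |m| := by
    have := neg_abs_le m
    have := le_abs_self m
    rw [abs_le] at ha hy ⊢
    constructor <;> linarith
  rw [h5, abs_mul, abs_of_nonneg (by positivity : 0 ≤ (r ^ 2)⁻¹ * lam),
    abs_mul, abs_sub_comm m a]
  refine mul_le_mul_of_nonneg_left ?_ (by positivity)
  exact mul_le_mul h6 had (abs_nonneg _) ((abs_nonneg _).trans h6)

lemma norm_cexp_I_mul_sub_quadratic_le {x b : ℝ} (hx : |x| ≤ b) (hb : b ≤ 1) :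
    ‖Complex.exp (Complex.I * x) - 1 - (Complex.I * x - x ^ 2 / 2)‖ ≤ b ^ 3 := by
  have hn : ‖Complex.I * (x : ℂ)‖ = |x| := by simp
  have h := Complex.exp_bound (x := Complex.I * x) (by rw [hn]; linarith) (n := 3) (by norm_num)
  simp only [Finset.sum_range_succ, Finset.sum_range_zero, hn] at h
  norm_num [Nat.factorial, mul_pow] at h
  have h2 : |x| ^ 3 ≤ b ^ 3 := by gcongr
  have h3 : Complex.exp (Complex.I * x) - 1 - (Complex.I * x - x ^ 2 / 2)
      = Complex.exp (Complex.I * x) - (1 + Complex.I * x + -(x : ℂ) ^ 2 / 2) := by ring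
  rw [h3]
  have h4 : 0 ≤ |x| ^ 3 := by positivity
  linarith

section Sequence

variable {Ω : ℕ → Type*} [∀ n, MeasurableSpace (Ω n)] {P : (n : ℕ) → Measure (Ω n)}
  {K p : ℕ} {π : Fin K → ℝ}
  {Bbar : Matrix (Fin K) (Fin K) ℝ} {ν : Measure (Cov p)} {γ₀ : Cov p} {ρ : ℕ → ℝ}
  {c e : (n : ℕ) → Ω n → Fin n → Fin K} {z : (n : ℕ) → Ω n → Fin n → Fin n → Cov p}
  {A : (n : ℕ) → Ω n → Fin n → Fin n → ℕ} {R κ : ℝ}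

lemma Regime.sqrt_ρ_zero (h : Regime P π Bbar ν γ₀ ρ c e z A R κ) :
    Tendsto (fun n => Real.sqrt (ρ n)) atTop (𝓝 0) := by
  have := (Real.continuous_sqrt.tendsto 0).comp h.ρ_zero
  rw [Real.sqrt_zero] at this
  exact this

variable [∀ n, IsProbabilityMeasure (P n)] [IsProbabilityMeasure ν]

lemma abs_sub_le_sum_sum (M : Fin K → Fin K → ℝ) (m : ℝ) (k l : Fin K) :
    |M k l - m| ≤ ∑ k, ∑ l, |M k l - m| :=
  (Finset.single_le_sum (f := fun l => |M k l - m|) (fun _ _ => abs_nonneg _)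
    (Finset.mem_univ l)).trans (Finset.single_le_sum (f := fun k => ∑ l, |M k l - m|)
      (fun _ _ => Finset.sum_nonneg fun _ _ => abs_nonneg _) (Finset.mem_univ k))

/-- The conditional mean of the score vanishes in the limit. -/
lemma Regime.tendsto_score_mean (h : Regime P π Bbar ν γ₀ ρ c e z A R κ) (s : Cov p) :
    Tendsto (fun x : Σ n, Ω n => ∑ q ∈ pairs x.1,
      rate (ρ x.1 • Bbar) γ₀ (c x.1 x.2) (z x.1 x.2) q.1 q.2 *
        ((Real.sqrt (numPairs x.1 * ρ x.1))⁻¹ * (inner ℝ (z x.1 x.2 q.1 q.2) s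
          - blockAvg (z x.1 x.2) (e x.1 x.2) γ₀ (fun y => inner ℝ y s)
            (e x.1 x.2 q.1) (e x.1 x.2 q.2)))) (inProb P) (𝓝 0) := by
  obtain ⟨C, -, hC⟩ := exists_abs_le_of_matrix Bbar
  set m := (∫ y, inner ℝ y s * Real.exp (inner ℝ y γ₀) ∂ν) / theta ν γ₀ with hm
  have hms := measurable_inner_const s
  have hbd : ∀ x : Cov p, ‖x‖ ≤ R → |inner ℝ x s| ≤ R * ‖s‖ := fun x hx => abs_inner_le hx s
  have hbd' : ∀ x : Cov p, ‖x‖ ≤ R → |inner ℝ x s - m| ≤ R * ‖s‖ + |m| := fun x hx =>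
    (abs_sub _ _).trans (by gcongr; exact hbd x hx)
  have hg0 : ∫ x, (inner ℝ x s - m) * Real.exp (inner ℝ x γ₀) ∂ν = 0 := by
    simp only [sub_mul]
    rw [integral_sub (integrable_mul_exp_inner h.bdd hms hbd)
      (integrable_mul_exp_inner h.bdd measurable_const fun _ _ => le_rfl), integral_const_mul,
      ← theta, hm, div_mul_cancel₀ _ h.theta_pos.ne', sub_self]
  -- With the limit `m` as centre the prefactor is `ρ / r = √ρ / √N`, so the sum has second moment
  -- of order `ρ_n`. Sparsity is used here and in `h2`.
  have h1 := h.tendsto_sum_centred ((hms.sub_const m).mul (measurable_exp_inner γ₀))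
    (fun x hx => abs_mul_exp_inner_le hx (hbd' x hx)) hg0
    (fun n u v q => Bbar (u q.1) (u q.2)) (fun n u v q => hC _ _) h.sqrt_ρ_zero
  set M : (Σ n, Ω n) → Fin K → Fin K → ℝ := fun x k l =>
    blockAvg (z x.1 x.2) (e x.1 x.2) γ₀ (fun y => inner ℝ y s) k l with hM
  -- Replacing `m` by the block means costs at most a bounded multiple of `r` times their errors.
  -- Those are of order `N_n^(-1/2)` and `r = √ρ √N`, so the cost is again of order `√ρ_n`.
  have h2 : Tendsto (fun x : Σ n, Ω n => Real.sqrt (ρ x.1) * Real.sqrt (numPairs x.1) *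
      ∑ k, ∑ l, |M x k l - m|) (inProb P) (𝓝 0) := by
    have : Tendsto (fun x : Σ n, Ω n => ∑ k, ∑ l, |Real.sqrt (ρ x.1) * Real.sqrt (numPairs x.1) *
        (M x k l - m)|) (inProb P) (𝓝 (∑ k : Fin K, ∑ l : Fin K, 0)) :=
      tendsto_finsetSum _ fun k _ => tendsto_finsetSum _ fun l _ => by
        have := (h.tendsto_blockAvg_sub hms hbd h.sqrt_ρ_zero k l).norm
        rwa [norm_zero] at this
    simp only [Finset.sum_const_zero] at this
    refine this.congr fun x => ?_
    simp only [Finset.mul_sum, abs_mul, abs_of_nonneg (Real.sqrt_nonneg _)]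
  have h3 : Tendsto (fun x : Σ n, Ω n => ∑ q ∈ pairs x.1,
      rate (ρ x.1 • Bbar) γ₀ (c x.1 x.2) (z x.1 x.2) q.1 q.2 *
        ((Real.sqrt (numPairs x.1 * ρ x.1))⁻¹ * (M x (e x.1 x.2 q.1) (e x.1 x.2 q.2) - m)))
      (inProb P) (𝓝 0) := by
    have hprod := h.tendsto_sum_rate.mul h2
    rw [mul_zero] at hprod
    refine squeeze_zero_norm' ?_ hprod
    filter_upwards [eventually_two_le_fst] with x hx
    have hr := h.scale_pos hx
    have hrr : Real.sqrt (ρ x.1) * Real.sqrt (numPairs x.1)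
        = Real.sqrt (numPairs x.1 * ρ x.1) := by
      rw [mul_comm, ← Real.sqrt_mul (numPairs_pos hx).le]
    rw [hrr]
    set r := Real.sqrt (numPairs x.1 * ρ x.1)
    set D := ∑ k, ∑ l, |M x k l - m|
    rw [show (r ^ 2)⁻¹ * (∑ q ∈ pairs x.1, rate (ρ x.1 • Bbar) γ₀ (c x.1 x.2) (z x.1 x.2) q.1 q.2)
        * (r * D) = ∑ q ∈ pairs x.1,
          rate (ρ x.1 • Bbar) γ₀ (c x.1 x.2) (z x.1 x.2) q.1 q.2 * (r⁻¹ * D) by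
      rw [← Finset.sum_mul]; field_simp]
    refine (norm_sum_le _ _).trans (Finset.sum_le_sum fun q _ => ?_)
    rw [norm_mul, norm_mul, Real.norm_eq_abs, abs_of_nonneg (h.rate_nonneg x q), Real.norm_eq_abs,
      abs_of_pos (inv_pos.2 hr)]
    refine mul_le_mul_of_nonneg_left (mul_le_mul_of_nonneg_left ?_ (inv_pos.2 hr).le)
      (h.rate_nonneg x q)
    exact abs_sub_le_sum_sum (M x) m _ _
  have h4 := h1.sub h3
  rw [sub_zero] at h4
  refine h4.congr' ?_
  filter_upwards [eventually_two_le_fst] with x hx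
  have hN := numPairs_pos hx
  have hρ := h.ρ_pos x.1
  rw [Finset.mul_sum, ← Finset.sum_sub_distrib]
  refine Finset.sum_congr rfl fun q _ => ?_
  have hs1 := (Real.sqrt_pos.2 hN).ne'
  have hs2 := (Real.sqrt_pos.2 hρ).ne'
  have hrr : Real.sqrt (ρ x.1) / Real.sqrt (numPairs x.1)
      = ρ x.1 * (Real.sqrt (numPairs x.1 * ρ x.1))⁻¹ := by
    rw [Real.sqrt_mul hN.le]
    field_simp
    rw [Real.sq_sqrt hρ.le]
  rw [hrr]
  simp only [rate, Matrix.smul_apply, smul_eq_mul, Pi.mul_apply, hM]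
  ring

/-- The conditional variance of the score converges. -/
lemma Regime.tendsto_score_var (h : Regime P π Bbar ν γ₀ ρ c e z A R κ) (s : Cov p) :
    Tendsto (fun x : Σ n, Ω n => ∑ q ∈ pairs x.1,
      rate (ρ x.1 • Bbar) γ₀ (c x.1 x.2) (z x.1 x.2) q.1 q.2 *
        ((Real.sqrt (numPairs x.1 * ρ x.1))⁻¹ * (inner ℝ (z x.1 x.2 q.1 q.2) s
          - blockAvg (z x.1 x.2) (e x.1 x.2) γ₀ (fun y => inner ℝ y s)
            (e x.1 x.2 q.1) (e x.1 x.2 q.2))) ^ 2) (inProb P)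
      (𝓝 (quad (sigmaInf Bbar π ν γ₀) s)) := by
  set m := (∫ y, inner ℝ y s * Real.exp (inner ℝ y γ₀) ∂ν) / theta ν γ₀ with hm
  have hms := measurable_inner_const s
  have hbd : ∀ x : Cov p, ‖x‖ ≤ R → |inner ℝ x s| ≤ R * ‖s‖ := fun x hx => abs_inner_le hx s
  have hbd' : ∀ x : Cov p, ‖x‖ ≤ R → |(inner ℝ x s - m) ^ 2| ≤ (R * ‖s‖ + |m|) ^ 2 := by
    intro x hx
    rw [abs_pow]
    have : |inner ℝ x s - m| ≤ R * ‖s‖ + |m| :=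
      (abs_sub _ _).trans (by gcongr; exact hbd x hx)
    gcongr
  -- Centred at `m`, the limiting variance is an integrated square, which is the quadratic form of
  -- the tilted covariance.
  have h1 := h.tendsto_sum_rate_mul ((hms.sub_const m).pow_const 2) hbd'
  rw [integral_centred_sq_mul_exp h.bdd h.theta_pos, ← quad_smul, ← sigmaInf_eq_smul] at h1
  set M : (Σ n, Ω n) → Fin K → Fin K → ℝ := fun x k l =>
    blockAvg (z x.1 x.2) (e x.1 x.2) γ₀ (fun y => inner ℝ y s) k l with hM
  have h2 : Tendsto (fun x : Σ n, Ω n => (3 * (R * ‖s‖) + |m|) *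
      ∑ k, ∑ l, |M x k l - m|) (inProb P) (𝓝 0) := by
    have : Tendsto (fun x : Σ n, Ω n => ∑ k, ∑ l, |M x k l - m|) (inProb P)
        (𝓝 (∑ k : Fin K, ∑ l : Fin K, 0)) :=
      tendsto_finsetSum _ fun k _ => tendsto_finsetSum _ fun l _ => by
        have := (tendsto_sub_nhds_zero_iff.2 (h.tendsto_blockAvg hms hbd k l)).norm
        rwa [norm_zero] at this
    simpa using this.const_mul (3 * (R * ‖s‖) + |m|)
  have hprod := h.tendsto_sum_rate.mul h2
  rw [mul_zero] at hprod
  have h3 : Tendsto (fun x : Σ n, Ω n => ∑ q ∈ pairs x.1,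
      rate (ρ x.1 • Bbar) γ₀ (c x.1 x.2) (z x.1 x.2) q.1 q.2 *
        ((Real.sqrt (numPairs x.1 * ρ x.1))⁻¹ * (inner ℝ (z x.1 x.2 q.1 q.2) s
          - M x (e x.1 x.2 q.1) (e x.1 x.2 q.2))) ^ 2
      - (Real.sqrt (numPairs x.1 * ρ x.1) ^ 2)⁻¹ *
        ∑ q ∈ pairs x.1, rate (ρ x.1 • Bbar) γ₀ (c x.1 x.2) (z x.1 x.2) q.1 q.2
        * (inner ℝ (z x.1 x.2 q.1 q.2) s - m) ^ 2) (inProb P) (𝓝 0) := by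
    refine squeeze_zero_norm' ?_ hprod
    filter_upwards [eventually_two_le_fst, h.eventually_norm_z, h.eventually_blockExp_pos]
      with x hx hz hE
    have hr := h.scale_pos hx
    set r := Real.sqrt (numPairs x.1 * ρ x.1)
    set D := ∑ k, ∑ l, |M x k l - m|
    rw [Finset.mul_sum, ← Finset.sum_sub_distrib, Finset.mul_sum, Finset.sum_mul]
    refine (norm_sum_le _ _).trans (Finset.sum_le_sum fun q _ => ?_)
    rw [Real.norm_eq_abs]
    exact abs_mul_sq_sub_le (h.rate_nonneg x q) (abs_blockAvg_inner_le hz s (hE _ _))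
      (hbd _ (hz _ _)) (abs_sub_le_sum_sum (M x) m _ _)
  have h4 := h3.add h1
  rw [zero_add] at h4
  refine h4.congr fun x => ?_
  simp only [sub_add_cancel, hM]

/-- The conditional log characteristic function of the score converges. -/
lemma Regime.tendsto_score_logChar (h : Regime P π Bbar ν γ₀ ρ c e z A R κ) (s : Cov p) :
    Tendsto (fun x : Σ n, Ω n => ∑ q ∈ pairs x.1,
      (rate (ρ x.1 • Bbar) γ₀ (c x.1 x.2) (z x.1 x.2) q.1 q.2 : ℂ) *
        (Complex.exp (Complex.I * (((Real.sqrt (numPairs x.1 * ρ x.1))⁻¹ *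
          (inner ℝ (z x.1 x.2 q.1 q.2) s
          - blockAvg (z x.1 x.2) (e x.1 x.2) γ₀ (fun y => inner ℝ y s)
            (e x.1 x.2 q.1) (e x.1 x.2 q.2)) : ℝ) : ℂ)) - 1)) (inProb P)
      (𝓝 (-(quad (sigmaInf Bbar π ν γ₀) s : ℂ) / 2)) := by
  set r : ℕ → ℝ := fun n => Real.sqrt (numPairs n * ρ n) with hr
  set u : (x : Σ n, Ω n) → Fin x.1 × Fin x.1 → ℝ := fun x q => (r x.1)⁻¹ *
    (inner ℝ (z x.1 x.2 q.1 q.2) s - blockAvg (z x.1 x.2) (e x.1 x.2) γ₀ (fun y => inner ℝ y s)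
      (e x.1 x.2 q.1) (e x.1 x.2 q.2)) with hu
  set lam : (x : Σ n, Ω n) → Fin x.1 × Fin x.1 → ℝ := fun x q =>
    rate (ρ x.1 • Bbar) γ₀ (c x.1 x.2) (z x.1 x.2) q.1 q.2 with hlam
  have h1 : Tendsto (fun x => ∑ q ∈ pairs x.1, lam x q * u x q) (inProb P) (𝓝 0) :=
    h.tendsto_score_mean s
  have h2 : Tendsto (fun x => ∑ q ∈ pairs x.1, lam x q * u x q ^ 2) (inProb P)
    (𝓝 (quad (sigmaInf Bbar π ν γ₀) s)) := h.tendsto_score_var s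
  have hr' : Tendsto (fun x : Σ n, Ω n => r x.1) (inProb P) atTop :=
    h.tendsto_scale.comp tendsto_fst_inProb
  have hb : Tendsto (fun x : Σ n, Ω n => 2 * (R * ‖s‖) * (r x.1)⁻¹) (inProb P) (𝓝 0) := by
    simpa using hr'.inv_tendsto_atTop.const_mul (2 * (R * ‖s‖))
  have h3 : Tendsto (fun x => (∑ q ∈ pairs x.1, (lam x q : ℂ) *
      (Complex.exp (Complex.I * (u x q : ℂ)) - 1)) - (Complex.I *
        ((∑ q ∈ pairs x.1, lam x q * u x q : ℝ) : ℂ)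
        - ((∑ q ∈ pairs x.1, lam x q * u x q ^ 2 : ℝ) : ℂ) / 2)) (inProb P) (𝓝 0) := by
    -- Each `u` is at most `2 R ‖s‖ / r`, so the cubic remainders sum to at most the total rate, of
    -- order `r²`, times a multiple of `r⁻³`.
    have hprod := h.tendsto_sum_rate.mul (hr'.inv_tendsto_atTop.const_mul ((2 * (R * ‖s‖)) ^ 3))
    rw [mul_zero, mul_zero] at hprod
    refine squeeze_zero_norm' ?_ hprod
    filter_upwards [eventually_two_le_fst, h.eventually_norm_z, h.eventually_blockExp_pos,
      hb.eventually (eventually_le_nhds one_pos)] with x hx hz hE hb1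
    have hrp : 0 < r x.1 := h.scale_pos hx
    have hub : ∀ q, |u x q| ≤ 2 * (R * ‖s‖) * (r x.1)⁻¹ := by
      intro q
      have ha := abs_blockAvg_inner_le (k := e x.1 x.2 q.1) (l := e x.1 x.2 q.2) hz s (hE _ _)
      have hy : |inner ℝ (z x.1 x.2 q.1 q.2) s| ≤ R * ‖s‖ := abs_inner_le (hz _ _) s
      rw [hu, abs_mul, abs_of_pos (inv_pos.2 hrp), mul_comm]
      refine mul_le_mul_of_nonneg_right ?_ (inv_pos.2 hrp).le
      exact (abs_sub _ _).trans (by linarith)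
    push_cast
    rw [Finset.mul_sum, Finset.sum_div, ← Finset.sum_sub_distrib, ← Finset.sum_sub_distrib]
    have hbound : ∀ q, ‖(lam x q : ℂ) * (Complex.exp (Complex.I * (u x q : ℂ)) - 1)
        - (Complex.I * ((lam x q : ℂ) * (u x q : ℂ)) - (lam x q : ℂ) * (u x q : ℂ) ^ 2 / 2)‖
        ≤ lam x q * (2 * (R * ‖s‖) * (r x.1)⁻¹) ^ 3 := by
      intro q
      have h5 := norm_cexp_I_mul_sub_quadratic_le (hub q) hb1
      have h6 : (lam x q : ℂ) * (Complex.exp (Complex.I * (u x q : ℂ)) - 1)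
        - (Complex.I * ((lam x q : ℂ) * (u x q : ℂ)) - (lam x q : ℂ) * (u x q : ℂ) ^ 2 / 2)
        = (lam x q : ℂ) * (Complex.exp (Complex.I * (u x q : ℂ)) - 1
          - (Complex.I * (u x q : ℂ) - (u x q : ℂ) ^ 2 / 2)) := by ring
      have hl0 : 0 ≤ lam x q := h.rate_nonneg x q
      rw [h6, norm_mul, Complex.norm_real, Real.norm_eq_abs, abs_of_nonneg hl0]
      exact mul_le_mul_of_nonneg_left h5 hl0
    refine (norm_sum_le _ _).trans ((Finset.sum_le_sum fun q _ => hbound q).trans_eq ?_)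
    rw [← Finset.sum_mul]
    simp only [hlam, Pi.inv_apply]
    change _ = ((r x.1) ^ 2)⁻¹ * _ * _
    field_simp
  have h4 := h3.add (((((Complex.continuous_ofReal.tendsto _).comp h1).const_mul Complex.I).sub
    (((Complex.continuous_ofReal.tendsto _).comp h2).div_const 2)))
  simp only [Complex.ofReal_zero, mul_zero, zero_sub, zero_add, Function.comp_def,
    sub_add_cancel, ← neg_div] at h4
  exact h4

/-- The characteristic functions of the score converge to those of a Gaussian vector. -/
lemma Regime.tendsto_charFun_score (h : Regime P π Bbar ν γ₀ ρ c e z A R κ) (s : Cov p) :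
    Tendsto (fun n => ∫ ω, Complex.exp ((inner ℝ (score (A n ω) (z n ω) (e n ω) γ₀
      (Real.sqrt (numPairs n * ρ n))) s : ℝ) * Complex.I) ∂(P n)) atTop
      (𝓝 (Complex.exp (-(quad (sigmaInf Bbar π ν γ₀) s : ℂ) / 2))) := by
  set r : ℕ → ℝ := fun n => Real.sqrt (numPairs n * ρ n) with hr
  set u : (n : ℕ) → (Fin n → Fin K) × (Fin n → Fin n → Cov p) → Fin n × Fin n → ℝ :=
    fun n y q => (r n)⁻¹ * (inner ℝ (y.2 q.1 q.2) s - blockAvg y.2 y.1 γ₀ (fun y => inner ℝ y s)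
      (y.1 q.1) (y.1 q.2)) with hu
  have hum : ∀ n q, Measurable fun y => u n y q := by
    intro n q
    have h1 : Measurable fun y : (Fin n → Fin K) × (Fin n → Fin n → Cov p) =>
        (inner ℝ (y.2 q.1 q.2) s : ℝ) := (measurable_inner_const s).comp
      ((measurable_pi_apply q.2).comp ((measurable_pi_apply q.1).comp measurable_snd))
    exact measurable_const.mul (h1.sub (measurable_blockAvg (measurable_inner_const s) γ₀ q))
  set Ψ : (n : ℕ) → Ω n → ℂ := fun n ω => ∑ q ∈ pairs n,
      (rate (ρ n • Bbar) γ₀ (c n ω) (z n ω) q.1 q.2 : ℂ) *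
        (Complex.exp (Complex.I * (u n (e n ω, z n ω) q : ℂ)) - 1) with hΨ
  have hid : ∀ n, ∫ ω, Complex.exp ((inner ℝ (score (A n ω) (z n ω) (e n ω) γ₀
      (r n)) s : ℝ) * Complex.I) ∂(P n) = ∫ ω, Complex.exp (Ψ n ω) ∂(P n) := by
    intro n
    have h1 := (h.model n).integral_cexp (h.smul_nonneg n)
      (fun y q => Complex.I * (u n y.2 q : ℂ))
      (fun q => measurable_const.mul (Complex.measurable_ofReal.comp
        ((hum n q).comp measurable_snd))) (fun y q => by simp)
    refine Eq.trans (integral_congr_ae (Eventually.of_forall fun ω => ?_)) h1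
    simp only [inner_score, hu]
    push_cast
    rw [Finset.sum_mul]
    congr 1
    exact Finset.sum_congr rfl fun q _ => by ring
  refine Tendsto.congr (fun n => (hid n).symm) ?_
  -- `exp Ψ` is bounded by one because `exp(i u)` has real part at most one and the rates are
  -- nonnegative; convergence of `Ψ` in probability then passes to the mean.
  refine tendsto_integral_of_inProb (F := fun n ω => Complex.exp (Ψ n ω)) (C := 1) ?_ ?_
    ((Complex.continuous_exp.tendsto _).comp (h.tendsto_score_logChar s))
  · intro n
    refine (Complex.measurable_exp.comp
      (Finset.measurable_sum _ fun q _ => Measurable.mul ?_ ?_)).aestronglyMeasurable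
    · exact Complex.measurable_ofReal.comp (h.measurable_rate n q.1 q.2)
    · exact (Complex.measurable_exp.comp (measurable_const.mul (Complex.measurable_ofReal.comp
        ((hum n q).comp ((h.model n).measurable_e.prodMk (h.model n).measurable_z))))).sub_const 1
  · intro n
    refine Eventually.of_forall fun ω => ?_
    rw [Complex.norm_exp, Real.exp_le_one_iff, hΨ, Complex.re_sum]
    refine Finset.sum_nonpos fun q _ => ?_
    rw [Complex.re_ofReal_mul]
    refine mul_nonpos_of_nonneg_of_nonpos (h.rate_nonneg ⟨n, ω⟩ q) ?_
    have h1 := Complex.re_le_norm (Complex.exp (Complex.I * (u n (e n ω, z n ω) q : ℂ)))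
    rw [Complex.norm_exp_I_mul_ofReal] at h1
    simpa using h1

end Sequence

/-! ### The quadratic approximation of the profile likelihood -/

lemma quad_sub {p : ℕ} (M N : Matrix (Fin p) (Fin p) ℝ) (h : Cov p) :
    quad (M - N) h = quad M h - quad N h := by
  simp only [quad, Matrix.sub_apply, mul_sub, Finset.sum_sub_distrib]

/-- The weighted block covariance matrix. -/
def blockCov {n K p : ℕ} (z : Fin n → Fin n → Cov p) (e : Fin n → Fin K) (γ : Cov p)
    (k l : Fin K) : Matrix (Fin p) (Fin p) ℝ :=
  Matrix.of fun r s => blockAvg z e γ (fun x => x r * x s) k l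
    - blockAvg z e γ (fun x => x r) k l * blockAvg z e γ (fun x => x s) k l

/-- This separates the direction from the data: convergence of finitely many matrix entries gives
convergence uniformly over bounded `h`. -/
lemma blockVar_eq_quad {n K p : ℕ} (z : Fin n → Fin n → Cov p) (e : Fin n → Fin K) (γ h : Cov p)
    (k l : Fin K) : blockVar z e γ h k l = quad (blockCov z e γ k l) h := by
  have h1 : (fun x : Cov p => inner ℝ x h ^ 2) = fun x => ∑ r, ∑ s, (h r * h s) * (x r * x s) :=
    funext fun x => inner_sq_eq_sum x h
  rw [blockVar, h1]
  simp only [inner_eq_sum (h := h), blockAvg_sum,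
    blockAvg_const_mul, quad, blockCov, Matrix.of_apply, mul_sub, Finset.sum_sub_distrib]
  rw [sq, Finset.sum_mul_sum]
  congr 1
  exact Finset.sum_congr rfl fun r _ => Finset.sum_congr rfl fun s _ => by ring

section Sequence

variable {Ω : ℕ → Type*} [∀ n, MeasurableSpace (Ω n)] {P : (n : ℕ) → Measure (Ω n)}
  {K p : ℕ} {π : Fin K → ℝ}
  {Bbar : Matrix (Fin K) (Fin K) ℝ} {ν : Measure (Cov p)} {γ₀ : Cov p} {ρ : ℕ → ℝ}
  {c e : (n : ℕ) → Ω n → Fin n → Fin K} {z : (n : ℕ) → Ω n → Fin n → Fin n → Cov p}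
  {A : (n : ℕ) → Ω n → Fin n → Fin n → ℕ} {R κ : ℝ}

lemma Regime.measurable_score (h : Regime P π Bbar ν γ₀ ρ c e z A R κ) (n : ℕ) (r : ℝ) :
    Measurable fun ω => score (A n ω) (z n ω) (e n ω) γ₀ r := by
  have hy : Measurable fun ω => (e n ω, z n ω) :=
    (h.model n).measurable_e.prodMk (h.model n).measurable_z
  have hcoord : ∀ q : Fin n × Fin n, Measurable fun ω => fun s : Fin p =>
      blockAvg (z n ω) (e n ω) γ₀ (fun x => x s) (e n ω q.1) (e n ω q.2) := by
    intro q
    rw [measurable_pi_iff]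
    intro s
    have h1 := (measurable_blockAvg (K := K) (measurable_apply s) γ₀ q).comp hy
    exact h1
  have hmean : ∀ q : Fin n × Fin n,
      Measurable fun ω => blockMean (z n ω) (e n ω) γ₀ (e n ω q.1) (e n ω q.2) := fun q =>
    (WithLp.measurable_toLp 2 (Fin p → ℝ)).comp (hcoord q)
  have hA : ∀ q : Fin n × Fin n, Measurable fun ω => (A n ω q.1 q.2 : ℝ) := fun q =>
    (measurable_of_countable (fun k : ℕ => (k : ℝ))).comp ((measurable_pi_apply q.2).comp
      ((measurable_pi_apply q.1).comp (h.model n).measurable_A))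
  have hsub : ∀ q : Fin n × Fin n, Measurable fun ω =>
      z n ω q.1 q.2 - blockMean (z n ω) (e n ω) γ₀ (e n ω q.1) (e n ω q.2) := fun q =>
    ((h.model n).measurable_z_apply q.1 q.2).sub (hmean q)
  have hsum : Measurable fun ω => ∑ q ∈ pairs n, (A n ω q.1 q.2 : ℝ) •
      (z n ω q.1 q.2 - blockMean (z n ω) (e n ω) γ₀ (e n ω q.1) (e n ω q.2)) :=
    Finset.measurable_sum _ fun q _ => (hA q).smul (hsub q)
  exact hsum.const_smul r⁻¹

variable [∀ n, IsProbabilityMeasure (P n)] [IsProbabilityMeasure ν]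

/-- The block covariance matrices converge. -/
lemma Regime.tendsto_blockCov (h : Regime P π Bbar ν γ₀ ρ c e z A R κ) :
    Tendsto (fun x : Σ n, Ω n => ∑ k, ∑ l, ∑ r, ∑ s,
      |(blockCov (z x.1 x.2) (e x.1 x.2) γ₀ k l - (theta ν γ₀)⁻¹ • tiltedCov ν γ₀) r s|)
      (inProb P) (𝓝 0) := by
  have hterm : ∀ k l r s, Tendsto (fun x : Σ n, Ω n =>
      |(blockCov (z x.1 x.2) (e x.1 x.2) γ₀ k l - (theta ν γ₀)⁻¹ • tiltedCov ν γ₀) r s|)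
      (inProb P) (𝓝 0) := by
    intro k l r s
    have h1 := h.tendsto_blockAvg ((measurable_apply r).mul (measurable_apply s))
      (fun x hx => abs_apply_mul_apply_le hx r s) k l
    have h2 := h.tendsto_blockAvg (measurable_apply r) (fun x hx => abs_apply_le hx r) k l
    have h3 := h.tendsto_blockAvg (measurable_apply s) (fun x hx => abs_apply_le hx s) k l
    have h4 := ((h1.sub (h2.mul h3)).sub_const (((theta ν γ₀)⁻¹ • tiltedCov ν γ₀) r s)).abs
    have h5 : (∫ y : Cov p, (y r * y s) * Real.exp (inner ℝ y γ₀) ∂ν) / theta ν γ₀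
        - (∫ y : Cov p, y r * Real.exp (inner ℝ y γ₀) ∂ν) / theta ν γ₀
          * ((∫ y : Cov p, y s * Real.exp (inner ℝ y γ₀) ∂ν) / theta ν γ₀)
        - ((theta ν γ₀)⁻¹ • tiltedCov ν γ₀) r s = 0 := by
      simp only [tiltedCov, Matrix.smul_apply, Matrix.sub_apply, Matrix.vecMulVec_apply, sigma, mu,
        Matrix.of_apply, smul_eq_mul]
      ring
    have h6 : |(∫ y : Cov p, (y r * y s) * Real.exp (inner ℝ y γ₀) ∂ν) / theta ν γ₀
        - (∫ y : Cov p, y r * Real.exp (inner ℝ y γ₀) ∂ν) / theta ν γ₀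
          * ((∫ y : Cov p, y s * Real.exp (inner ℝ y γ₀) ∂ν) / theta ν γ₀)
        - ((theta ν γ₀)⁻¹ • tiltedCov ν γ₀) r s| = 0 := by rw [h5, abs_zero]
    rw [← h6]
    exact h4
  have := tendsto_finsetSum Finset.univ fun k _ => tendsto_finsetSum Finset.univ fun l _ =>
    tendsto_finsetSum Finset.univ fun r _ => tendsto_finsetSum Finset.univ fun s _ =>
      hterm k l r s
  simpa only [Finset.sum_const_zero] using this

/-- Locally uniform quadratic approximation of the profile likelihood. -/
lemma Regime.eventually_abs_logLik_sub_le (h : Regime P π Bbar ν γ₀ ρ c e z A R κ) (H : ℝ)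
    {ε : ℝ} (hε : 0 < ε) : ∀ᶠ x : Σ n, Ω n in inProb P, ∀ u : Cov p, ‖u‖ ≤ H →
      |logLik (A x.1 x.2) (z x.1 x.2) (e x.1 x.2)
          (γ₀ + (Real.sqrt (numPairs x.1 * ρ x.1))⁻¹ • u)
        - logLik (A x.1 x.2) (z x.1 x.2) (e x.1 x.2) γ₀
        - (inner ℝ (score (A x.1 x.2) (z x.1 x.2) (e x.1 x.2) γ₀
            (Real.sqrt (numPairs x.1 * ρ x.1))) u - quad (sigmaInf Bbar π ν γ₀) u / 2)| < ε := by
  set r : ℕ → ℝ := fun n => Real.sqrt (numPairs n * ρ n) with hr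
  set T : (Σ n, Ω n) → ℝ := fun x => edgeDensity (A x.1 x.2) (r x.1) with hT
  set τ := meanB Bbar π * theta ν γ₀ with hτ
  set V := (theta ν γ₀)⁻¹ • tiltedCov ν γ₀ with hV
  set C := ∑ i, ∑ j, |V i j| with hC
  set Δ : (Σ n, Ω n) → ℝ := fun x => ∑ k, ∑ l, ∑ i, ∑ j,
    |(blockCov (z x.1 x.2) (e x.1 x.2) γ₀ k l - V) i j| with hΔ
  have hTlim : Tendsto T (inProb P) (𝓝 τ) := h.tendsto_edgeDensity
  have hΔlim : Tendsto Δ (inProb P) (𝓝 0) := h.tendsto_blockCov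
  have hr' : Tendsto (fun x : Σ n, Ω n => r x.1) (inProb P) atTop :=
    h.tendsto_scale.comp tendsto_fst_inProb
  have hrinv : Tendsto (fun x : Σ n, Ω n => (r x.1)⁻¹) (inProb P) (𝓝 0) := hr'.inv_tendsto_atTop
  -- This bound on the expansion error involves `u` only through `‖u‖ ≤ H`, which gives uniformity.
  have herr : Tendsto (fun x : Σ n, Ω n => (T x * (H ^ 2 * Δ x) + |T x - τ| * (H ^ 2 * C)) / 2
      + 20 * (R * H) ^ 3 * T x * (r x.1)⁻¹) (inProb P) (𝓝 0) := by
    have h1 := (hTlim.mul (hΔlim.const_mul (H ^ 2))).add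
      ((tendsto_sub_nhds_zero_iff.2 hTlim).abs.mul_const (H ^ 2 * C))
    have h2 := (h1.div_const 2).add ((hTlim.const_mul (20 * (R * H) ^ 3)).mul hrinv)
    simpa using h2
  have hsmall : Tendsto (fun x : Σ n, Ω n => R * H * (r x.1)⁻¹) (inProb P) (𝓝 0) := by
    simpa using hrinv.const_mul (R * H)
  filter_upwards [eventually_two_le_fst, h.eventually_norm_z, h.eventually_blockExp_pos,
    hsmall.eventually (eventually_le_nhds (by norm_num : (0 : ℝ) < 1 / 4)),
    herr.eventually (eventually_lt_nhds hε)] with x hx hz hE hs hlt u hu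
  have hrp : 0 < r x.1 := h.scale_pos hx
  have hT0 : 0 ≤ T x := mul_nonneg (by positivity) (Finset.sum_nonneg fun q _ => Nat.cast_nonneg _)
  have hR0 := h.R_nonneg
  have hvar : ∀ k l, |blockVar (z x.1 x.2) (e x.1 x.2) γ₀ u k l - quad V u| ≤ H ^ 2 * Δ x := by
    intro k l
    rw [blockVar_eq_quad, ← quad_sub]
    refine (abs_quad_le _ _).trans ?_
    have h1 : ∑ i, ∑ j, |(blockCov (z x.1 x.2) (e x.1 x.2) γ₀ k l - V) i j| ≤ Δ x :=
      (Finset.single_le_sum (f := fun l => ∑ i, ∑ j,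
        |(blockCov (z x.1 x.2) (e x.1 x.2) γ₀ k l - V) i j|)
        (fun _ _ => Finset.sum_nonneg fun _ _ => Finset.sum_nonneg fun _ _ => abs_nonneg _)
        (Finset.mem_univ l)).trans
      (Finset.single_le_sum (f := fun k => ∑ l, ∑ i, ∑ j,
        |(blockCov (z x.1 x.2) (e x.1 x.2) γ₀ k l - V) i j|)
        (fun _ _ => Finset.sum_nonneg fun _ _ => Finset.sum_nonneg fun _ _ =>
          Finset.sum_nonneg fun _ _ => abs_nonneg _) (Finset.mem_univ k))
    have h2 : 0 ≤ ∑ i, ∑ j, |(blockCov (z x.1 x.2) (e x.1 x.2) γ₀ k l - V) i j| :=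
      Finset.sum_nonneg fun _ _ => Finset.sum_nonneg fun _ _ => abs_nonneg _
    gcongr
  -- `τ` carries a factor `θ` and `V` a factor `θ⁻¹`, so `τ • V` is exactly `sigmaInf`.
  have hVeq : T x * quad V u - quad (sigmaInf Bbar π ν γ₀) u = (T x - τ) * quad V u := by
    rw [sigmaInf_eq_smul, hV, quad_smul, quad_smul, hτ]
    have := h.theta_pos.ne'
    field_simp
  have hVle : |T x * quad V u - quad (sigmaInf Bbar π ν γ₀) u| ≤ |T x - τ| * (H ^ 2 * C) := by
    rw [hVeq, abs_mul]
    refine mul_le_mul_of_nonneg_left ((abs_quad_le _ _).trans ?_) (abs_nonneg _)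
    have : 0 ≤ C := Finset.sum_nonneg fun _ _ => Finset.sum_nonneg fun _ _ => abs_nonneg _
    gcongr
  have hmain := abs_logLik_sub_quadratic_le (γ := γ₀) ((h.model x.1).A_symm x.2) ((h.model x.1).A_diag x.2)
    ((h.model x.1).z_symm x.2) hz hE hrp (h := u) (V := quad (sigmaInf Bbar π ν γ₀) u)
    (v := quad V u) (D := H ^ 2 * Δ x) (by
      rw [div_eq_mul_inv]
      refine le_trans ?_ hs
      gcongr) hvar
  refine (hmain.trans ?_).trans_lt hlt
  have hH : R * ‖u‖ ≤ R * H := by gcongr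
  rw [div_eq_mul_inv _ (r x.1)]
  gcongr

end Sequence

/-! ### Asymptotic normality of the maximizer -/

/-- A maximizer of a profile likelihood that is close to a quadratic form is close to the maximizer
of the quadratic form. -/
lemma norm_argmax_sub_lt {n K p : ℕ} {A : Fin n → Fin n → ℕ} {z : Fin n → Fin n → Cov p}
    {e : Fin n → Fin K} {γ g : Cov p} (hA : ∀ i j, A i j = A j i) (hA0 : ∀ i, A i i = 0)
    (hz : ∀ i j, z i j = z j i) {M : Matrix (Fin p) (Fin p) ℝ} (hM : M.PosDef) {a : ℝ}
    (ha : ∀ u : Cov p, a * ‖u‖ ^ 2 ≤ quad M u) {r δ : ℝ} (hr : 0 < r) (hδ : 0 < δ) {w : Cov p}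
    (happ : ∀ u : Cov p, ‖u - op M⁻¹ w‖ ≤ δ → |logLik A z e (γ + r⁻¹ • u) - logLik A z e γ
      - (inner ℝ w u - quad M u / 2)| < a * δ ^ 2 / 4) (hg : IsArgmax A z e g) :
    ‖r • (g - γ) - op M⁻¹ w‖ < δ := by
  set F : Cov p → ℝ := fun u => logLik A z e (γ + r⁻¹ • u) with hF
  have hconc : ConcaveOn ℝ Set.univ F := by
    refine ⟨convex_univ, fun x _ y _ b d hb hd hbd => ?_⟩
    have h1 := (concaveOn_logLik (e := e) hA hA0 hz).2 (Set.mem_univ (γ + r⁻¹ • x))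
      (Set.mem_univ (γ + r⁻¹ • y)) hb hd hbd
    have h2 : b • (γ + r⁻¹ • x) + d • (γ + r⁻¹ • y) = γ + r⁻¹ • (b • x + d • y) := by
      have : γ = (b + d) • γ := by rw [hbd, one_smul]
      conv_rhs => rw [this]
      module
    rw [h2] at h1
    exact h1
  have hcont : Continuous F := (continuous_logLik hA hA0 hz).comp (by fun_prop)
  have hback : ∀ γ', F (r • (γ' - γ)) = logLik A z e γ' := by
    intro γ'
    simp only [hF, smul_smul, inv_mul_cancel₀ hr.ne', one_smul, add_sub_cancel]
  -- On the sphere of radius `δ` the quadratic form lies at least `a δ² / 2` below its value at the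
  -- centre. The approximation errors at the two points are each less than `a δ² / 4`, so `F` is
  -- strictly smaller on the sphere.
  obtain ⟨⟨u, hu⟩, hnear⟩ := exists_argmax_and_norm_sub_lt hconc hcont hδ (x₀ := op M⁻¹ w) (by
    intro x hx
    have h1 := abs_lt.1 (happ x hx.le)
    have h2 := abs_lt.1 (happ (op M⁻¹ w) (by rw [sub_self, norm_zero]; exact hδ.le))
    have h3 := quadratic_eq hM w x
    have h4 := ha (x - op M⁻¹ w)
    rw [hx] at h4
    simp only [hF]
    linarith [h1.2, h2.1])
  refine hnear _ fun y => ?_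
  rw [hback]
  -- `IsArgmax` constrains `g` only when a maximizer exists; the one just found supplies this.
  refine hg ⟨γ + r⁻¹ • u, fun γ' => ?_⟩ _
  have := hu (r • (γ' - γ))
  rwa [hback] at this

section Sequence

variable {Ω : ℕ → Type*} [∀ n, MeasurableSpace (Ω n)] {P : (n : ℕ) → Measure (Ω n)}
  [∀ n, IsProbabilityMeasure (P n)]

/-- Convergence of characteristic functions gives tightness. -/
lemma exists_norm_le_of_tendsto_charFun {p : ℕ} {W : (n : ℕ) → Ω n → Cov p}
    (hW : ∀ n, Measurable (W n)) {f : Cov p → ℂ} (hf : ContinuousAt f 0)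
    (h : ∀ t, Tendsto (fun n => ∫ ω, Complex.exp ((inner ℝ (W n ω) t : ℝ) * Complex.I) ∂(P n))
      atTop (𝓝 (f t))) (η : ENNReal) (hη : 0 < η) :
    ∃ R : ℝ, ∀ n, P n {ω | ¬ ‖W n ω‖ ≤ R} ≤ η := by
  have : ∀ n, IsProbabilityMeasure ((P n).map (W n)) := fun n =>
    Measure.isProbabilityMeasure_map (hW n).aemeasurable
  have htight := isTightMeasureSet_of_tendsto_charFun (μ := fun n => (P n).map (W n)) hf (by
    intro t
    refine (h t).congr fun n => ?_
    rw [charFun_apply, integral_map (hW n).aemeasurable (by fun_prop)])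
  rw [isTightMeasureSet_iff_exists_isCompact_measure_compl_le] at htight
  obtain ⟨C, hC, hCη⟩ := htight η hη
  obtain ⟨R, hR⟩ := hC.isBounded.exists_norm_le
  refine ⟨R, fun n => ?_⟩
  have h1 := hCη _ ⟨n, rfl⟩
  rw [Measure.map_apply (hW n) hC.measurableSet.compl] at h1
  refine le_trans (measure_mono ?_) h1
  intro ω hω hc
  exact hω (hR _ hc)

variable {K p : ℕ} {π : Fin K → ℝ}
  {Bbar : Matrix (Fin K) (Fin K) ℝ} {ν : Measure (Cov p)} [IsProbabilityMeasure ν] {γ₀ : Cov p}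
  {ρ : ℕ → ℝ}
  {c e : (n : ℕ) → Ω n → Fin n → Fin K} {z : (n : ℕ) → Ω n → Fin n → Fin n → Cov p}
  {A : (n : ℕ) → Ω n → Fin n → Fin n → ℕ} {R κ : ℝ}

/-- The maximizer is asymptotically equivalent to a linear transformation of the score. -/
lemma Regime.tendsto_argmax_sub (h : Regime P π Bbar ν γ₀ ρ c e z A R κ)
    (hM : (sigmaInf Bbar π ν γ₀).PosDef) {γhat : (n : ℕ) → Ω n → Cov p}
    (hγ_max : ∀ n, ∀ᵐ ω ∂(P n), IsArgmax (A n ω) (z n ω) (e n ω) (γhat n ω)) :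
    Tendsto (fun x : Σ n, Ω n => Real.sqrt (numPairs x.1 * ρ x.1) • (γhat x.1 x.2 - γ₀)
      - op (sigmaInf Bbar π ν γ₀)⁻¹ (score (A x.1 x.2) (z x.1 x.2) (e x.1 x.2) γ₀
        (Real.sqrt (numPairs x.1 * ρ x.1)))) (inProb P) (𝓝 0) := by
  set M := sigmaInf Bbar π ν γ₀ with hMdef
  set r : ℕ → ℝ := fun n => Real.sqrt (numPairs n * ρ n) with hr
  set W : (n : ℕ) → Ω n → Cov p := fun n ω => score (A n ω) (z n ω) (e n ω) γ₀ (r n) with hWdef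
  obtain ⟨a, ha0, ha⟩ := exists_le_quad hM
  have hmax : ∀ᶠ x : Σ n, Ω n in inProb P,
      IsArgmax (A x.1 x.2) (z x.1 x.2) (e x.1 x.2) (γhat x.1 x.2) :=
    eventually_inProb_of_ae
      (p := fun x => IsArgmax (A x.1 x.2) (z x.1 x.2) (e x.1 x.2) (γhat x.1 x.2))
      (Eventually.of_forall hγ_max)
  have hcontf : ContinuousAt (fun s : Cov p => Complex.exp (-(quad M s : ℂ) / 2)) 0 := by
    have := continuous_quad M
    fun_prop
  -- The quadratic approximation is uniform only on bounded sets, while its maximizer `Σ_∞⁻¹ W`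
  -- moves with the data. Tightness of the score confines it: when `‖W‖ ≤ B`, the `δ`-ball around it
  -- lies within radius `‖op M⁻¹‖ * B + δ`.
  refine tendsto_inProb_of_tight (W := fun x => ‖W x.1 x.2‖)
    (exists_norm_le_of_tendsto_charFun (fun n => h.measurable_score n (r n)) hcontf
      h.tendsto_charFun_score) fun B => ?_
  rw [Metric.tendsto_nhds]
  intro δ hδ
  rw [eventually_inf_principal]
  filter_upwards [hmax, eventually_two_le_fst,
    h.eventually_abs_logLik_sub_le (‖op M⁻¹‖ * B + δ) (by positivity : 0 < a * δ ^ 2 / 4)]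
    with x hx hx2 happ hB
  have hB' : ‖W x.1 x.2‖ ≤ B := hB
  rw [dist_zero_right]
  refine norm_argmax_sub_lt ((h.model x.1).A_symm x.2) ((h.model x.1).A_diag x.2)
    ((h.model x.1).z_symm x.2) hM ha (h.scale_pos hx2) hδ (fun u hu => happ u ?_) hx
  calc ‖u‖ = ‖op M⁻¹ (W x.1 x.2) + (u - op M⁻¹ (W x.1 x.2))‖ := by rw [add_sub_cancel]
    _ ≤ ‖op M⁻¹ (W x.1 x.2)‖ + ‖u - op M⁻¹ (W x.1 x.2)‖ := norm_add_le _ _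
    _ ≤ ‖op M⁻¹‖ * B + δ := by
      refine add_le_add (((op M⁻¹).le_opNorm _).trans ?_) hu
      gcongr

/-- The characteristic functions of the normalized maximizer converge. -/
lemma Regime.tendsto_charFun_argmax (h : Regime P π Bbar ν γ₀ ρ c e z A R κ)
    (hM : (sigmaInf Bbar π ν γ₀).PosDef) {γhat : (n : ℕ) → Ω n → Cov p}
    (hγ_meas : ∀ n, AEMeasurable (γhat n) (P n))
    (hγ_max : ∀ n, ∀ᵐ ω ∂(P n), IsArgmax (A n ω) (z n ω) (e n ω) (γhat n ω)) (t : Cov p) :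
    Tendsto (fun n => ∫ ω, Complex.exp ((inner ℝ (Real.sqrt (numPairs n * ρ n) •
        (γhat n ω - γ₀)) t : ℝ) * Complex.I) ∂(P n)) atTop
      (𝓝 (Complex.exp (-(quad (sigmaInf Bbar π ν γ₀)⁻¹ t : ℂ) / 2))) := by
  set M := sigmaInf Bbar π ν γ₀ with hMdef
  set r : ℕ → ℝ := fun n => Real.sqrt (numPairs n * ρ n) with hr
  set W : (n : ℕ) → Ω n → Cov p := fun n ω => score (A n ω) (z n ω) (e n ω) γ₀ (r n) with hWdef
  set X : (n : ℕ) → Ω n → ℝ := fun n ω => inner ℝ (r n • (γhat n ω - γ₀)) t with hX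
  set Y : (n : ℕ) → Ω n → ℝ := fun n ω => inner ℝ (W n ω) (op M⁻¹ t) with hY
  have hXm : ∀ n, AEMeasurable (X n) (P n) := fun n =>
    (measurable_inner_const t).comp_aemeasurable (((hγ_meas n).sub_const γ₀).const_smul (r n))
  have hYm : ∀ n, Measurable (Y n) := fun n =>
    (measurable_inner_const _).comp (h.measurable_score n (r n))
  have hnorm : ∀ y : ℝ, ‖Complex.exp ((y : ℂ) * Complex.I)‖ = 1 := Complex.norm_exp_ofReal_mul_I
  have hcm : Measurable fun y : ℝ => Complex.exp ((y : ℂ) * Complex.I) := by fun_prop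
  have hXint : ∀ n, Integrable (fun ω => Complex.exp ((X n ω : ℂ) * Complex.I)) (P n) := fun n =>
    Integrable.of_bound (hcm.comp_aemeasurable (hXm n)).aestronglyMeasurable 1
      (Eventually.of_forall fun ω => (hnorm _).le)
  have hYint : ∀ n, Integrable (fun ω => Complex.exp ((Y n ω : ℂ) * Complex.I)) (P n) := fun n =>
    Integrable.of_bound (hcm.comp (hYm n)).aestronglyMeasurable 1
      (Eventually.of_forall fun ω => (hnorm _).le)
  have hXY : Tendsto (fun x : Σ n, Ω n => X x.1 x.2 - Y x.1 x.2) (inProb P) (𝓝 0) := by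
    have h1 := Filter.Tendsto.inner (𝕜 := ℝ) (h.tendsto_argmax_sub hM hγ_max)
      (tendsto_const_nhds (x := t))
    rw [inner_zero_left] at h1
    refine h1.congr fun x => ?_
    rw [inner_sub_left, inner_op_comm (isSymm_of_posDef hM.inv)]
  have hdiff : Tendsto (fun n => ∫ ω, (Complex.exp ((X n ω : ℂ) * Complex.I)
      - Complex.exp ((Y n ω : ℂ) * Complex.I)) ∂(P n)) atTop (𝓝 0) := by
    refine tendsto_integral_of_inProb (C := 2) (fun n => ((hXint n).sub (hYint n)).1)
      (fun n => Eventually.of_forall fun ω => ?_) ?_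
    · refine (norm_sub_le _ _).trans ?_
      rw [hnorm, hnorm]
      norm_num
    · have hcont : Continuous fun y : ℝ => Complex.exp ((y : ℂ) * Complex.I) - 1 := by fun_prop
      have h2 := ((hcont.tendsto 0).comp hXY).norm
      simp only [Complex.ofReal_zero, zero_mul, Complex.exp_zero, sub_self, norm_zero] at h2
      refine squeeze_zero_norm' (Eventually.of_forall fun x => ?_) h2
      -- A unimodular factor is pulled out, so the difference depends in norm only on `X - Y`.
      have h3 : Complex.exp ((X x.1 x.2 : ℂ) * Complex.I) - Complex.exp ((Y x.1 x.2 : ℂ) * Complex.I)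
          = Complex.exp ((Y x.1 x.2 : ℂ) * Complex.I) *
            (Complex.exp (((X x.1 x.2 - Y x.1 x.2 : ℝ) : ℂ) * Complex.I) - 1) := by
        rw [mul_sub, ← Complex.exp_add, mul_one]
        congr 2
        push_cast
        ring
      rw [h3, norm_mul, hnorm, one_mul]
      exact le_rfl
  have h4 := hdiff.add (h.tendsto_charFun_score (op M⁻¹ t))
  rw [← hMdef, quad_op_inv hM, zero_add] at h4
  refine h4.congr fun n => ?_
  rw [integral_sub (hXint n) (hYint n)]
  exact sub_add_cancel _ _

end Sequence

/-! ### Positivity of the limiting connectivity and the Euclidean bound on the covariates -/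

lemma meanB_pos {K : ℕ} {Bbar : Matrix (Fin K) (Fin K) ℝ} {π : Fin K → ℝ} (hπ : ∀ k, 0 < π k)
    (hB : ∀ a b, 0 ≤ Bbar a b) (hB_ne : Bbar ≠ 0) : 0 < meanB Bbar π := by
  obtain ⟨a, b, hab⟩ : ∃ a b, Bbar a b ≠ 0 := by
    by_contra! hc
    exact hB_ne (by ext a b; exact hc a b)
  have h0 : ∀ a b, 0 ≤ Bbar a b * π a * π b := fun a b =>
    mul_nonneg (mul_nonneg (hB a b) (hπ a).le) (hπ b).le
  refine Finset.sum_pos' (fun a _ => Finset.sum_nonneg fun b _ => h0 a b)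
    ⟨a, Finset.mem_univ a, Finset.sum_pos' (fun b _ => h0 a b) ⟨b, Finset.mem_univ b, ?_⟩⟩
  exact mul_pos (mul_pos ((hB a b).lt_of_ne' hab) (hπ a)) (hπ b)

lemma norm_le_card_mul {p : ℕ} {x : Cov p} {ζ : ℝ} (hx : ∀ r, |x r| ≤ ζ) : ‖x‖ ≤ p * ζ := by
  have h1 : ‖x‖ ≤ ∑ r, |x r| := by
    have := norm_sum_le Finset.univ fun r : Fin p => EuclideanSpace.single r (x r)
    have h2 : ∑ r : Fin p, EuclideanSpace.single r (x r) = x := by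
      ext s
      simp [Finset.sum_apply]
    rw [h2] at this
    simpa using this
  refine h1.trans ((Finset.sum_le_card_nsmul _ _ ζ fun r _ => hx r).trans ?_)
  simp

end PCABM

end

/-! ### The limit theorem -/

theorem mainTheorem2 {K p : ℕ}
    -- model parameters
    (π : Fin K → ℝ) (hπ_pos : ∀ k, 0 < π k) (hπ_sum : ∑ k, π k = 1)
    (Bbar : Matrix (Fin K) (Fin K) ℝ) (hB_symm : Bbar.IsSymm) (hB_nonneg : ∀ a b, 0 ≤ Bbar a b)
    (hB_ne : Bbar ≠ 0)
    (γ₀ : PCABM.Cov p)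
    -- law of the covariates: bounded support and the non-degeneracy at the true coefficient
    (ν : Measure (PCABM.Cov p)) [IsProbabilityMeasure ν]
    (ζ : ℝ) (hζ : 0 < ζ) (hν_bdd : ∀ᵐ x ∂ν, ∀ r, |x r| ≤ ζ)
    (hν_pd : (PCABM.tiltedCov ν γ₀).PosDef)
    -- sparsity
    (ρ : ℕ → ℝ) (hρ_pos : ∀ n, 0 < ρ n) (hρ_zero : Tendsto ρ atTop (𝓝 0))
    (hρ_edges : Tendsto (fun n => PCABM.numPairs n * ρ n) atTop atTop)
    -- for each number of nodes, data from the model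
    {Ω : ℕ → Type*} [∀ n, MeasurableSpace (Ω n)] (P : (n : ℕ) → Measure (Ω n))
    [∀ n, IsProbabilityMeasure (P n)]
    (c e : (n : ℕ) → Ω n → Fin n → Fin K)
    (z : (n : ℕ) → Ω n → Fin n → Fin n → PCABM.Cov p)
    (A : (n : ℕ) → Ω n → Fin n → Fin n → ℕ)
    (hmodel : ∀ n, PCABM.IsPCABM (P n) π (ρ n • Bbar) ν γ₀ (c n) (e n) (z n) (A n))
    -- non-degeneracy of the initial assignment
    (κ₁ κ₂ : ℝ) (hκ₁ : 0 < κ₁) (hκ₁₂ : κ₁ ≤ κ₂) (hκ₂ : κ₂ < 1)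
    (he : ∀ᶠ n : ℕ in atTop, ∀ᵐ ω ∂(P n), ∀ k,
      κ₁ ≤ (PCABM.blockSize (e n ω) k : ℝ) / n ∧ (PCABM.blockSize (e n ω) k : ℝ) / n ≤ κ₂)
    -- the estimator
    (γhat : (n : ℕ) → Ω n → PCABM.Cov p) (hγ_meas : ∀ n, AEMeasurable (γhat n) (P n))
    (hγ_max : ∀ n, ∀ᵐ ω ∂(P n), PCABM.IsArgmax (A n ω) (z n ω) (e n ω) (γhat n ω)) :
    (PCABM.sigmaInf Bbar π ν γ₀).PosDef ∧
    TendstoInDistribution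
      (fun n ω => Real.sqrt (PCABM.numPairs n * ρ n) • (γhat n ω - γ₀)) atTop
      (id : PCABM.Cov p → PCABM.Cov p) P
      (multivariateGaussian 0 (PCABM.sigmaInf Bbar π ν γ₀)⁻¹) := by

  have hpd : (PCABM.sigmaInf Bbar π ν γ₀).PosDef := by
    rw [PCABM.sigmaInf_eq_smul]
    exact hν_pd.smul (PCABM.meanB_pos hπ_pos hB_nonneg hB_ne)
  refine ⟨hpd, ?_⟩
  -- The coordinatewise bound `ζ` becomes the Euclidean bound `p * ζ`.
  have h : PCABM.Regime P π Bbar ν γ₀ ρ c e z A (p * ζ) κ₁ :=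
    { B_symm := hB_symm
      B_nonneg := hB_nonneg
      R_nonneg := by positivity
      bdd := by filter_upwards [hν_bdd] with x hx using PCABM.norm_le_card_mul hx
      ρ_pos := hρ_pos
      ρ_zero := hρ_zero
      ρ_edges := hρ_edges
      model := hmodel
      κ_pos := hκ₁
      blocks := by
        filter_upwards [he] with n hn
        filter_upwards [hn] with ω hω k using (hω k).1 }
  have hmeas : ∀ n, AEMeasurable
      (fun ω => Real.sqrt (PCABM.numPairs n * ρ n) • (γhat n ω - γ₀)) (P n) := fun n =>
    ((hγ_meas n).sub_const γ₀).const_smul (Real.sqrt (PCABM.numPairs n * ρ n))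
  refine ⟨hmeas, aemeasurable_id, ?_⟩
  -- Lévy's continuity theorem reduces convergence in distribution to pointwise convergence of
  -- characteristic functions.
  refine ProbabilityMeasure.tendsto_iff_tendsto_charFun.2 fun t => ?_
  have hlim : charFun ((multivariateGaussian 0 (PCABM.sigmaInf Bbar π ν γ₀)⁻¹).map id) t
      = Complex.exp (-(PCABM.quad (PCABM.sigmaInf Bbar π ν γ₀)⁻¹ t : ℂ) / 2) := by
    rw [Measure.map_id, charFun_multivariateGaussian hpd.inv.posSemidef,
      PCABM.quad_eq_dotProduct, inner_zero_right]
    congr 1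
    push_cast
    ring
  change Tendsto (fun n => charFun ((P n).map _) t) atTop (𝓝 (charFun (Measure.map id _) t))
  rw [hlim]
  refine (h.tendsto_charFun_argmax hpd hγ_meas hγ_max t).congr fun n => ?_
  rw [charFun_apply, integral_map (hmeas n) (by fun_prop)]
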